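/- Let $L/K$ be a cyclic Galois extension of number fields, $[K:\mathbb{Q}]=n$, $[L:K]=d$, $\mathrm{Gal}(L/K)=\langle\theta\rangle$, let $\gamma\in\mathcal{O}_K$, and let $\Lambda=\bigoplus_{i=0}^{d-1}u^i\mathcal{O}_L$ (with $xu=u\theta(x)$ for $x\in\mathcal{O}_L$ and $u^d=\gamma$) be the natural order of the cyclic algebra $(L/K,\theta,\gamma)$. Let $q\ge n+1$ be a prime that splits completely in $K$ and is unramified in $L$, and suppose that no prime of $\mathcal{O}_K$ above $q$ contains $\gamma$. Put $\Lambda_q=\Lambda/q\Lambda$. For $s\in\Lambda_q$ and a probability distribution $\chi$ on $\Lambda_q$, let $\Pi_{s,\chi}$ be the distribution of $(a,\,a s+e)$ with $a\in\Lambda_q$ uniform and $e\leftarrow\chi$ independent. The search CLWE problem asks to recover $s$ from independent samples of $\Pi_{s,\chi}$; the decision problem asks to distinguish independent samples of $\Pi_{s,\chi}$ (with one common secret $s$) from uniformly random samples in $\Lambda_q\times\Lambda_q$. For every fixed $d$ there is a probabilistic polynomial-time reduction, both for the search and for the decision problem, from CLWE with error distribution $\chi$ and secret $s$ uniformly random in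 an arbitrary non-empty set $G\subseteq\Lambda_q$ (for instance $G=\Lambda_q$) to CLWE with error distribution $\chi$ and secret $s'\leftarrow\chi$. More precisely, fix $d$ and a sign $\varepsilon\in\{1,-1\}$. There are, for the search and for the decision problem, fixed oracle programs (probabilistic random access machines with logarithmic cost), and a polynomial $P$, both depending only on $d$ and $\varepsilon$, with the following properties for all data as above. The input consists of $n,d,q$, numbers $\kappa,m\in\mathbb{N}$, and the coordinates of $1$ and the structure constants of $\Lambda_q$ with respect to any $\mathbb{Z}$-basis of $\Lambda$; the oracles are a source of independent samples $(a,b)\in\Lambda_q\times\Lambda_q$ and an arbitrary randomized solver $A$ that takes a list of $m$ samples. 1. The running time is always at most $P(n+\ell(q)+\kappa+m)$, where $\ell(q)$ is the bit length of $q$. 2. For every distribution of the samples and every $A$, the output is distributed exactly as follows: draw at most $\kappa$ samples until one, $(a_1,b_1)$, has $a_1$ invertible in $\Lambda_q$ (output $0$, respectively "reject", if there is none); draw $m$ further samples $(a_i,b_i)$ and give to $A$ the list of the pairs $$\varepsilon\cdot\bigl(a_i a_1^{-1},\; a_i a_1^{-1} b_1-b_i\bigr);$$ if $x$ is the answer of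 $A$, output $a_1^{-1}(b_1-x)$ in the search case and $x$ in the decision case. 3. Suppose that $\varepsilon=-1$, or that $\varepsilon=1$ and $\chi$ is symmetric ($\chi(-x)=\chi(x)$ for all $x$). If $A$ solves search CLWE with secret $s'\leftarrow\chi$ and error distribution $\chi$ from $m$ samples with probability $p$, then for every non-empty $G\subseteq\Lambda_q$ the reduction with solver $A$ solves search CLWE with $s$ uniform in $G$ and error distribution $\chi$ with probability at least $\bigl(1-(1-e^{-d})^{\kappa}\bigr)p$. Likewise, if $A$ has advantage $p$ (the absolute difference of the acceptance probabilities on CLWE samples and on uniform samples) for decision CLWE with $s'\leftarrow\chi$ and error distribution $\chi$, then the reduction has advantage at least $\bigl(1-(1-e^{-d})^{\kappa}\bigr)p$ for decision CLWE with $s$ uniform in $G$ and error distribution $\chi$. -/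

import Mathlib

open scoped NumberField

noncomputable section

/-! ## Cyclic algebras and natural orders -/

/-- The data of a cyclic algebra over a commutative ring `R`: a degree `d`, an automorphism `θ`
with `θ ^ d = 1`, and an element `γ` fixed by `θ`. -/
structure CyclicData (R : Type*) [CommRing R] where
  d : ℕ
  d_pos : 0 < d
  θ : R ≃+* R
  θ_pow : θ ^ d = 1
  γ : R
  θ_γ : θ γ = γ

/-- The ring `R ⊕ u R ⊕ ⋯ ⊕ u ^ (d-1) R` with `x u = u θ(x)` for `x ∈ R` and `u ^ d = γ`;
an element with coefficients `x : Fin d → R` stands for `∑ i, u ^ i * x i`. -/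
@[ext]
structure CyclicAlgebra {R : Type*} [CommRing R] (D : CyclicData R) where
  coeff : Fin D.d → R

namespace CyclicAlgebra

variable {R : Type*} [CommRing R] {D : CyclicData R}

instance : Zero (CyclicAlgebra D) := ⟨⟨0⟩⟩
instance : Add (CyclicAlgebra D) := ⟨fun x y => ⟨x.coeff + y.coeff⟩⟩
instance : Neg (CyclicAlgebra D) := ⟨fun x => ⟨-x.coeff⟩⟩
instance : Sub (CyclicAlgebra D) := ⟨fun x y => ⟨x.coeff - y.coeff⟩⟩
instance : SMul ℕ (CyclicAlgebra D) := ⟨fun n x => ⟨n • x.coeff⟩⟩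
instance : SMul ℤ (CyclicAlgebra D) := ⟨fun n x => ⟨n • x.coeff⟩⟩

theorem coeff_injective : Function.Injective (coeff : CyclicAlgebra D → Fin D.d → R) :=
  fun _ _ h => CyclicAlgebra.ext h

instance : AddCommGroup (CyclicAlgebra D) :=
  coeff_injective.addCommGroup _ rfl (fun _ _ => rfl) (fun _ => rfl) (fun _ _ => rfl)
    (fun _ _ => rfl) (fun _ _ => rfl)

/-- The coefficient vector, as an additive isomorphism. -/
def coeffEquiv (D : CyclicData R) : CyclicAlgebra D ≃+ (Fin D.d → R) where
  toFun := coeff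
  invFun := mk
  left_inv _ := rfl
  right_inv _ := rfl
  map_add' _ _ := rfl

/-- The element `u ^ k * r`, for an arbitrary `k : ℕ`, brought to normal form by `u ^ d = γ`. -/
def mono (D : CyclicData R) (k : ℕ) (r : R) : CyclicAlgebra D :=
  ⟨Pi.single (⟨k % D.d, Nat.mod_lt k D.d_pos⟩ : Fin D.d) (D.γ ^ (k / D.d) * r)⟩

instance : One (CyclicAlgebra D) := ⟨mono D 0 1⟩

/-- `(∑ i, u ^ i x_i) * (∑ j, u ^ j y_j) = ∑ i, ∑ j, u ^ (i + j) θ ^ j (x_i) y_j`. -/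
instance : Mul (CyclicAlgebra D) :=
  ⟨fun x y => ∑ i : Fin D.d, ∑ j : Fin D.d,
    mono D ((i : ℕ) + j) ((D.θ ^ (j : ℕ)) (x.coeff i) * y.coeff j)⟩

theorem mul_def (x y : CyclicAlgebra D) : x * y = ∑ i : Fin D.d, ∑ j : Fin D.d,
    mono D ((i : ℕ) + j) ((D.θ ^ (j : ℕ)) (x.coeff i) * y.coeff j) := rfl

theorem one_def : (1 : CyclicAlgebra D) = mono D 0 1 := rfl

@[simp] theorem coeff_add (x y : CyclicAlgebra D) : (x + y).coeff = x.coeff + y.coeff := rfl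

@[simp] theorem coeff_zero : (0 : CyclicAlgebra D).coeff = 0 := rfl

theorem mono_add (k : ℕ) (r s : R) : mono D k (r + s) = mono D k r + mono D k s := by
  ext1
  simp only [mono, mul_add, Pi.single_add, coeff_add]

@[simp] theorem mono_zero (k : ℕ) : mono D k (0 : R) = 0 := by
  ext1
  simp [mono]

theorem θ_pow_γ (k : ℕ) : (D.θ ^ k) D.γ = D.γ := by
  induction k with
  | zero => simp
  | succ k ih => rw [pow_succ, RingAut.mul_apply, D.θ_γ, ih]

theorem θ_pow_mod (k : ℕ) : D.θ ^ (k % D.d) = D.θ ^ k := by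
  conv_rhs => rw [← Nat.mod_add_div k D.d, pow_add, pow_mul, D.θ_pow, one_pow, mul_one]

theorem mono_add_d (k : ℕ) (t : ℕ) (r : R) :
    mono D (k + D.d * t) r = mono D k (D.γ ^ t * r) := by
  simp only [mono]
  congr 2
  · simp
  · rw [Nat.add_mul_div_left _ _ D.d_pos, pow_add]; ring

theorem coeff_sum {ι : Type*} (s : Finset ι) (f : ι → CyclicAlgebra D) :
    (∑ i ∈ s, f i).coeff = ∑ i ∈ s, (f i).coeff :=
  map_sum (coeffEquiv D) f s

theorem sum_mono (x : CyclicAlgebra D) :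
    ∑ i : Fin D.d, mono D (i : ℕ) (x.coeff i) = x := by
  ext1
  rw [coeff_sum]
  have h : ∀ i : Fin D.d, (mono D (i : ℕ) (x.coeff i)).coeff = Pi.single i (x.coeff i) := by
    intro i
    simp only [mono]
    have h1 : (⟨(i : ℕ) % D.d, Nat.mod_lt _ D.d_pos⟩ : Fin D.d) = i :=
      Fin.ext (Nat.mod_eq_of_lt i.2)
    rw [h1, Nat.div_eq_of_lt i.2]
    simp
  simp only [h]
  exact Finset.univ_sum_single x.coeff

theorem cmul_add (x y z : CyclicAlgebra D) : x * (y + z) = x * y + x * z := by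
  simp only [mul_def, coeff_add, Pi.add_apply, mul_add, mono_add, Finset.sum_add_distrib]

theorem cadd_mul (x y z : CyclicAlgebra D) : (x + y) * z = x * z + y * z := by
  simp only [mul_def, coeff_add, Pi.add_apply, map_add, add_mul, mono_add,
    Finset.sum_add_distrib]

theorem cmul_zero (x : CyclicAlgebra D) : x * 0 = 0 := by
  simp [mul_def]

theorem czero_mul (x : CyclicAlgebra D) : 0 * x = 0 := by
  simp [mul_def]

/-- The multiplication rule on monomials. -/
theorem mono_mul_mono (k l : ℕ) (r s : R) :
    mono D k r * mono D l s = mono D (k + l) ((D.θ ^ l) r * s) := by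
  have key : mono D k r * mono D l s
      = mono D (k % D.d + l % D.d) ((D.θ ^ (l % D.d)) (D.γ ^ (k / D.d) * r)
          * (D.γ ^ (l / D.d) * s)) := by
    rw [mul_def]
    rw [Finset.sum_eq_single (⟨k % D.d, Nat.mod_lt k D.d_pos⟩ : Fin D.d),
      Finset.sum_eq_single (⟨l % D.d, Nat.mod_lt l D.d_pos⟩ : Fin D.d)]
    · simp only [mono, Pi.single_eq_same]
    · intro j _ hj
      have : (mono D l s).coeff j = 0 := by simp [mono, Pi.single_eq_of_ne hj]
      simp [this]
    · simp
    · intro i _ hi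
      have : (mono D k r).coeff i = 0 := by simp [mono, Pi.single_eq_of_ne hi]
      simp [this]
    · simp
  rw [key, θ_pow_mod, map_mul, map_pow, θ_pow_γ]
  have e : k + l = (k % D.d + l % D.d) + D.d * (k / D.d + l / D.d) := by
    have h1 := Nat.mod_add_div k D.d
    have h2 := Nat.mod_add_div l D.d
    rw [mul_add]; omega
  rw [e, mono_add_d, pow_add]
  congr 1
  ring

theorem csum_mul {ι : Type*} (s : Finset ι) (f : ι → CyclicAlgebra D) (y : CyclicAlgebra D) :
    (∑ i ∈ s, f i) * y = ∑ i ∈ s, f i * y := by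
  classical
  induction s using Finset.induction_on with
  | empty => simp [czero_mul]
  | insert a s ha ih => rw [Finset.sum_insert ha, Finset.sum_insert ha, cadd_mul, ih]

theorem cmul_sum {ι : Type*} (s : Finset ι) (f : ι → CyclicAlgebra D) (y : CyclicAlgebra D) :
    y * (∑ i ∈ s, f i) = ∑ i ∈ s, y * f i := by
  classical
  induction s using Finset.induction_on with
  | empty => simp [cmul_zero]
  | insert a s ha ih => rw [Finset.sum_insert ha, Finset.sum_insert ha, cmul_add, ih]

theorem cmul_assoc (x y z : CyclicAlgebra D) : x * y * z = x * (y * z) := by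
  rw [← sum_mono x, ← sum_mono y, ← sum_mono z]
  simp only [csum_mul, cmul_sum, mono_mul_mono]
  refine Finset.sum_congr rfl fun k _ => Finset.sum_congr rfl fun j _ =>
    Finset.sum_congr rfl fun i _ => ?_
  rw [map_mul, ← RingAut.mul_apply, ← pow_add, add_assoc, mul_assoc]
  simp only [add_comm]

theorem cone_mul (x : CyclicAlgebra D) : 1 * x = x := by
  conv_rhs => rw [← sum_mono x]
  conv_lhs => rw [← sum_mono x, one_def]
  simp [cmul_sum, mono_mul_mono]

theorem cmul_one (x : CyclicAlgebra D) : x * 1 = x := by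
  conv_rhs => rw [← sum_mono x]
  conv_lhs => rw [← sum_mono x, one_def]
  simp [csum_mul, mono_mul_mono]

instance : Ring (CyclicAlgebra D) :=
  { (inferInstance : AddCommGroup (CyclicAlgebra D)) with
    left_distrib := cmul_add
    right_distrib := cadd_mul
    zero_mul := czero_mul
    mul_zero := cmul_zero
    mul_assoc := cmul_assoc
    one_mul := cone_mul
    mul_one := cmul_one }

end CyclicAlgebra

/-- The data of the natural order `⊕ u ^ i 𝓞 L` of the cyclic algebra `(L/K, θ, γ)`. -/
def naturalData {K L : Type*} [Field K] [NumberField K] [Field L] [NumberField L] [Algebra K L]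
    [IsGalois K L] (θ : L ≃ₐ[K] L) (γ : 𝓞 K) : CyclicData (𝓞 L) where
  d := Module.finrank K L
  d_pos := Module.finrank_pos
  θ := NumberField.RingOfIntegers.mapRingEquiv θ.toRingEquiv
  θ_pow := by
    have h : θ ^ Module.finrank K L = 1 := by
      rw [← IsGalois.card_aut_eq_finrank K L]
      exact pow_card_eq_one'
    have h2 : ∀ (k : ℕ) (x : 𝓞 L),
        (((NumberField.RingOfIntegers.mapRingEquiv θ.toRingEquiv ^ k : 𝓞 L ≃+* 𝓞 L) x : 𝓞 L) : L)
          = (θ ^ k) (x : L) := by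
      intro k
      induction k with
      | zero => intro x; simp
      | succ k ih =>
        intro x
        rw [pow_succ, pow_succ, RingAut.mul_apply, ih, AlgEquiv.mul_apply]
        rfl
    ext x
    rw [h2, h]
    rfl
  γ := algebraMap (𝓞 K) (𝓞 L) γ
  θ_γ := by
    ext
    exact θ.commutes (γ : K)

/-- The natural order `Λ = ⊕ u ^ i 𝓞 L` of the cyclic algebra `(L/K, θ, γ)`. -/
abbrev NaturalOrder {K L : Type*} [Field K] [NumberField K] [Field L] [NumberField L]
    [Algebra K L] [IsGalois K L] (θ : L ≃ₐ[K] L) (γ : 𝓞 K) : Type _ :=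
  CyclicAlgebra (naturalData θ γ)

instance span_natCast_isTwoSided {S : Type*} [Ring S] (q : ℕ) :
    (Ideal.span {(q : S)}).IsTwoSided where
  mul_mem_of_left {a} b ha := by
    rw [Ideal.mem_span_singleton'] at ha ⊢
    obtain ⟨c, rfl⟩ := ha
    exact ⟨c * b, by rw [mul_assoc, mul_assoc, (Nat.cast_commute q b).eq]⟩

/-- The quotient `S_q = S / q S`. -/
abbrev ModQ (S : Type*) [Ring S] (q : ℕ) : Type _ := S ⧸ Ideal.span {(q : S)}

instance naturalOrder_modQ_finite {K L : Type*} [Field K] [NumberField K] [Field L]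
    [NumberField L] [Algebra K L] [IsGalois K L] (θ : L ≃ₐ[K] L) (γ : 𝓞 K) (q : ℕ) [NeZero q] :
    Finite (ModQ (NaturalOrder θ γ) q) := by
  have h1 : Module.Finite ℤ (NaturalOrder θ γ) :=
    Module.Finite.equiv (CyclicAlgebra.coeffEquiv (naturalData θ γ)).symm.toIntLinearEquiv
  have h2 : Module.Finite ℤ (ModQ (NaturalOrder θ γ) q) :=
    Module.Finite.of_surjective
      (Ideal.Quotient.mk (Ideal.span {(q : NaturalOrder θ γ)})).toAddMonoidHom.toIntLinearMap
      Ideal.Quotient.mk_surjective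
  refine Module.finite_of_fg_torsion _ fun x => ?_
  refine ⟨⟨(q : ℤ), mem_nonZeroDivisors_of_ne_zero (by exact_mod_cast NeZero.ne q)⟩, ?_⟩
  have hq : ((q : ℕ) : ModQ (NaturalOrder θ γ) q) = 0 := by
    have := Ideal.Quotient.eq_zero_iff_mem.2
      (Ideal.mem_span_singleton_self (q : NaturalOrder θ γ))
    simpa using this
  show (q : ℤ) • x = 0
  rw [zsmul_eq_mul]
  simp [hq]

/-! ## CLWE distributions and problems, over a finite ring `S` (later `S = Λ_q`) -/

section CLWE

/-- The uniform distribution on a finite type. -/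
def unif (S : Type*) [Finite S] [Nonempty S] : PMF S :=
  letI := Fintype.ofFinite S
  PMF.uniformOfFintype S

/-- `m` independent samples from `D`. -/
def iid {X : Type*} (D : PMF X) : ℕ → PMF (List X)
  | 0 => PMF.pure []
  | m + 1 => D.bind fun x => (iid D m).map fun xs => x :: xs

variable {S : Type*} [Ring S] [Finite S]

/-- The CLWE distribution with secret `s` and error distribution `χ`: pairs `(a, a * s + e)` with
`a` uniform and `e ← χ` independent. -/
def clweDist (s : S) (χ : PMF S) : PMF (S × S) :=
  (unif S).bind fun a => χ.map fun e => (a, a * s + e)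

/-- The success probability for the search problem of an algorithm with access to a sample
distribution, when the secret is drawn from `σ` and the errors from `χ`. -/
def searchSuccess (σ χ : PMF S) (alg : PMF (S × S) → PMF S) : ℝ :=
  ((σ.bind fun s => (alg (clweDist s χ)).map fun x => (s, x)).toOuterMeasure
    {p | p.2 = p.1}).toReal

/-- The advantage for the decision problem of an algorithm with access to a sample distribution:
the difference between its acceptance probabilities on CLWE samples, with secret drawn from `σ`
and errors from `χ`, and on uniformly random samples. -/
def decisionAdvantage (σ χ : PMF S) (alg : PMF (S × S) → PMF Bool) : ℝ :=
  |((σ.bind fun s => alg (clweDist s χ)) true).toReal - (alg (unif (S × S)) true).toReal|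

/-- An algorithm that works on lists of samples, run on `m` independent samples. -/
def onSamples {α : Type*} (m : ℕ) (A : List (S × S) → PMF α) (D : PMF (S × S)) : PMF α :=
  (iid D m).bind A

/-! ## The transformation to normal form -/

open Classical in
/-- Draw at most `κ` samples until one `(a₁, b₁)` has `a₁` invertible. -/
def findUnit (D : PMF (S × S)) : ℕ → PMF (Option (Sˣ × S))
  | 0 => PMF.pure none
  | κ + 1 => D.bind fun p =>
      if h : IsUnit p.1 then PMF.pure (some (h.unit, p.2)) else findUnit D κ

/-- For `ε = 1` the map `(a, b) ↦ (a a₁⁻¹, a a₁⁻¹ b₁ - b)`; for `ε = -1` its negative. -/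
def transform (ε : ℤˣ) (a₁ : Sˣ) (b₁ : S) (p : S × S) : S × S :=
  ((ε : ℤ) • (p.1 * (↑a₁⁻¹ : S)), (ε : ℤ) • (p.1 * (↑a₁⁻¹ : S) * b₁ - p.2))

/-- Find a sample `(a₁, b₁)` with `a₁` invertible among at most `κ` samples (return `fail` if
there is none), draw `m` fresh samples, transform them, give them to `A`, and postprocess the
answer. -/
def normalFormExperiment {α : Type*} (ε : ℤˣ) (κ m : ℕ) (A : List (S × S) → PMF α) (fail : α)
    (post : Sˣ → S → α → α) (D : PMF (S × S)) : PMF α :=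
  (findUnit D κ).bind fun r => match r with
    | none => PMF.pure fail
    | some (a₁, b₁) => (iid D m).bind fun xs =>
        (A (xs.map (transform ε a₁ b₁))).map (post a₁ b₁)

/-- For the search problem, an answer `x` for the new secret is turned into the answer
`a₁⁻¹ (b₁ - x)` for the old one. -/
def normalFormSearch (ε : ℤˣ) (κ m : ℕ) (A : List (S × S) → PMF S) :
    PMF (S × S) → PMF S :=
  normalFormExperiment ε κ m A 0 fun a₁ b₁ x => (↑a₁⁻¹ : S) * (b₁ - x)

/-- For the decision problem, the answer is returned unchanged. -/
def normalFormDecision (ε : ℤˣ) (κ m : ℕ) (A : List (S × S) → PMF Bool) :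
    PMF (S × S) → PMF Bool :=
  normalFormExperiment ε κ m A false fun _ _ x => x

end CLWE

/-! ## A probabilistic random access machine with oracles and logarithmic cost -/

namespace RAM

/-- Arithmetic expressions over the memory `ℕ → ℕ`; `load e` is the content of cell `e`;
subtraction is truncated. -/
inductive Expr where
  | const (n : ℕ)
  | load (e : Expr)
  | add (e f : Expr)
  | sub (e f : Expr)
  | mul (e f : Expr)
  | div (e f : Expr)
  | mod (e f : Expr)

def Expr.eval (mem : ℕ → ℕ) : Expr → ℕ
  | const n => n
  | load e => mem (e.eval mem)
  | add e f => e.eval mem + f.eval mem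
  | sub e f => e.eval mem - f.eval mem
  | mul e f => e.eval mem * f.eval mem
  | div e f => e.eval mem / f.eval mem
  | mod e f => e.eval mem % f.eval mem

/-- Logarithmic cost: every node costs one plus the bit length of its value. -/
def Expr.cost (mem : ℕ → ℕ) : Expr → ℕ
  | const n => 1 + n.size
  | load e => 1 + (mem (e.eval mem)).size + e.cost mem
  | add e f => 1 + (e.eval mem + f.eval mem).size + e.cost mem + f.cost mem
  | sub e f => 1 + (e.eval mem - f.eval mem).size + e.cost mem + f.cost mem
  | mul e f => 1 + (e.eval mem * f.eval mem).size + e.cost mem + f.cost mem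
  | div e f => 1 + (e.eval mem / f.eval mem).size + e.cost mem + f.cost mem
  | mod e f => 1 + (e.eval mem % f.eval mem).size + e.cost mem + f.cost mem

/-- Programs. `assign dst e` stores the value of `e` in the cell `dst`; `ite` and `loop` test
whether an expression is non-zero; `flip dst` stores a fair random bit; `sample dst` obtains a
fresh reply of the sample oracle; `solve src len dst` sends the `len` cells from `src` on to the
solver oracle. Replies of oracles are stored from the cell `dst` on. -/
inductive Cmd where
  | skip
  | assign (dst e : Expr)
  | seq (c₁ c₂ : Cmd)
  | ite (e : Expr) (c₁ c₂ : Cmd)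
  | loop (e : Expr) (c : Cmd)
  | flip (dst : Expr)
  | sample (dst : Expr)
  | solve (src len dst : Expr)

structure Oracles where
  sample : PMF (List ℕ)
  solver : List ℕ → PMF (List ℕ)

/-- The commands that remain to be executed, the memory, and the time used so far. -/
structure Config where
  todo : List Cmd
  mem : ℕ → ℕ
  time : ℕ

/-- The `len` memory cells from `src` on. -/
def readMem (mem : ℕ → ℕ) (src len : ℕ) : List ℕ :=
  (List.range len).map fun i => mem (src + i)

/-- Store the list `l` from the cell `dst` on. -/
def writeMem (mem : ℕ → ℕ) (dst : ℕ) (l : List ℕ) : ℕ → ℕ :=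
  fun k => if dst ≤ k ∧ k < dst + l.length then l.getD (k - dst) 0 else mem k

/-- The cost of transferring a list to or from an oracle. -/
def listCost (l : List ℕ) : ℕ := (l.map fun x => 1 + x.size).sum

/-- One step of the computation; a configuration without remaining commands is final. -/
def step (O : Oracles) : Config → PMF Config
  | ⟨[], mem, t⟩ => PMF.pure ⟨[], mem, t⟩
  | ⟨.skip :: k, mem, t⟩ => PMF.pure ⟨k, mem, t + 1⟩
  | ⟨.assign dst e :: k, mem, t⟩ =>
      PMF.pure ⟨k, Function.update mem (dst.eval mem) (e.eval mem),
        t + dst.cost mem + e.cost mem⟩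
  | ⟨.seq c₁ c₂ :: k, mem, t⟩ => PMF.pure ⟨c₁ :: c₂ :: k, mem, t + 1⟩
  | ⟨.ite e c₁ c₂ :: k, mem, t⟩ =>
      PMF.pure ⟨(if e.eval mem ≠ 0 then c₁ else c₂) :: k, mem, t + e.cost mem⟩
  | ⟨.loop e c :: k, mem, t⟩ =>
      PMF.pure ⟨if e.eval mem ≠ 0 then c :: .loop e c :: k else k, mem, t + e.cost mem⟩
  | ⟨.flip dst :: k, mem, t⟩ =>
      (PMF.uniformOfFintype Bool).map fun b =>
        ⟨k, Function.update mem (dst.eval mem) b.toNat, t + 1 + dst.cost mem⟩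
  | ⟨.sample dst :: k, mem, t⟩ =>
      O.sample.map fun r =>
        ⟨k, writeMem mem (dst.eval mem) r, t + 1 + dst.cost mem + listCost r⟩
  | ⟨.solve src len dst :: k, mem, t⟩ =>
      let query := readMem mem (src.eval mem) (len.eval mem)
      (O.solver query).map fun r =>
        ⟨k, writeMem mem (dst.eval mem) r,
          t + 1 + src.cost mem + len.cost mem + dst.cost mem + listCost query + listCost r⟩

/-- The distribution of the configuration after `t` steps. -/
def run (O : Oracles) : ℕ → Config → PMF Config
  | 0, c => PMF.pure c
  | t + 1, c => (step O c).bind (run O t)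

/-- The program `R` on an input that is stored from the cell `0` on. -/
def start (R : Cmd) (input : List ℕ) : Config := ⟨[R], writeMem (fun _ => 0) 0 input, 0⟩

/-- With every random outcome, `R` terminates within time `T`. (Every step costs at least one
unit of time, so that `T` steps suffice.) -/
def HaltsWithin (O : Oracles) (R : Cmd) (input : List ℕ) (T : ℕ) : Prop :=
  ∀ c ∈ (run O T (start R input)).support, c.todo = [] ∧ c.time ≤ T

end RAM

/-! ## Reductions between CLWE problems as programs -/

section Coding

variable {S : Type*} [Ring S] {N : ℕ}

/-- The coordinates in `{0, …, q - 1}` of an element of `S / q S` with respect to a `ℤ`-basis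
of `S`. -/
def encode (B : Module.Basis (Fin N) ℤ S) (q : ℕ) (x : ModQ S q) : List ℕ :=
  List.ofFn fun i => (B.repr (Function.surjInv Ideal.Quotient.mk_surjective x) i % (q : ℤ)).toNat

def encodePair (B : Module.Basis (Fin N) ℤ S) (q : ℕ) (p : ModQ S q × ModQ S q) : List ℕ :=
  encode B q p.1 ++ encode B q p.2

/-- The element of `S / q S` whose coordinates are the `N` entries of `l` from position `o` on. -/
def decode (B : Module.Basis (Fin N) ℤ S) (q : ℕ) (l : List ℕ) (o : ℕ) : ModQ S q :=
  Ideal.Quotient.mk _ (∑ i : Fin N, l.getD (o + i) 0 • B i)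

/-- The first `m` pairs in a list of coordinates. -/
def decodePairs (B : Module.Basis (Fin N) ℤ S) (q m : ℕ) (l : List ℕ) :
    List (ModQ S q × ModQ S q) :=
  (List.range m).map fun j => (decode B q l (2 * N * j), decode B q l (2 * N * j + N))

/-- The input of a reduction: the numbers `n, d, q, κ, m`, the coordinates of `1`, and the
structure constants of the ring `S / q S`. -/
def instanceInput (B : Module.Basis (Fin N) ℤ S) (n d q κ m : ℕ) : List ℕ :=
  [n, d, q, κ, m] ++ encode B q 1 ++
    (List.ofFn fun i => (List.ofFn fun j =>
      encode B q (Ideal.Quotient.mk _ (B i * B j))).flatten).flatten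

/-- Oracle access to samples from `D` and to a solver `A` of the search problem that uses `m`
samples. -/
def searchOracles (B : Module.Basis (Fin N) ℤ S) (q m : ℕ)
    (A : List (ModQ S q × ModQ S q) → PMF (ModQ S q)) (D : PMF (ModQ S q × ModQ S q)) :
    RAM.Oracles where
  sample := D.map (encodePair B q)
  solver l := (A (decodePairs B q m l)).map (encode B q)

/-- Oracle access to samples from `D` and to a solver `A` of the decision problem that uses `m`
samples. -/
def decisionOracles (B : Module.Basis (Fin N) ℤ S) (q m : ℕ)
    (A : List (ModQ S q × ModQ S q) → PMF Bool) (D : PMF (ModQ S q × ModQ S q)) :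
    RAM.Oracles where
  sample := D.map (encodePair B q)
  solver l := (A (decodePairs B q m l)).map fun b => [b.toNat]

/-- The element of `S / q S` that the program `R` leaves in the cells `0, …, N - 1` after `T`
steps. -/
def searchOutput (B : Module.Basis (Fin N) ℤ S) (n d q κ m : ℕ) (R : RAM.Cmd) (T : ℕ)
    (A : List (ModQ S q × ModQ S q) → PMF (ModQ S q)) (D : PMF (ModQ S q × ModQ S q)) :
    PMF (ModQ S q) :=
  (RAM.run (searchOracles B q m A D) T (RAM.start R (instanceInput B n d q κ m))).map
    fun c => decode B q (RAM.readMem c.mem 0 N) 0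

/-- The bit that the program `R` leaves in the cell `0` after `T` steps. -/
def decisionOutput (B : Module.Basis (Fin N) ℤ S) (n d q κ m : ℕ) (R : RAM.Cmd) (T : ℕ)
    (A : List (ModQ S q × ModQ S q) → PMF Bool) (D : PMF (ModQ S q × ModQ S q)) :
    PMF Bool :=
  (RAM.run (decisionOracles B q m A D) T (RAM.start R (instanceInput B n d q κ m))).map
    fun c => decide (c.mem 0 ≠ 0)

end Coding

end

/-!
The reduction is analysed in three independent parts.

*Security.* If `b₁ = a₁ s + e₁` with `a₁` invertible, the map `(a, a s + e) ↦ ± (a a₁⁻¹, a a₁⁻¹ b₁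
- (a s + e)) = ± (a a₁⁻¹, (a a₁⁻¹) e₁ - e)` turns the samples with secret `s` into samples with
secret `e₁`, because `a ↦ ± a a₁⁻¹` permutes the ring and the error distribution is preserved
(`clweDist_map_transform`). As the error of the first sample with invertible `a₁` is still
distributed according to `χ`, the only loss is the probability that no invertible `a₁` occurs among
`κ` samples (`findUnit_bind_apply`). Uniform samples are samples with uniform errors, which are
symmetric, so that the same computation applies to both terms of the advantage
(`searchSuccess_normalForm`, `decisionAdvantage_normalForm`).

*Density of units.* A random element of `Λ / qΛ` is invertible with probability at least `exp (-d)`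
(`exp_neg_le_unit_density`). As `q` is unramified, the inertia groups at `q` are trivial, so that
for `0 < i < d` the elements `y - θ ^ i y` generate the unit ideal modulo `q`. Comparison of left
and right multiplication by `y` then shows that a two-sided ideal above `q` contains the
coefficients of its elements, and that central elements of `Λ / qΛ` are constants fixed by `θ`;
here `γ` has to be invertible modulo `q`. It follows that `Λ / qΛ` is semisimple
(`CyclicAlgebra.isSemisimpleRing_modQ`), with at most as many simple factors as there are primes of
`K` above `q` (`card_central_idempotents_le`). So it is a product of `J ≤ n` matrix rings of sizes
`kᵢ` over fields with at least `q` elements, where `∑ kᵢ² ≤ n d²`, hence `∑ kᵢ ≤ n d`, and a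
proportion of at least `(1 - 1 / q) ^ (n d) ≥ exp (-d)` of its elements is invertible
(`unit_density_of_isSemisimpleRing`, `exp_neg_le_pow`).

*The programs.* Elements of `Λ / qΛ` are represented by their coordinates, and multiplied by means
of the structure constants (`RAM.exec_mul`). Inversion needs no linear algebra: by the regular
representation the units form a subgroup of `GL_N(𝔽_q)`, so that with its order `g` an element `a`
is invertible if and only if `a * a ^ (g - 1) = 1`, and then `a ^ (g - 1)` is its inverse
(`isUnit_iff_mul_pow_eq_one`, `inv_eq_pow`). The number `g` has at most `N ^ 2` times the length of
`q` as its length, whence square-and-multiply takes polynomial time (`RAM.exec_unit`).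

The memory is divided into the input, a buffer, the query to the solver, and interleaved arrays
above them, whose starting point is kept in the cell `0`. `RAM.Exec` describes deterministic
commands and `RAM.Halts` randomized ones; in both, time is counted in units of length `w + 1`,
where `w` (`RAM.width`) bounds the length of all numbers in the memory, so that an expression of
fixed shape costs a constant number of units. `RAM.halts_main` shows that the program realizes the
experiment, and `RAM.exists_mainTime_le` that its time is polynomial.
-/

noncomputable section

/-! ### The transformation and the distributions -/

section Security

theorem unif_apply {T : Type*} [Finite T] [Nonempty T] (a : T) :
    unif T a = (Nat.card T : ENNReal)⁻¹ := by
  let _ := Fintype.ofFinite T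
  simp [unif, PMF.uniformOfFintype_apply, Nat.card_eq_fintype_card]

theorem unif_map_equiv {T U : Type*} [Finite T] [Nonempty T] [Finite U] [Nonempty U]
    (e : T ≃ U) : (unif T).map e = unif U := by
  ext y
  rw [PMF.map_apply, tsum_eq_single (e.symm y)]
  · simp [unif_apply, Nat.card_congr e]
  · intro x hx
    rw [if_neg]
    rintro rfl
    simp at hx

theorem iid_map {X Y : Type*} (D : PMF X) (f : X → Y) (m : ℕ) :
    (iid D m).map (List.map f) = iid (D.map f) m := by
  induction m with
  | zero => simp [iid, PMF.pure_map]
  | succ m ih =>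
    rw [iid, iid, PMF.map_bind, PMF.bind_map]
    congr 1
    funext x
    rw [Function.comp_apply, ← ih, PMF.map_comp, PMF.map_comp]
    rfl

variable {S : Type*} [Ring S] [Finite S]

theorem clweDist_unif (s : S) : clweDist s (unif S) = unif (S × S) := by
  have h : ∀ a : S, (unif S).map (fun e => (a, a * s + e)) = (unif S).map (fun e => (a, e)) := by
    intro a
    conv_rhs => rw [← unif_map_equiv (Equiv.addLeft (a * s)), PMF.map_comp]
    rfl
  ext ⟨a, b⟩
  simp only [clweDist, h, PMF.bind_apply, PMF.map_apply, unif_apply, Prod.mk.injEq]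
  rw [tsum_eq_single a, tsum_eq_single b]
  · simp [Nat.card_prod, ENNReal.mul_inv]
  · intro b' hb'
    simp [hb'.symm]
  · intro a' ha'
    simp [ha'.symm]

/-- The transformation to normal form turns the error `b₁ - a₁ s` of the first sample into the
new secret. -/
theorem clweDist_map_transform (ε : ℤˣ) (s b₁ : S) (a₁ : Sˣ) (χ : PMF S)
    (h : ε = -1 ∨ ∀ x, χ (-x) = χ x) :
    (clweDist s χ).map (transform ε a₁ b₁) = clweDist (b₁ - a₁ * s) χ := by
  have hχ : χ.map (fun e => -((ε : ℤ) • e)) = χ := by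
    rcases Int.units_eq_one_or ε with rfl | rfl
    · have h' : ∀ x, χ (-x) = χ x := by
        rcases h with h | h
        · exact absurd h (by decide)
        · exact h
      ext y
      rw [PMF.map_apply, tsum_eq_single (-y)]
      · simp [h']
      · intro x hx
        rw [if_neg]
        rintro rfl
        simp at hx
    · have h1 : (fun e : S => -(((-1 : ℤˣ) : ℤ) • e)) = id := by
        funext e
        simp
      rw [h1, PMF.map_id]
  -- `a ↦ ε a a₁⁻¹` is a permutation of the ring, so that the first entry stays uniform.
  let σ : S ≃ S :=
    { toFun := fun a => (ε : ℤ) • (a * (↑a₁⁻¹ : S))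
      invFun := fun a => (ε : ℤ) • (a * (a₁ : S))
      left_inv := fun a => by
        rcases Int.units_eq_one_or ε with rfl | rfl <;> simp
      right_inv := fun a => by
        rcases Int.units_eq_one_or ε with rfl | rfl <;> simp }
  conv_rhs => rw [clweDist, ← unif_map_equiv σ, PMF.bind_map]
  rw [clweDist, PMF.map_bind]
  congr 1
  funext a
  conv_rhs => rw [Function.comp_apply, ← hχ]
  rw [PMF.map_comp, PMF.map_comp]
  congr 1
  funext e
  simp only [Function.comp_apply, transform, σ, Equiv.coe_fn_mk, Prod.mk.injEq, true_and,
    smul_mul_assoc, mul_sub, smul_sub, smul_add, mul_assoc, Units.inv_mul_cancel_left]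
  abel

/-! ### Search for an invertible sample -/

/-- The proportion of non-units in a finite ring. -/
def nonunitMass (S : Type*) [Ring S] [Finite S] : ENNReal :=
  open Classical in ∑' a, unif S a * if IsUnit a then 0 else 1

/-- The proportion of units in a finite ring. -/
def unitMass (S : Type*) [Ring S] [Finite S] : ENNReal :=
  open Classical in ∑' a, unif S a * if IsUnit a then 1 else 0

theorem unitMass_add_nonunitMass : unitMass S + nonunitMass S = 1 := by
  classical
  rw [unitMass, nonunitMass, ← ENNReal.tsum_add, ← (unif S).tsum_coe]
  congr 1
  funext a
  by_cases h : IsUnit a <;> simp [h]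

theorem unitMass_toReal : (unitMass S).toReal = (Nat.card Sˣ : ℝ) / Nat.card S := by
  classical
  let _ := Fintype.ofFinite S
  have : unitMass S = (Nat.card Sˣ : ENNReal) * (Nat.card S : ENNReal)⁻¹ := by
    rw [unitMass, tsum_fintype]
    simp only [unif_apply, mul_ite, mul_one, mul_zero]
    rw [Finset.sum_ite, Finset.sum_const, Finset.sum_const_zero, add_zero, nsmul_eq_mul]
    congr 2
    rw [← Fintype.card_subtype, ← Nat.card_eq_fintype_card]
    refine Nat.card_congr (Equiv.ofBijective (fun u : Sˣ => (⟨u, u.isUnit⟩ : {a : S // IsUnit a}))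
      ⟨fun u v h => Units.ext (congrArg Subtype.val h), fun a => ⟨a.2.unit, rfl⟩⟩).symm
  rw [this]
  simp [div_eq_mul_inv]

/-- What follows the search for an invertible sample is run on a secret drawn from the error
distribution, up to the probability that the search fails. -/
theorem findUnit_bind_apply {α : Type*} (s : S) (χ : PMF S) (k : Option (Sˣ × S) → PMF α)
    (ψ : S → PMF α) (hk : ∀ a₁ b₁, k (some (a₁, b₁)) = ψ (b₁ - a₁ * s)) (y : α) (κ : ℕ) :
    ((findUnit (clweDist s χ) κ).bind k) y + nonunitMass S ^ κ * (χ.bind ψ) y =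
      (χ.bind ψ) y + nonunitMass S ^ κ * k none y := by
  classical
  induction κ with
  | zero => simp [findUnit, add_comm]
  | succ κ ih =>
    have h : ((findUnit (clweDist s χ) (κ + 1)).bind k) =
        (unif S).bind fun a => if IsUnit a then χ.bind ψ
          else (findUnit (clweDist s χ) κ).bind k := by
      rw [findUnit, PMF.bind_bind, clweDist, PMF.bind_bind]
      congr 1
      funext a
      rw [PMF.bind_map]
      split_ifs with ha
      · congr 1
        funext e
        simp [ha, PMF.pure_bind, hk]
      · ext z
        simp [ha, PMF.bind_apply, ENNReal.tsum_mul_right, PMF.tsum_coe]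
    have h2 : ((findUnit (clweDist s χ) (κ + 1)).bind k) y =
        unitMass S * (χ.bind ψ) y +
          nonunitMass S * ((findUnit (clweDist s χ) κ).bind k) y := by
      rw [h, PMF.bind_apply, unitMass, nonunitMass, ← ENNReal.tsum_mul_right,
        ← ENNReal.tsum_mul_right, ← ENNReal.tsum_add]
      congr 1
      funext a
      by_cases ha : IsUnit a <;> simp [ha]
    rw [h2, pow_succ', add_assoc, mul_assoc, ← mul_add, ih, mul_add, ← add_assoc, ← add_mul,
      unitMass_add_nonunitMass, one_mul, mul_assoc]

/-- The identity `findUnit_bind_apply`, solved for the probability that the whole experiment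
yields `y`. -/
theorem findUnit_bind_toReal {α : Type*} (s : S) (χ : PMF S) (k : Option (Sˣ × S) → PMF α)
    (ψ : S → PMF α) (hk : ∀ a₁ b₁, k (some (a₁, b₁)) = ψ (b₁ - a₁ * s)) (y : α) (κ : ℕ) :
    (((findUnit (clweDist s χ) κ).bind k) y).toReal =
      (1 - (1 - (unitMass S).toReal) ^ κ) * ((χ.bind ψ) y).toReal +
        (1 - (unitMass S).toReal) ^ κ * (k none y).toReal := by
  have h := congrArg ENNReal.toReal (findUnit_bind_apply s χ k ψ hk y κ)
  have hu : unitMass S ≠ ⊤ := fun h => by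
    have := unitMass_add_nonunitMass (S := S); simp [h] at this
  have hn : nonunitMass S ≠ ⊤ := fun h => by
    have := unitMass_add_nonunitMass (S := S); simp [h] at this
  have h1 := congrArg ENNReal.toReal (unitMass_add_nonunitMass (S := S))
  rw [ENNReal.toReal_add hu hn, ENNReal.toReal_one] at h1
  rw [ENNReal.toReal_add (PMF.apply_ne_top _ _)
      (ENNReal.mul_ne_top (ENNReal.pow_ne_top hn) (PMF.apply_ne_top _ _)),
    ENNReal.toReal_add (PMF.apply_ne_top _ _)
      (ENNReal.mul_ne_top (ENNReal.pow_ne_top hn) (PMF.apply_ne_top _ _)),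
    ENNReal.toReal_mul, ENNReal.toReal_mul, ENNReal.toReal_pow,
    show (nonunitMass S).toReal = 1 - (unitMass S).toReal by linarith] at h
  linarith

/-! ### Success probability and advantage of the reduction -/

theorem searchSuccess_eq (σ χ : PMF S) (alg : PMF (S × S) → PMF S) :
    searchSuccess σ χ alg = (∑' s, σ s * alg (clweDist s χ) s).toReal := by
  classical
  rw [searchSuccess]
  congr 1
  rw [PMF.toOuterMeasure_bind_apply]
  congr 1
  funext s
  congr 1
  rw [PMF.toOuterMeasure_map_apply, PMF.toOuterMeasure_apply, tsum_eq_single s]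
  · simp
  · intro x hx
    simp [hx]

theorem onSamples_map_transform {α : Type*} (ε : ℤˣ) (s b₁ : S) (a₁ : Sˣ) (χ : PMF S)
    (h : ε = -1 ∨ ∀ x, χ (-x) = χ x) (m : ℕ) (A : List (S × S) → PMF α) :
    ((iid (clweDist s χ) m).bind fun xs => A (xs.map (transform ε a₁ b₁))) =
      onSamples m A (clweDist (b₁ - a₁ * s) χ) := by
  rw [onSamples, ← clweDist_map_transform ε s b₁ a₁ χ h, ← iid_map, PMF.bind_map]
  rfl

theorem one_sub_pow_le {c ρ : ℝ} (hρ : ρ ≤ 1) (h : c ≤ ρ) (κ : ℕ) :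
    1 - (1 - c) ^ κ ≤ 1 - (1 - ρ) ^ κ :=
  sub_le_sub_left (pow_le_pow_left₀ (by linarith) (by linarith) κ) 1

theorem unitMass_toReal_le_one : (unitMass S).toReal ≤ 1 := by
  rw [← ENNReal.toReal_one]
  exact ENNReal.toReal_mono ENNReal.one_ne_top
    (unitMass_add_nonunitMass (S := S) ▸ le_self_add)

/-- For every fixed secret `s`: the fresh secret `b₁ - a₁ s` is the error of the first sample, and a
correct answer for it is turned into `s`. -/
theorem normalFormSearch_apply_ge (ε : ℤˣ) (κ m : ℕ) (A : List (S × S) → PMF S) (χ : PMF S)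
    (h : ε = -1 ∨ ∀ x, χ (-x) = χ x) (s : S) :
    (1 - (1 - (unitMass S).toReal) ^ κ) * searchSuccess χ χ (onSamples m A) ≤
      (normalFormSearch ε κ m A (clweDist s χ) s).toReal := by
  classical
  set k : Option (Sˣ × S) → PMF S := fun r => match r with
    | none => PMF.pure 0
    | some (a₁, b₁) => (iid (clweDist s χ) m).bind fun xs =>
        (A (xs.map (transform ε a₁ b₁))).map fun x => (↑a₁⁻¹ : S) * (b₁ - x) with hk
  have h1 : normalFormSearch ε κ m A (clweDist s χ) s =
      ((findUnit (clweDist s χ) κ).bind fun r => (k r).map fun y => decide (y = s)) true := by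
    rw [← PMF.map_bind, PMF.map_apply, tsum_eq_single s]
    · simp only [decide_true, if_true]
      rfl
    · intro y hy
      simp [hy]
  have h2 := findUnit_bind_toReal s χ (fun r => (k r).map fun y => decide (y = s))
    (fun e => (onSamples m A (clweDist e χ)).map fun x => decide (x = e)) (by
      intro a₁ b₁
      rw [← onSamples_map_transform ε s b₁ a₁ χ h m A, PMF.map_bind]
      simp only [PMF.map_bind, PMF.map_comp]
      congr 1
      funext xs
      congr 1
      funext x
      simp only [Function.comp_apply]
      congr 1
      rw [eq_iff_iff]
      constructor
      · intro hx
        rw [← hx]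
        simp
      · rintro rfl
        simp) true κ
  have h3 : (χ.bind fun e => (onSamples m A (clweDist e χ)).map fun x => decide (x = e)) true
      = ∑' e, χ e * onSamples m A (clweDist e χ) e := by
    rw [PMF.bind_apply]
    congr 1
    funext e
    congr 1
    rw [PMF.map_apply, tsum_eq_single e]
    · simp
    · intro y hy
      simp [hy]
  rw [h1, h2, h3, searchSuccess_eq]
  have h4 : 0 ≤ (1 - (unitMass S).toReal) ^ κ :=
    pow_nonneg (by linarith [unitMass_toReal_le_one (S := S)]) κ
  have := mul_nonneg h4 (ENNReal.toReal_nonneg (a := (((k none).map fun y => decide (y = s)) true)))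
  linarith

theorem searchSuccess_normalForm (ε : ℤˣ) (κ m : ℕ) (A : List (S × S) → PMF S) (χ σ : PMF S)
    (h : ε = -1 ∨ ∀ x, χ (-x) = χ x) {c : ℝ} (hc : c ≤ (Nat.card Sˣ : ℝ) / Nat.card S) :
    (1 - (1 - c) ^ κ) * searchSuccess χ χ (onSamples m A) ≤
      searchSuccess σ χ (normalFormSearch ε κ m A) := by
  let _ := Fintype.ofFinite S
  have h0 : 0 ≤ searchSuccess χ χ (onSamples m A) := ENNReal.toReal_nonneg
  refine (mul_le_mul_of_nonneg_right
    (one_sub_pow_le unitMass_toReal_le_one (hc.trans_eq unitMass_toReal.symm) κ) h0).trans ?_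
  rw [searchSuccess_eq σ, tsum_fintype, ENNReal.toReal_sum (fun s _ =>
    ENNReal.mul_ne_top (PMF.apply_ne_top _ _) (PMF.apply_ne_top _ _))]
  have h1 : ∑ s, (σ s).toReal = 1 := by
    rw [← ENNReal.toReal_sum (fun s _ => PMF.apply_ne_top _ _),
      ← tsum_fintype (L := .unconditional _), PMF.tsum_coe, ENNReal.toReal_one]
  refine (one_mul _).symm.trans_le ?_
  conv_lhs => enter [1]; rw [← h1]
  rw [Finset.sum_mul]
  refine Finset.sum_le_sum fun s _ => ?_
  rw [ENNReal.toReal_mul]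
  exact mul_le_mul_of_nonneg_left (normalFormSearch_apply_ge ε κ m A χ h s)
    ENNReal.toReal_nonneg

/-- For every fixed secret `s`, the acceptance probability is scaled by the probability that an
invertible sample is found. -/
theorem normalFormDecision_apply (ε : ℤˣ) (κ m : ℕ) (A : List (S × S) → PMF Bool) (χ : PMF S)
    (h : ε = -1 ∨ ∀ x, χ (-x) = χ x) (s : S) :
    (normalFormDecision ε κ m A (clweDist s χ) true).toReal =
      (1 - (1 - (unitMass S).toReal) ^ κ) *
        ((χ.bind fun e => onSamples m A (clweDist e χ)) true).toReal := by
  classical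
  set k : Option (Sˣ × S) → PMF Bool := fun r => match r with
    | none => PMF.pure false
    | some (a₁, b₁) => (iid (clweDist s χ) m).bind fun xs =>
        (A (xs.map (transform ε a₁ b₁))).map fun x => x with hk
  have h2 := findUnit_bind_toReal s χ k (fun e => onSamples m A (clweDist e χ)) (by
      intro a₁ b₁
      rw [← onSamples_map_transform ε s b₁ a₁ χ h m A]
      simp only [hk]
      congr 1
      funext xs
      exact PMF.map_id _) true κ
  have h3 : k none true = 0 := by simp [hk]
  rw [h3, ENNReal.toReal_zero, mul_zero, add_zero] at h2
  exact h2

theorem decisionAdvantage_normalForm (ε : ℤˣ) (κ m : ℕ) (A : List (S × S) → PMF Bool)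
    (χ σ : PMF S) (h : ε = -1 ∨ ∀ x, χ (-x) = χ x) {c : ℝ}
    (hc : c ≤ (Nat.card Sˣ : ℝ) / Nat.card S) :
    (1 - (1 - c) ^ κ) * decisionAdvantage χ χ (onSamples m A) ≤
      decisionAdvantage σ χ (normalFormDecision ε κ m A) := by
  let _ := Fintype.ofFinite S
  refine (mul_le_mul_of_nonneg_right
    (one_sub_pow_le unitMass_toReal_le_one (hc.trans_eq unitMass_toReal.symm) κ)
    (abs_nonneg _)).trans_eq ?_
  set u := 1 - (1 - (unitMass S).toReal) ^ κ with hu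
  have hu0 : 0 ≤ u := by
    have h0 : 0 ≤ (unitMass S).toReal := ENNReal.toReal_nonneg
    have := pow_le_one₀ (n := κ) (by linarith [unitMass_toReal_le_one (S := S)])
      (show 1 - (unitMass S).toReal ≤ 1 by linarith)
    linarith
  have h1 : ((σ.bind fun s => normalFormDecision ε κ m A (clweDist s χ)) true).toReal =
      u * ((χ.bind fun e => onSamples m A (clweDist e χ)) true).toReal := by
    rw [PMF.bind_apply, tsum_fintype, ENNReal.toReal_sum (fun s _ =>
      ENNReal.mul_ne_top (PMF.apply_ne_top _ _) (PMF.apply_ne_top _ _))]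
    simp only [ENNReal.toReal_mul, normalFormDecision_apply ε κ m A χ h]
    rw [← Finset.sum_mul, ← ENNReal.toReal_sum (fun s _ => PMF.apply_ne_top _ _),
      ← tsum_fintype (L := .unconditional _), PMF.tsum_coe, ENNReal.toReal_one, one_mul]
  -- Uniform samples are samples with uniform errors, and the uniform distribution is symmetric.
  have h2 : (normalFormDecision ε κ m A (unif (S × S)) true).toReal =
      u * (onSamples m A (unif (S × S)) true).toReal := by
    rw [← clweDist_unif (0 : S), normalFormDecision_apply ε κ m A (unif S)
      (Or.inr fun x => by simp [unif_apply]) 0]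
    simp only [clweDist_unif, PMF.bind_const, hu]
  simp only [decisionAdvantage]
  rw [h1, h2, ← mul_sub, abs_mul, abs_of_nonneg hu0]

end Security

/-! ### Unit density of a finite semisimple algebra -/

section Density

variable (q : ℕ) [Fact q.Prime]

theorem card_ge_of_algebra (F : Type*) [Ring F] [Nontrivial F] [Finite F] [Algebra (ZMod q) F] :
    q ≤ Nat.card F := by
  have h := Nat.card_le_card_of_injective _ (algebraMap (ZMod q) F).injective
  simpa [Nat.card_zmod] using h

/-- In the order `∏ i, (Q ^ k - Q ^ i)` of the general linear group over a field with `Q ≥ q`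
elements each factor is at least `(1 - 1 / q) Q ^ k`. By Wedderburn's theorem the division ring is
a field. -/
theorem matrix_unit_density (F : Type*) [DivisionRing F] [Finite F] [Algebra (ZMod q) F] (k : ℕ) :
    (1 - 1 / (q : ℝ)) ^ k * Nat.card (Matrix (Fin k) (Fin k) F) ≤
      Nat.card (Matrix (Fin k) (Fin k) F)ˣ := by
  have hQ := card_ge_of_algebra q F
  have hcard : Nat.card (Matrix (Fin k) (Fin k) F)ˣ =
      ∏ i : Fin k, (Nat.card F ^ k - Nat.card F ^ (i : ℕ)) := by
    let _ : Field F := littleWedderburn F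
    let _ := Fintype.ofFinite F
    have := Matrix.card_GL_field (𝔽 := F) k
    rw [← Nat.card_eq_fintype_card] at this
    exact this
  have hq : (1 : ℝ) < q := by exact_mod_cast (Fact.out : q.Prime).one_lt
  have hM : (Nat.card (Matrix (Fin k) (Fin k) F) : ℝ) = ∏ _i : Fin k, (Nat.card F : ℝ) ^ k := by
    have : Nat.card (Matrix (Fin k) (Fin k) F) = Nat.card (Fin k → Fin k → F) := rfl
    rw [this]
    simp [Nat.card_fun]
  have h1 : (1 - 1 / (q : ℝ)) ^ k = ∏ _i : Fin k, (1 - 1 / (q : ℝ)) := by simp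
  rw [hcard, hM, h1, ← Finset.prod_mul_distrib]
  push_cast
  have hQ' : (q : ℝ) ≤ Nat.card F := by exact_mod_cast hQ
  set Q : ℝ := ((Nat.card F : ℕ) : ℝ) with hQd
  have hQ1 : 1 < Q := hq.trans_le hQ'
  have hq1 : 1 / (q : ℝ) ≤ 1 := by rw [div_le_one (by linarith)]; linarith
  refine Finset.prod_le_prod (fun i _ => mul_nonneg (by linarith) (by positivity)) fun i _ => ?_
  rw [Nat.cast_sub (Nat.pow_le_pow_right Nat.card_pos i.2.le)]
  push_cast
  have h2 : Q ^ (i : ℕ) * Q ≤ Q ^ k := by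
    rw [← pow_succ]
    exact pow_le_pow_right₀ hQ1.le i.2
  have h3 : Q ^ (i : ℕ) * q ≤ Q ^ k := le_trans (by gcongr) h2
  have h4 : Q ^ (i : ℕ) ≤ 1 / q * Q ^ k := by
    rw [one_div, inv_mul_eq_div, le_div_iff₀ (by linarith)]
    exact h3
  rw [sub_mul, one_mul]
  linarith

/-- A finite semisimple algebra of dimension `n d²` over `𝔽_q` with at most `n` simple factors has
at most `n d` as the sum of the sizes of its matrix factors, whence the bound. -/
theorem unit_density_of_isSemisimpleRing {A : Type*} [Ring A] [Finite A] [Algebra (ZMod q) A]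
    [IsSemisimpleRing A] (n d : ℕ) (hcard : Nat.card A = q ^ (n * d ^ 2))
    (hJ : ∀ (J : ℕ) (f : Fin J → A), (∀ i, f i ≠ 0) → (∀ i a, a * f i = f i * a) →
      (∀ i, f i * f i = f i) → (∀ i j, i ≠ j → f i * f j = 0) → J ≤ n) :
    (1 - 1 / (q : ℝ)) ^ (n * d) ≤ (Nat.card Aˣ : ℝ) / Nat.card A := by
  classical
  obtain ⟨J, F, k, _, _, _, hk, ⟨e⟩⟩ :=
    IsSemisimpleRing.exists_algEquiv_pi_matrix_divisionRing_finite (ZMod q) A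
  have hfin : ∀ i, Finite (F i) := fun i => Module.finite_of_finite (ZMod q)
  -- The units of the simple factors are orthogonal central idempotents.
  have hJn : J ≤ n := by
    refine hJ J (fun i => e.symm (Pi.single i 1)) ?_ ?_ ?_ ?_
    · intro i h
      rw [map_eq_zero_iff _ e.symm.injective] at h
      have := congrFun h i
      rw [Pi.single_eq_same] at this
      exact one_ne_zero this
    · intro i a
      apply e.injective
      simp only [map_mul, AlgEquiv.apply_symm_apply]
      ext1 j
      by_cases hij : j = i
      · subst hij; simp
      · simp [hij]
    · intro i
      apply e.injective
      simp only [map_mul, AlgEquiv.apply_symm_apply]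
      rw [← Pi.single_mul, one_mul]
    · intro i j hij
      apply e.injective
      simp only [map_mul, AlgEquiv.apply_symm_apply, map_zero]
      ext1 l
      by_cases hil : l = i
      · subst hil; simp [hij]
      · simp [hil]
  have hq : 1 < q := (Fact.out : q.Prime).one_lt
  have hA : Nat.card A = ∏ i, Nat.card (Matrix (Fin (k i)) (Fin (k i)) (F i)) := by
    rw [Nat.card_congr e.toEquiv, Nat.card_pi]
  have hAu : Nat.card Aˣ = ∏ i, Nat.card (Matrix (Fin (k i)) (Fin (k i)) (F i))ˣ := by
    rw [Nat.card_congr (Units.mapEquiv e.toMulEquiv).toEquiv,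
      Nat.card_congr MulEquiv.piUnits.toEquiv, Nat.card_pi]
  -- Comparison of cardinalities: the `i`-th factor has at least `q ^ (k i ^ 2)` elements.
  have hsq : ∑ i, k i ^ 2 ≤ n * d ^ 2 := by
    rw [← Nat.pow_le_pow_iff_right hq, ← hcard, hA, ← Finset.prod_pow_eq_pow_sum]
    refine Finset.prod_le_prod' fun i _ => ?_
    have h1 : Nat.card (Matrix (Fin (k i)) (Fin (k i)) (F i)) =
        Nat.card (Fin (k i) → Fin (k i) → F i) := rfl
    rw [h1]
    simp only [Nat.card_fun, Nat.card_eq_fintype_card, Fintype.card_fin]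
    rw [← pow_mul, sq]
    exact Nat.pow_le_pow_left (by
      simpa [Nat.card_eq_fintype_card] using card_ge_of_algebra q (F i)) _
  -- The Cauchy–Schwarz inequality.
  have hsum : ∑ i, k i ≤ n * d := by
    have h1 := sq_sum_le_card_mul_sum_sq (s := (Finset.univ : Finset (Fin J))) (f := k)
    rw [Finset.card_univ, Fintype.card_fin] at h1
    have h2 : (∑ i, k i) ^ 2 ≤ (n * d) ^ 2 := by
      calc (∑ i, k i) ^ 2 ≤ J * ∑ i, k i ^ 2 := h1
        _ ≤ n * (n * d ^ 2) := Nat.mul_le_mul hJn hsq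
        _ = (n * d) ^ 2 := by ring
    exact (Nat.pow_le_pow_iff_left two_ne_zero).1 h2
  have hq' : (1 : ℝ) < q := by exact_mod_cast hq
  have hq1 : 1 / (q : ℝ) ≤ 1 := by rw [div_le_one (by linarith)]; linarith
  have hq0 : 0 < 1 / (q : ℝ) := by positivity
  have hApos : (0 : ℝ) < Nat.card A := by
    rw [hcard]
    push_cast
    positivity
  rw [le_div_iff₀ hApos]
  calc (1 - 1 / (q : ℝ)) ^ (n * d) * Nat.card A
      ≤ (1 - 1 / (q : ℝ)) ^ (∑ i, k i) * Nat.card A :=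
        mul_le_mul_of_nonneg_right
          (pow_le_pow_of_le_one (by linarith) (by linarith) hsum) hApos.le
    _ = ∏ i, ((1 - 1 / (q : ℝ)) ^ k i * Nat.card (Matrix (Fin (k i)) (Fin (k i)) (F i))) := by
        rw [Finset.prod_mul_distrib, Finset.prod_pow_eq_pow_sum, hA]
        push_cast
        rfl
    _ ≤ ∏ i, (Nat.card (Matrix (Fin (k i)) (Fin (k i)) (F i))ˣ : ℝ) :=
        Finset.prod_le_prod
          (fun i _ => mul_nonneg (pow_nonneg (by linarith) _) (Nat.cast_nonneg _))
          fun i _ => matrix_unit_density q (F i) (k i)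
    _ = Nat.card Aˣ := by rw [hAu]; push_cast; rfl

/-- From `1 - 1 / q ≥ 1 - 1 / (n + 1) = (1 + 1 / n)⁻¹ ≥ exp (-1 / n)`. -/
theorem exp_neg_le_pow (q n d : ℕ) (hn : n + 1 ≤ q) :
    Real.exp (-(d : ℝ)) ≤ (1 - 1 / (q : ℝ)) ^ (n * d) := by
  rcases Nat.eq_zero_or_pos n with rfl | hn0
  · simp
  have hq : (n : ℝ) + 1 ≤ q := by exact_mod_cast hn
  have hn0' : (0 : ℝ) < n := by exact_mod_cast hn0
  have h1 : Real.exp (-1) ≤ (1 - 1 / (q : ℝ)) ^ n := by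
    have h2 : Real.exp (-(1 / (n : ℝ))) ≤ 1 - 1 / (q : ℝ) := by
      have h3 : 1 / (n : ℝ) + 1 ≤ Real.exp (1 / n) := Real.add_one_le_exp _
      rw [Real.exp_neg]
      have h4 : (1 / (n : ℝ) + 1)⁻¹ = 1 - 1 / (n + 1) := by
        field_simp
        ring
      calc (Real.exp (1 / n))⁻¹ ≤ (1 / (n : ℝ) + 1)⁻¹ := inv_anti₀ (by positivity) h3
        _ = 1 - 1 / (n + 1) := h4
        _ ≤ 1 - 1 / (q : ℝ) := by
          have := one_div_le_one_div_of_le (by positivity) hq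
          linarith
    calc Real.exp (-1) = Real.exp (-(1 / (n : ℝ))) ^ n := by
          rw [← Real.exp_nat_mul]
          congr 1
          field_simp
      _ ≤ _ := pow_le_pow_left₀ (Real.exp_pos _).le h2 n
  calc Real.exp (-(d : ℝ)) = Real.exp (-1) ^ d := by
        rw [← Real.exp_nat_mul]
        simp
    _ ≤ ((1 - 1 / (q : ℝ)) ^ n) ^ d := pow_le_pow_left₀ (Real.exp_pos _).le h1 d
    _ = _ := (pow_mul _ _ _).symm

end Density

namespace CyclicAlgebra

/-! ### Ideals of a cyclic algebra modulo `q` -/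

section Separable

variable {R : Type*} [CommRing R] {D : CyclicData R}

theorem coeff_natCast_mul (q : ℕ) (x : CyclicAlgebra D) (i : Fin D.d) :
    ((q : CyclicAlgebra D) * x).coeff i = q * x.coeff i := by
  rw [← nsmul_eq_mul, ← nsmul_eq_mul]
  rfl

theorem mem_span_natCast_iff (q : ℕ) (a : CyclicAlgebra D) :
    a ∈ Ideal.span {(q : CyclicAlgebra D)} ↔ ∀ i, a.coeff i ∈ Ideal.span {(q : R)} := by
  simp only [Ideal.mem_span_singleton']
  constructor
  · rintro ⟨b, rfl⟩ i
    refine ⟨b.coeff i, ?_⟩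
    rw [← (Nat.cast_commute q b).eq, coeff_natCast_mul, mul_comm]
  · intro h
    choose b hb using h
    refine ⟨⟨b⟩, ?_⟩
    ext i
    rw [← (Nat.cast_commute q _).eq, coeff_natCast_mul, mul_comm]
    exact hb i

theorem coeff_mono (i : Fin D.d) (r : R) : (mono D (i : ℕ) r).coeff = Pi.single i r := by
  have h1 : (⟨(i : ℕ) % D.d, Nat.mod_lt _ D.d_pos⟩ : Fin D.d) = i :=
    Fin.ext (Nat.mod_eq_of_lt i.2)
  simp only [mono]
  rw [h1, Nat.div_eq_of_lt i.2]
  simp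

theorem coeff_mul_mono_zero (a : CyclicAlgebra D) (r : R) (i : Fin D.d) :
    (a * mono D 0 r).coeff i = a.coeff i * r := by
  have h : a * mono D 0 r = ⟨fun i => a.coeff i * r⟩ := by
    conv_lhs => rw [← sum_mono a]
    conv_rhs => rw [← sum_mono ⟨fun i => a.coeff i * r⟩]
    simp [csum_mul, mono_mul_mono]
  rw [h]

theorem coeff_mono_zero_mul (a : CyclicAlgebra D) (r : R) (i : Fin D.d) :
    (mono D 0 r * a).coeff i = (D.θ ^ (i : ℕ)) r * a.coeff i := by
  have h : mono D 0 r * a = ⟨fun i => (D.θ ^ (i : ℕ)) r * a.coeff i⟩ := by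
    conv_lhs => rw [← sum_mono a]
    conv_rhs => rw [← sum_mono ⟨fun i => (D.θ ^ (i : ℕ)) r * a.coeff i⟩]
    simp [cmul_sum, mono_mul_mono]
  rw [h]

/-- The index `0` of the coefficients. -/
def zeroIdx (D : CyclicData R) : Fin D.d := ⟨0, D.d_pos⟩

/-- The functions `f` on the indices such that multiplication of the `i`-th coefficient by `f i`
preserves the ideal `I`. -/
def stableMultipliers (I : Ideal (CyclicAlgebra D)) : Subring (Fin D.d → R) where
  carrier := {f | ∀ a ∈ I, (⟨fun i => a.coeff i * f i⟩ : CyclicAlgebra D) ∈ I}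
  mul_mem' {f g} hf hg a ha := by
    have := hg _ (hf a ha)
    simpa only [Pi.mul_apply, mul_assoc] using this
  one_mem' a ha := by simpa using ha
  add_mem' {f g} hf hg a ha := by
    have := I.add_mem (hf a ha) (hg a ha)
    have h : (⟨fun i => a.coeff i * (f + g) i⟩ : CyclicAlgebra D) =
        ⟨fun i => a.coeff i * f i⟩ + ⟨fun i => a.coeff i * g i⟩ := by
      ext i
      simp [mul_add]
    rwa [h]
  zero_mem' a _ := by
    have h : (⟨fun i => a.coeff i * (0 : Fin D.d → R) i⟩ : CyclicAlgebra D) = 0 := by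
      ext i
      simp
    rw [h]
    exact I.zero_mem
  neg_mem' {f} hf a ha := by
    have h : (⟨fun i => a.coeff i * (-f) i⟩ : CyclicAlgebra D) =
        -⟨fun i => a.coeff i * f i⟩ := by
      ext i
      change a.coeff i * (-f i) = -(a.coeff i * f i)
      ring
    rw [h]
    exact I.neg_mem (hf a ha)

theorem const_mem_stableMultipliers (I : Ideal (CyclicAlgebra D)) [I.IsTwoSided] (r : R) :
    (fun _ => r) ∈ stableMultipliers I := by
  intro a ha
  have h : (⟨fun i => a.coeff i * r⟩ : CyclicAlgebra D) = a * mono D 0 r := by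
    ext i
    rw [coeff_mul_mono_zero]
  rw [h]
  exact I.mul_mem_right _ ha

theorem conj_mem_stableMultipliers (I : Ideal (CyclicAlgebra D)) (r : R) :
    (fun i : Fin D.d => (D.θ ^ (i : ℕ)) r) ∈ stableMultipliers I := by
  intro a ha
  have h : (⟨fun i => a.coeff i * (D.θ ^ (i : ℕ)) r⟩ : CyclicAlgebra D) = mono D 0 r * a := by
    ext i
    rw [coeff_mono_zero_mul, mul_comm]
  rw [h]
  exact I.mul_mem_left _ ha

variable (q : ℕ)

/-- No power `θ ^ i` with `0 < i < d` has a non-trivial fixed quotient modulo `q`: this is what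
it means for all inertia groups at `q` to be trivial. -/
def InertiaFree (D : CyclicData R) (q : ℕ) : Prop :=
  ∀ i : Fin D.d, (i : ℕ) ≠ 0 →
    Ideal.span (Set.range fun y : R => y - (D.θ ^ (i : ℕ)) y) ⊔ Ideal.span {(q : R)} = ⊤

/-- The multipliers `i ↦ θ ^ i y - θ ^ i₀ y` vanish at `i₀`, and their values at `0` generate the
unit ideal modulo `q`. -/
theorem exists_multiplier (hD : InertiaFree D q) (I : Ideal (CyclicAlgebra D)) [I.IsTwoSided]
    (i₀ : Fin D.d) (hi₀ : (i₀ : ℕ) ≠ 0) :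
    ∃ f ∈ stableMultipliers I, f (zeroIdx D) - 1 ∈ Ideal.span {(q : R)} ∧
      f i₀ ∈ Ideal.span {(q : R)} := by
  have h1 : (1 : R) ∈ Ideal.span (Set.range fun y : R => y - (D.θ ^ (i₀ : ℕ)) y) ⊔
      Ideal.span {(q : R)} := by rw [hD i₀ hi₀]; trivial
  obtain ⟨x, hx, z, hz, hxz⟩ := Submodule.mem_sup.1 h1
  have key : ∀ x ∈ Ideal.span (Set.range fun y : R => y - (D.θ ^ (i₀ : ℕ)) y),
      ∃ f ∈ stableMultipliers I, f (zeroIdx D) = x ∧ f i₀ = 0 := by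
    intro x hx
    induction hx using Submodule.span_induction with
    | mem x h =>
      obtain ⟨y, rfl⟩ := h
      refine ⟨_, sub_mem (conj_mem_stableMultipliers I y)
        (const_mem_stableMultipliers I ((D.θ ^ (i₀ : ℕ)) y)), ?_, ?_⟩
      · simp [zeroIdx]
      · simp
    | zero => exact ⟨0, zero_mem _, rfl, rfl⟩
    | add x y _ _ hx hy =>
      obtain ⟨f, hf, hf1, hf2⟩ := hx
      obtain ⟨g, hg, hg1, hg2⟩ := hy
      exact ⟨f + g, add_mem hf hg, by simp [hf1, hg1], by simp [hf2, hg2]⟩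
    | smul r x _ hx =>
      obtain ⟨f, hf, hf1, hf2⟩ := hx
      exact ⟨_, mul_mem (const_mem_stableMultipliers I r) hf, by simp [hf1], by simp [hf2]⟩
  obtain ⟨f, hf, hf1, hf2⟩ := key x hx
  refine ⟨f, hf, ?_, ?_⟩
  · rw [hf1, ← hxz]
    simpa using hz
  · rw [hf2]
    exact zero_mem _

/-- A two-sided ideal above `q` contains the constant coefficients of its elements. -/
theorem mono_coeff_zero_mem (hD : InertiaFree D q) (I : Ideal (CyclicAlgebra D)) [I.IsTwoSided]
    (hq : (q : CyclicAlgebra D) ∈ I) {a : CyclicAlgebra D} (ha : a ∈ I) :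
    mono D 0 (a.coeff (zeroIdx D)) ∈ I := by
  classical
  have hsub : ∀ b : CyclicAlgebra D, (∀ i, b.coeff i ∈ Ideal.span {(q : R)}) → b ∈ I := by
    intro b hb
    exact (Ideal.span_singleton_le_iff_mem I).2 hq ((mem_span_natCast_iff q b).2 hb)
  have h1 : ∀ s : Finset (Fin D.d), ∃ f ∈ stableMultipliers I,
      f (zeroIdx D) - 1 ∈ Ideal.span {(q : R)} ∧
        ∀ i ∈ s, (i : ℕ) ≠ 0 → f i ∈ Ideal.span {(q : R)} := by
    intro s
    induction s using Finset.induction_on with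
    | empty => exact ⟨1, one_mem _, by simp, by simp⟩
    | insert j s _ ih =>
      obtain ⟨f, hf, hf1, hf2⟩ := ih
      by_cases hj : (j : ℕ) = 0
      · refine ⟨f, hf, hf1, fun i hi hi0 => ?_⟩
        rcases Finset.mem_insert.1 hi with rfl | hi
        · exact absurd hj hi0
        · exact hf2 i hi hi0
      · obtain ⟨g, hg, hg1, hg2⟩ := exists_multiplier q hD I j hj
        refine ⟨f * g, mul_mem hf hg, ?_, fun i hi hi0 => ?_⟩
        · have h2 : (f * g) (zeroIdx D) - 1 = f (zeroIdx D) * (g (zeroIdx D) - 1) +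
              (f (zeroIdx D) - 1) := by
            simp only [Pi.mul_apply]
            ring
          rw [h2]
          exact add_mem (Ideal.mul_mem_left _ _ hg1) hf1
        · rcases Finset.mem_insert.1 hi with rfl | hi
          · exact Ideal.mul_mem_left _ _ hg2
          · exact Ideal.mul_mem_right _ _ (hf2 i hi hi0)
  -- Modulo `q`, the multiplier `f` is the projection to the constant coefficient.
  obtain ⟨f, hf, hf1, hf2⟩ := h1 Finset.univ
  have h3 := hf a ha
  have h4 : (⟨fun i => a.coeff i * f i⟩ - mono D 0 (a.coeff (zeroIdx D)) : CyclicAlgebra D) ∈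
      I := by
    apply hsub
    intro i
    have h5 : (mono D 0 (a.coeff (zeroIdx D))).coeff =
        Pi.single (zeroIdx D) (a.coeff (zeroIdx D)) := coeff_mono (zeroIdx D) _
    change a.coeff i * f i - (mono D 0 (a.coeff (zeroIdx D))).coeff i ∈ _
    rw [h5]
    by_cases hi : i = zeroIdx D
    · subst hi
      rw [Pi.single_eq_same, ← mul_sub_one]
      exact Ideal.mul_mem_left _ _ hf1
    · rw [Pi.single_eq_of_ne hi, sub_zero]
      exact Ideal.mul_mem_left _ _ (hf2 i (Finset.mem_univ i) fun h => hi (Fin.ext h))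
  have := I.sub_mem h3 h4
  simpa using this

/-- A two-sided ideal above `q` contains all coefficients of its elements. -/
theorem mono_coeff_mem (hD : InertiaFree D q) (hγ : Ideal.span {D.γ} ⊔ Ideal.span {(q : R)} = ⊤)
    (I : Ideal (CyclicAlgebra D)) [I.IsTwoSided]
    (hq : (q : CyclicAlgebra D) ∈ I) {a : CyclicAlgebra D} (ha : a ∈ I) (i : Fin D.d) :
    mono D 0 (a.coeff i) ∈ I := by
  by_cases hi : (i : ℕ) = 0
  · have : i = zeroIdx D := Fin.ext hi
    subst this
    exact mono_coeff_zero_mem q hD I hq ha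
  -- The constant coefficient of `u ^ (d - i) * a` is `γ` times the `i`-th coefficient of `a`.
  have h1 : mono D (D.d - i) 1 * a ∈ I := I.mul_mem_left _ ha
  have h2 := mono_coeff_zero_mem q hD I hq h1
  have h3 : (mono D (D.d - i) 1 * a).coeff (zeroIdx D) = D.γ * a.coeff i := by
    conv_lhs => rw [← sum_mono a]
    simp only [cmul_sum, mono_mul_mono, map_one, one_mul, coeff_sum, Finset.sum_apply]
    rw [Finset.sum_eq_single i]
    · have h4 : D.d - (i : ℕ) + i = D.d := by omega
      rw [h4]
      simp [mono, zeroIdx, Nat.div_self D.d_pos]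
    · intro j _ hj
      have hne : (zeroIdx D) ≠ (⟨(D.d - (i : ℕ) + j) % D.d, Nat.mod_lt _ D.d_pos⟩ : Fin D.d) := by
        intro h
        have h5 : (D.d - (i : ℕ) + j) % D.d = 0 := (congrArg Fin.val h).symm
        obtain ⟨c, hc⟩ := Nat.dvd_of_mod_eq_zero h5
        have hj' : (j : ℕ) ≠ i := fun h => hj (Fin.ext h)
        have hi2 := i.2
        have hj2 := j.2
        have : c = 1 := by
          rcases Nat.lt_or_ge c 1 with h6 | h6
          · have : c = 0 := by omega
            subst this
            omega
          · rcases Nat.lt_or_ge c 2 with h7 | h7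
            · omega
            · have : D.d * 2 ≤ D.d * c := Nat.mul_le_mul_left _ h7
              omega
        subst this
        omega
      simp only [mono]
      exact Pi.single_eq_of_ne hne _
    · simp
  rw [h3] at h2
  have h6 : (1 : R) ∈ Ideal.span {D.γ} ⊔ Ideal.span {(q : R)} := by rw [hγ]; trivial
  obtain ⟨x, hx, z, hz, hxz⟩ := Submodule.mem_sup.1 h6
  obtain ⟨g, rfl⟩ := Ideal.mem_span_singleton'.1 hx
  obtain ⟨c, rfl⟩ := Ideal.mem_span_singleton'.1 hz
  have h7 : mono D 0 (a.coeff i) = mono D 0 g * mono D 0 (D.γ * a.coeff i) +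
      (q : CyclicAlgebra D) * mono D 0 (c * a.coeff i) := by
    have hz : mono D 0 (a.coeff i) = mono D (zeroIdx D : ℕ) (a.coeff i) := rfl
    have h8 : (q : CyclicAlgebra D) * mono D 0 (c * a.coeff i) =
        mono D 0 ((q : R) * (c * a.coeff i)) := by
      rw [← nsmul_eq_mul, ← nsmul_eq_mul]
      ext j
      simp only [mono]
      rw [show (q • (⟨Pi.single _ _⟩ : CyclicAlgebra D)).coeff = q • _ from rfl]
      simp only [Pi.smul_apply, Pi.single_apply]
      split_ifs <;> simp
    rw [h8, mono_mul_mono, ← mono_add]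
    congr 1
    simp only [pow_zero, RingAut.one_apply]
    linear_combination (a.coeff i) * (-hxz)
  rw [h7]
  exact I.add_mem (I.mul_mem_left _ h2) (I.mul_mem_right _ hq)

theorem mono_zero_pow (r : R) (k : ℕ) : mono D 0 r ^ k = mono D 0 (r ^ k) := by
  induction k with
  | zero => simp [one_def]
  | succ k ih => rw [pow_succ, ih, mono_mul_mono]; simp [pow_succ]

theorem mono_zero_mem_span_iff (r : R) :
    mono D 0 r ∈ Ideal.span {(q : CyclicAlgebra D)} ↔ r ∈ Ideal.span {(q : R)} := by
  rw [mem_span_natCast_iff]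
  have h5 : (mono D 0 r).coeff = Pi.single (zeroIdx D) r := coeff_mono (zeroIdx D) _
  rw [h5]
  constructor
  · intro h
    simpa using h (zeroIdx D)
  · intro h i
    rw [Pi.single_apply]
    split_ifs
    · exact h
    · exact zero_mem _

/-- The Jacobson radical is nilpotent, and with an element it contains its coefficients; these are
nilpotent modulo `q`, hence divisible by `q`. -/
theorem isSemisimpleRing_modQ [Finite (ModQ (CyclicAlgebra D) q)] (hD : InertiaFree D q)
    (hγ : Ideal.span {D.γ} ⊔ Ideal.span {(q : R)} = ⊤)
    (hq : (Ideal.span {(q : R)}).IsRadical) : IsSemisimpleRing (ModQ (CyclicAlgebra D) q) := by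
  rw [IsArtinianRing.isSemisimpleRing_iff_jacobson, eq_bot_iff]
  intro a ha
  let I := (Ring.jacobson (ModQ (CyclicAlgebra D) q)).comap (Ideal.Quotient.mk _)
  obtain ⟨k, hk⟩ := IsSemiprimaryRing.isNilpotent (R := ModQ (CyclicAlgebra D) q)
  obtain ⟨a, rfl⟩ := Ideal.Quotient.mk_surjective a
  have haI : a ∈ I := ha
  have hqI : (q : CyclicAlgebra D) ∈ I := by
    change Ideal.Quotient.mk _ _ ∈ Ring.jacobson _
    rw [Ideal.Quotient.eq_zero_iff_mem.2 (Ideal.mem_span_singleton_self _)]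
    exact zero_mem _
  rw [Submodule.mem_bot, Ideal.Quotient.eq_zero_iff_mem, mem_span_natCast_iff]
  intro i
  have h1 : mono D 0 (a.coeff i) ∈ I := mono_coeff_mem q hD hγ I hqI haI i
  have h2 : Ideal.Quotient.mk (Ideal.span {(q : CyclicAlgebra D)})
      (mono D 0 (a.coeff i)) ^ k = 0 := by
    have h3 : Ideal.Quotient.mk (Ideal.span {(q : CyclicAlgebra D)}) (mono D 0 (a.coeff i)) ^ k ∈
        Ring.jacobson (ModQ (CyclicAlgebra D) q) ^ k := Ideal.pow_mem_pow
        (show Ideal.Quotient.mk _ (mono D 0 (a.coeff i)) ∈ Ring.jacobson _ from h1) k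
    rw [hk] at h3
    exact h3
  rw [← map_pow, mono_zero_pow, Ideal.Quotient.eq_zero_iff_mem, mono_zero_mem_span_iff] at h2
  exact hq ⟨k, h2⟩

/-- The centre of `Λ / qΛ` consists of constants fixed by `θ`. -/
theorem exists_eq_mono_of_central (hD : InertiaFree D q)
    (hγ : Ideal.span {D.γ} ⊔ Ideal.span {(q : R)} = ⊤)
    (c : ModQ (CyclicAlgebra D) q) (hc : ∀ a, a * c = c * a) :
    ∃ r : R, c = Ideal.Quotient.mk _ (mono D 0 r) ∧ D.θ r - r ∈ Ideal.span {(q : R)} := by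
  obtain ⟨c, rfl⟩ := Ideal.Quotient.mk_surjective c
  have h1 : ∀ a : CyclicAlgebra D, a * c - c * a ∈ Ideal.span {(q : CyclicAlgebra D)} := by
    intro a
    rw [← Ideal.Quotient.eq, map_mul, map_mul]
    exact hc _
  have h2 : ∀ i : Fin D.d, (i : ℕ) ≠ 0 → c.coeff i ∈ Ideal.span {(q : R)} := by
    intro i hi
    have h3 : ∀ y ∈ Ideal.span (Set.range fun y : R => y - (D.θ ^ (i : ℕ)) y) ⊔
        Ideal.span {(q : R)}, y * c.coeff i ∈ Ideal.span {(q : R)} := by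
      intro y hy
      obtain ⟨x, hx, z, hz, rfl⟩ := Submodule.mem_sup.1 hy
      rw [add_mul]
      refine add_mem ?_ (Ideal.mul_mem_right _ _ hz)
      clear hy
      induction hx using Submodule.span_induction with
      | mem x h =>
        obtain ⟨y, rfl⟩ := h
        have h4 := (mem_span_natCast_iff q _).1 (h1 (mono D 0 y)) i
        change (mono D 0 y * c).coeff i - (c * mono D 0 y).coeff i ∈ _ at h4
        rw [coeff_mono_zero_mul, coeff_mul_mono_zero] at h4
        have h5 := neg_mem h4
        have h6 : (y - (D.θ ^ (i : ℕ)) y) * c.coeff i =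
            -((D.θ ^ (i : ℕ)) y * c.coeff i - c.coeff i * y) := by ring
        rw [h6]
        exact h5
      | zero => simp
      | add x y _ _ hx hy => rw [add_mul]; exact add_mem hx hy
      | smul r x _ hx => rw [smul_eq_mul, mul_assoc]; exact Ideal.mul_mem_left _ _ hx
    rw [hD i hi] at h3
    simpa using h3 1 trivial
  have h0 : Ideal.Quotient.mk (Ideal.span {(q : CyclicAlgebra D)}) c =
      Ideal.Quotient.mk _ (mono D 0 (c.coeff (zeroIdx D))) := by
    rw [Ideal.Quotient.eq, mem_span_natCast_iff]
    intro i
    change c.coeff i - (mono D 0 (c.coeff (zeroIdx D))).coeff i ∈ _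
    have h5 : (mono D 0 (c.coeff (zeroIdx D))).coeff =
        Pi.single (zeroIdx D) (c.coeff (zeroIdx D)) := coeff_mono (zeroIdx D) _
    rw [h5]
    by_cases hi : i = zeroIdx D
    · subst hi
      simp
    · rw [Pi.single_eq_of_ne hi, sub_zero]
      exact h2 i fun h => hi (Fin.ext h)
  refine ⟨_, h0, ?_⟩
  -- The constant `r` commutes with `u`, so that `θ r - r` is killed by `γ` modulo `q`.
  have h6 := hc (Ideal.Quotient.mk _ (mono D 1 1))
  rw [h0, ← map_mul, ← map_mul, Ideal.Quotient.eq, mono_mul_mono, mono_mul_mono] at h6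
  -- Multiplication by `u ^ (d - 1)` turns the degree `1` into the degree `0`, also when `d = 1`.
  have h7 := Ideal.mul_mem_left _ (mono D (D.d - 1) 1) h6
  have h8 : ∀ r : R, mono D D.d r = mono D 0 (D.γ * r) := by
    intro r
    have := mono_add_d (D := D) 0 1 r
    simpa using this
  rw [mul_sub, mono_mul_mono, mono_mul_mono, Nat.zero_add, add_zero,
    Nat.sub_add_cancel D.d_pos, h8, h8] at h7
  have h9 : ∀ r s : R, mono D 0 r - mono D 0 s = mono D 0 (r - s) := by
    intro r s
    rw [sub_eq_iff_eq_add, ← mono_add, sub_add_cancel]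
  rw [h9, mono_zero_mem_span_iff] at h7
  simp only [map_one, pow_zero, pow_one, one_mul, mul_one] at h7
  have h10 : (1 : R) ∈ Ideal.span {D.γ} ⊔ Ideal.span {(q : R)} := by rw [hγ]; trivial
  obtain ⟨x, hx, z, hz, hxz⟩ := Submodule.mem_sup.1 h10
  obtain ⟨g, rfl⟩ := Ideal.mem_span_singleton'.1 hx
  set r := c.coeff (zeroIdx D)
  have h11 : D.θ r - r = (D.θ r - r) * z - g * (D.γ * r - D.γ * D.θ r) := by
    linear_combination (D.θ r - r) * (-hxz)
  rw [h11]
  refine sub_mem (Ideal.mul_mem_left _ _ hz) (Ideal.mul_mem_left _ _ ?_)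
  simpa using h7

end Separable

end CyclicAlgebra

/-! ### The natural order modulo an unramified prime -/

section NumberTheory

variable {K L : Type*} [Field K] [Field L]

theorem under_mem_primesOver [Algebra K L] (q : ℕ) [hq : Fact q.Prime] {Q : Ideal (𝓞 L)}
    [Q.IsPrime] (h : (q : 𝓞 L) ∈ Q) :
    Q.under (𝓞 K) ∈ Ideal.primesOver (Ideal.span {(q : ℤ)}) (𝓞 K) := by
  refine ⟨inferInstance, ⟨?_⟩⟩
  have h1 : Ideal.span {(q : ℤ)} ≤ (Q.under (𝓞 K)).under ℤ := by
    rw [Ideal.span_singleton_le_iff_mem, Ideal.mem_comap]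
    rw [Ideal.mem_comap]
    simpa using h
  have h2 : (Ideal.span {(q : ℤ)}).IsMaximal :=
    PrincipalIdealRing.isMaximal_of_irreducible
      (Nat.prime_iff_prime_int.1 hq.out).irreducible
  exact h2.eq_of_le (Ideal.IsPrime.ne_top inferInstance) h1

variable [NumberField L]

theorem isRadical_span_natCast {q : ℕ} (hsq : Squarefree (Ideal.span {(q : 𝓞 L)})) :
    (Ideal.span {(q : 𝓞 L)}).IsRadical := by
  rintro x ⟨k, hk⟩
  have h1 : Ideal.span {(q : 𝓞 L)} ∣ Ideal.span {x} ^ k := by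
    rw [Ideal.span_singleton_pow, Ideal.dvd_iff_le, Ideal.span_singleton_le_iff_mem]
    exact hk
  have h2 := hsq.isRadical k _ h1
  rwa [Ideal.dvd_iff_le, Ideal.span_singleton_le_iff_mem] at h2

variable [NumberField K] [Algebra K L]
  [IsGalois K L]

theorem naturalData_θ_pow_apply (θ : L ≃ₐ[K] L) (γ : 𝓞 K) (k : ℕ) (x : 𝓞 L) :
    ((naturalData θ γ).θ ^ k) x = (θ ^ k) • x := by
  induction k generalizing x with
  | zero => simp
  | succ k ih =>
    rw [pow_succ, pow_succ, RingAut.mul_apply, ih, mul_smul]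
    rfl

variable (q : ℕ) [hq : Fact q.Prime]

theorem span_natCast_ne_bot : Ideal.span {(q : 𝓞 L)} ≠ ⊥ := by
  rw [Ne, Ideal.span_singleton_eq_bot]
  exact_mod_cast hq.out.ne_zero

/-- The order of the inertia group is the ramification index of `Q` over `K`, which divides that
over `ℚ`, and this is `1`. -/
theorem inertia_eq_bot (hsq : Squarefree (Ideal.span {(q : 𝓞 L)})) (Q : Ideal (𝓞 L)) [Q.IsPrime]
    (h : (q : 𝓞 L) ∈ Q) : Ideal.inertia (L ≃ₐ[K] L) Q = ⊥ := by
  have h0 : (q : 𝓞 K) ∈ Q.under (𝓞 K) := by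
    rw [Ideal.mem_comap]
    simpa using h
  have hp : Q.under (𝓞 K) ≠ ⊥ := by
    intro hbot
    rw [hbot, Ideal.mem_bot] at h0
    exact hq.out.ne_zero (by exact_mod_cast h0)
  have hdvd : Ideal.map (algebraMap (𝓞 K) (𝓞 L)) (Q.under (𝓞 K)) ∣ Ideal.span {(q : 𝓞 L)} := by
    rw [Ideal.dvd_iff_le, Ideal.span_singleton_le_iff_mem]
    simpa using Ideal.mem_map_of_mem (algebraMap (𝓞 K) (𝓞 L)) h0
  have hne : Ideal.map (algebraMap (𝓞 K) (𝓞 L)) (Q.under (𝓞 K)) ≠ ⊥ :=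
    fun hb => span_natCast_ne_bot (L := L) q (by
      rw [hb] at hdvd
      exact eq_bot_iff.2 (by simpa using (zero_dvd_iff.1 hdvd).le))
  have hmax : (Q.under (𝓞 K)).IsMaximal := Ideal.IsPrime.isMaximal inferInstance hp
  have : Finite (𝓞 K ⧸ Q.under (𝓞 K)) := Ideal.finiteQuotientOfFreeOfNeBot _ hp
  have hcard := Ideal.card_inertia_eq_ramificationIdxIn (G := L ≃ₐ[K] L) (Q.under (𝓞 K)) Q
  rw [Ideal.ramificationIdxIn_eq_ramificationIdx (Q.under (𝓞 K)) Q (L ≃ₐ[K] L),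
    Ideal.IsDedekindDomain.ramificationIdx_eq_normalizedFactors_count (Q.under (𝓞 K)) Q hne]
    at hcard
  have hnodup := (UniqueFactorizationMonoid.squarefree_iff_nodup_normalizedFactors hne).1
    (hsq.squarefree_of_dvd hdvd)
  have h1 := Multiset.nodup_iff_count_le_one.1 hnodup Q
  rw [← hcard] at h1
  exact Subgroup.card_le_one_iff_eq_bot _ |>.1 h1

/-- If the elements `y - θ ^ i y` and `q` lie in a common maximal ideal, then `θ ^ i` belongs to its
inertia group. -/
theorem inertiaFree_naturalData (θ : L ≃ₐ[K] L) (γ : 𝓞 K)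
    (hθ : ∀ g : L ≃ₐ[K] L, g ∈ Subgroup.zpowers θ)
    (hsq : Squarefree (Ideal.span {(q : 𝓞 L)})) :
    CyclicAlgebra.InertiaFree (naturalData θ γ) q := by
  intro i hi
  by_contra hne
  obtain ⟨Q, hQ, hle⟩ := Ideal.exists_le_maximal _ hne
  have hqQ : (q : 𝓞 L) ∈ Q := hle (Ideal.mem_sup_right (Ideal.mem_span_singleton_self _))
  have h1 : θ ^ (i : ℕ) ∈ Ideal.inertia (L ≃ₐ[K] L) Q := by
    intro x
    have h2 : x - ((naturalData θ γ).θ ^ (i : ℕ)) x ∈ Q :=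
      hle (Ideal.mem_sup_left (Ideal.subset_span ⟨x, rfl⟩))
    rw [naturalData_θ_pow_apply] at h2
    have h3 := Q.neg_mem h2
    rwa [neg_sub] at h3
  have := hQ.isPrime
  rw [inertia_eq_bot (K := K) q hsq Q hqQ, Subgroup.mem_bot] at h1
  have h2 : orderOf θ = Module.finrank K L := by
    rw [orderOf_eq_card_of_forall_mem_zpowers hθ, IsGalois.card_aut_eq_finrank]
  have h3 := Nat.le_of_dvd (Nat.pos_of_ne_zero hi) (orderOf_dvd_of_pow_eq_one h1)
  rw [h2] at h3
  exact absurd i.2 (not_lt.2 h3)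

theorem span_γ_sup_span_natCast (θ : L ≃ₐ[K] L) (γ : 𝓞 K)
    (hγ : ∀ p ∈ Ideal.primesOver (Ideal.span {(q : ℤ)}) (𝓞 K), γ ∉ p) :
    Ideal.span {(naturalData θ γ).γ} ⊔ Ideal.span {(q : 𝓞 L)} = ⊤ := by
  by_contra hne
  obtain ⟨Q, hQ, hle⟩ := Ideal.exists_le_maximal _ hne
  have hqQ : (q : 𝓞 L) ∈ Q := hle (Ideal.mem_sup_right (Ideal.mem_span_singleton_self _))
  have := hQ.isPrime
  refine hγ _ (under_mem_primesOver q hqQ) ?_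
  rw [Ideal.mem_comap]
  exact hle (Ideal.mem_sup_left (Ideal.mem_span_singleton_self _))

/-- Distinct simple factors of `Λ / qΛ` lie over distinct primes of `K`, because the Galois group
permutes the primes of `L` above a prime of `K` transitively. -/
theorem card_central_idempotents_le (θ : L ≃ₐ[K] L) (γ : 𝓞 K)
    (hθ : ∀ g : L ≃ₐ[K] L, g ∈ Subgroup.zpowers θ)
    (hsq : Squarefree (Ideal.span {(q : 𝓞 L)}))
    (hγ : ∀ p ∈ Ideal.primesOver (Ideal.span {(q : ℤ)}) (𝓞 K), γ ∉ p)
    {J : ℕ} (f : Fin J → ModQ (NaturalOrder θ γ) q) (hf0 : ∀ i, f i ≠ 0)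
    (hfc : ∀ i a, a * f i = f i * a) (hff : ∀ i j, i ≠ j → f i * f j = 0) :
    J ≤ (Ideal.primesOver (Ideal.span {(q : ℤ)}) (𝓞 K)).ncard := by
  have h1 := fun i => CyclicAlgebra.exists_eq_mono_of_central q
    (inertiaFree_naturalData q θ γ hθ hsq) (span_γ_sup_span_natCast q θ γ hγ) (f i) (hfc i)
  choose r hr hrθ using h1
  have hr0 : ∀ i, r i ∉ Ideal.span {(q : 𝓞 L)} := by
    intro i h
    refine hf0 i ?_
    rw [hr i, Ideal.Quotient.eq_zero_iff_mem, CyclicAlgebra.mono_zero_mem_span_iff]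
    exact h
  have hrr : ∀ i j, i ≠ j → r i * r j ∈ Ideal.span {(q : 𝓞 L)} := by
    intro i j hij
    have h2 := hff i j hij
    rw [hr i, hr j, ← map_mul, CyclicAlgebra.mono_mul_mono, Ideal.Quotient.eq_zero_iff_mem] at h2
    simpa using (CyclicAlgebra.mono_zero_mem_span_iff (D := naturalData θ γ) q (r i * r j)).1
      (by simpa using h2)
  -- Since `q` is unramified, `r i ∉ q 𝓞 L` is detected by a prime above `q`.
  have hQ : ∀ i, ∃ Q : Ideal (𝓞 L), Q.IsPrime ∧ (q : 𝓞 L) ∈ Q ∧ r i ∉ Q := by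
    intro i
    have h2 := hr0 i
    rw [← (isRadical_span_natCast hsq).radical, Ideal.radical_eq_sInf, Submodule.mem_sInf] at h2
    push Not at h2
    obtain ⟨Q, ⟨hle, hQ⟩, hrQ⟩ := h2
    exact ⟨Q, hQ, hle (Ideal.mem_span_singleton_self _), hrQ⟩
  choose Q hQp hqQ hrQ using hQ
  have hinj : Function.Injective fun i => (⟨(Q i).under (𝓞 K), under_mem_primesOver q (hqQ i)⟩ :
      Ideal.primesOver (Ideal.span {(q : ℤ)}) (𝓞 K)) := by
    intro i j hij
    by_contra hne
    have hij' : (Q i).under (𝓞 K) = (Q j).under (𝓞 K) := congrArg Subtype.val hij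
    have : (Q j).LiesOver ((Q i).under (𝓞 K)) := ⟨hij'⟩
    obtain ⟨σ, hσ⟩ := Ideal.exists_smul_eq_of_isGaloisGroup ((Q i).under (𝓞 K)) (Q i) (Q j)
      (L ≃ₐ[K] L)
    obtain ⟨k, rfl⟩ := (mem_powers_iff_mem_zpowers).2 (hθ σ)
    have hfix : ∀ k : ℕ, (θ ^ k) • r i - r i ∈ Ideal.span {(q : 𝓞 L)} := by
      intro k
      induction k with
      | zero => simp
      | succ k ih =>
        have h3 : (θ ^ (k + 1)) • r i - r i =
            (naturalData θ γ).θ ((θ ^ k) • r i - r i) + ((naturalData θ γ).θ (r i) - r i) := by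
          have h4 := naturalData_θ_pow_apply θ γ 1 ((θ ^ k) • r i)
          rw [pow_one, pow_one, ← mul_smul, ← pow_succ'] at h4
          rw [map_sub, h4]
          ring
        rw [h3]
        refine add_mem ?_ (hrθ i)
        obtain ⟨c, hc⟩ := Ideal.mem_span_singleton'.1 ih
        rw [← hc, map_mul, map_natCast]
        exact Ideal.mul_mem_left _ _ (Ideal.mem_span_singleton_self _)
    have hle : Ideal.span {(q : 𝓞 L)} ≤ Q j := by
      rw [Ideal.span_singleton_le_iff_mem]
      exact hqQ j
    -- `σ` maps `Q i` to `Q j` and fixes `r i` modulo `q`; hence `r i ∈ Q i`, a contradiction.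
    have h5 : r i ∈ Q j := ((hQp j).mem_or_mem (hle (hrr i j hne))).resolve_right (hrQ j)
    have h6 : (θ ^ k) • r i ∈ Q j := by
      have := add_mem (hle (hfix k)) h5
      simpa using this
    rw [← hσ] at h6
    exact hrQ i (by simpa using h6)
  have hfin : Finite (Ideal.primesOver (Ideal.span {(q : ℤ)}) (𝓞 K)) := by
    have : (Ideal.span {(q : ℤ)}).IsMaximal :=
      PrincipalIdealRing.isMaximal_of_irreducible (Nat.prime_iff_prime_int.1 hq.out).irreducible
    exact (IsDedekindDomain.primesOver_finite (Ideal.span {(q : ℤ)}) (𝓞 K)).to_subtype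
  have := Nat.card_le_card_of_injective _ hinj
  simpa [Set.ncard] using this

end NumberTheory

/-! ### Coordinates modulo `q` -/

section Coordinates

variable {S : Type*} [Ring S] {N : ℕ} (B : Module.Basis (Fin N) ℤ S) {q : ℕ}

/-- The coordinates of an element of `S / q S`, as residue classes. -/
def crd (x : ModQ S q) (i : Fin N) : ZMod q :=
  (B.repr (Function.surjInv Ideal.Quotient.mk_surjective x) i : ℤ)

theorem crd_mk (s : S) (i : Fin N) : crd B (Ideal.Quotient.mk (Ideal.span {(q : S)}) s) i =
    ((B.repr s i : ℤ) : ZMod q) := by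
  have h := Function.surjInv_eq
    (Ideal.Quotient.mk_surjective (I := Ideal.span {(q : S)})) (Ideal.Quotient.mk _ s)
  rw [Ideal.Quotient.eq, Ideal.mem_span_singleton'] at h
  obtain ⟨c, hc⟩ := h
  rw [crd, ← sub_eq_zero, ← Int.cast_sub, ← Finsupp.sub_apply, ← map_sub, ← hc,
    ← (Nat.cast_commute q c).eq, ← nsmul_eq_mul, map_nsmul]
  simp

theorem crd_mk_sum (v : Fin N → ℕ) (i : Fin N) :
    crd B (Ideal.Quotient.mk (Ideal.span {(q : S)}) (∑ j, v j • B j)) i = (v i : ZMod q) := by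
  rw [crd_mk]
  simp only [map_sum, map_nsmul, Module.Basis.repr_self, Finsupp.coe_finsetSum, Finsupp.coe_smul,
    Finset.sum_apply, Pi.smul_apply]
  rw [Finset.sum_eq_single i]
  · simp
  · intro j _ hj
    simp [Finsupp.single_eq_of_ne hj.symm]
  · simp

theorem crd_add (x y : ModQ S q) (i : Fin N) : crd B (x + y) i = crd B x i + crd B y i := by
  obtain ⟨x, rfl⟩ := Ideal.Quotient.mk_surjective x
  obtain ⟨y, rfl⟩ := Ideal.Quotient.mk_surjective y
  rw [← map_add, crd_mk, crd_mk, crd_mk]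
  simp

theorem crd_neg (x : ModQ S q) (i : Fin N) : crd B (-x) i = -crd B x i := by
  obtain ⟨x, rfl⟩ := Ideal.Quotient.mk_surjective x
  rw [← map_neg, crd_mk, crd_mk]
  simp

theorem crd_sub (x y : ModQ S q) (i : Fin N) : crd B (x - y) i = crd B x i - crd B y i := by
  rw [sub_eq_add_neg, crd_add, crd_neg, sub_eq_add_neg]

theorem crd_zero (i : Fin N) : crd B (0 : ModQ S q) i = 0 := by
  rw [← map_zero (Ideal.Quotient.mk (Ideal.span {(q : S)})), crd_mk]
  simp

theorem crd_mul (x y : ModQ S q) (k : Fin N) : crd B (x * y) k =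
    ∑ i, ∑ j, crd B x i * crd B y j *
      crd B (Ideal.Quotient.mk (Ideal.span {(q : S)}) (B i * B j)) k := by
  obtain ⟨x, rfl⟩ := Ideal.Quotient.mk_surjective x
  obtain ⟨y, rfl⟩ := Ideal.Quotient.mk_surjective y
  rw [← map_mul]
  simp only [crd_mk]
  conv_lhs => rw [← B.sum_repr x, ← B.sum_repr y, Finset.sum_mul_sum]
  simp only [smul_mul_assoc, mul_smul_comm, map_sum, map_zsmul, Finsupp.coe_finsetSum,
    Finsupp.coe_smul, Finset.sum_apply, Pi.smul_apply, smul_eq_mul]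
  push_cast
  refine Finset.sum_congr rfl fun i _ => Finset.sum_congr rfl fun j _ => ?_
  ring

theorem crd_injective : Function.Injective (crd B : ModQ S q → Fin N → ZMod q) := by
  intro x y h
  rw [← sub_eq_zero]
  have h0 : ∀ i, crd B (x - y) i = 0 := fun i => by rw [crd_sub, h, sub_self]
  obtain ⟨z, hz⟩ := Ideal.Quotient.mk_surjective (x - y)
  rw [← hz] at h0 ⊢
  simp only [crd_mk, ZMod.intCast_zmod_eq_zero_iff_dvd] at h0
  choose c hc using h0
  rw [Ideal.Quotient.eq_zero_iff_mem, Ideal.mem_span_singleton']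
  refine ⟨∑ i, c i • B i, ?_⟩
  rw [← (Nat.cast_commute q _).eq, Finset.mul_sum]
  conv_rhs => rw [← B.sum_repr z]
  refine Finset.sum_congr rfl fun i _ => ?_
  rw [hc, mul_smul, Nat.cast_smul_eq_nsmul, nsmul_eq_mul]

theorem length_encode (x : ModQ S q) : (encode B q x).length = N := by
  rw [encode, List.length_ofFn]

theorem decode_eq {l : List ℕ} {o : ℕ} {x : ModQ S q}
    (h : ∀ i : Fin N, (l.getD (o + i) 0 : ZMod q) = crd B x i) : decode B q l o = x := by
  apply crd_injective B
  funext i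
  rw [decode, crd_mk_sum B fun i : Fin N => l.getD (o + i) 0]
  exact h i

variable [NeZero q]

theorem crd_surjective : Function.Surjective (crd B : ModQ S q → Fin N → ZMod q) := by
  intro v
  refine ⟨Ideal.Quotient.mk _ (∑ j, (v j).val • B j), ?_⟩
  funext i
  rw [crd_mk_sum B fun j => (v j).val]
  simp

theorem card_modQ (B : Module.Basis (Fin N) ℤ S) : Nat.card (ModQ S q) = q ^ N := by
  rw [Nat.card_congr (Equiv.ofBijective _ ⟨crd_injective B, crd_surjective B⟩), Nat.card_fun,
    Nat.card_zmod, Nat.card_eq_fintype_card, Fintype.card_fin]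

theorem encode_eq (x : ModQ S q) : encode B q x = List.ofFn fun i => (crd B x i).val := by
  rw [encode]
  congr 1
  funext i
  rw [← Int.natCast_inj, crd, ZMod.val_intCast, Int.toNat_of_nonneg]
  exact Int.emod_nonneg _ (by exact_mod_cast NeZero.ne q)

end Coordinates

section Lagrange

variable {S : Type*} [Ring S] {N : ℕ} (q : ℕ)

theorem natCast_modQ : (q : ModQ S q) = 0 := by
  have := Ideal.Quotient.eq_zero_iff_mem.2 (Ideal.mem_span_singleton_self (q : S))
  simpa using this

/-- The structure of an algebra over the prime field on `S / q S`. -/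
abbrev modQAlgebra : Algebra (ZMod q) (ModQ S q) :=
  ZMod.algebra' (ModQ S q) (ringChar (ModQ S q)) (ringChar.dvd (natCast_modQ q))

/-- The order of the general linear group of degree `N` over the field with `q` elements, written in
the form in which a program can compute it factor by factor. -/
def glCard (q N : ℕ) : ℕ := ∏ i ∈ Finset.range N, (q ^ (i + 1) - 1) * q ^ i

theorem glCard_eq (q N : ℕ) : glCard q N = ∏ i : Fin N, (q ^ N - q ^ (i : ℕ)) := by
  have h1 : ∏ i ∈ Finset.range N, (q ^ (i + 1) - 1) =
      ∏ i ∈ Finset.range N, (q ^ (N - i) - 1) := by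
    rw [← Finset.prod_range_reflect]
    refine Finset.prod_congr rfl fun i hi => ?_
    rw [Finset.mem_range] at hi
    congr 2
    omega
  rw [glCard, Finset.prod_mul_distrib, h1, ← Finset.prod_mul_distrib,
    Fin.prod_univ_eq_prod_range (fun i => q ^ N - q ^ i) N]
  refine Finset.prod_congr rfl fun i hi => ?_
  rw [Finset.mem_range] at hi
  rw [Nat.sub_mul, one_mul, ← pow_add, Nat.sub_add_cancel hi.le]

theorem glCard_pos [hq : Fact q.Prime] : 0 < glCard q N := by
  refine Finset.prod_pos fun i _ => Nat.mul_pos (Nat.sub_pos_of_lt ?_) (pow_pos hq.out.pos _)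
  exact Nat.one_lt_pow (Nat.succ_ne_zero i) hq.out.one_lt

/-- Lagrange's theorem for the image of the unit group under the regular representation. -/
theorem unit_pow_glCard (B : Module.Basis (Fin N) ℤ S) [hq : Fact q.Prime] (a : (ModQ S q)ˣ) :
    a ^ glCard q N = 1 := by
  let _ : Algebra (ZMod q) (ModQ S q) := modQAlgebra q
  have hfin : Finite (ModQ S q) :=
    (Equiv.ofBijective _ ⟨crd_injective B, crd_surjective B⟩).finite_iff.2 inferInstance
  have hmod : Module.Finite (ZMod q) (ModQ S q) := Module.Finite.of_finite
  have hrank : Module.finrank (ZMod q) (ModQ S q) = N := by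
    have h1 := Module.natCard_eq_pow_finrank (K := ZMod q) (V := ModQ S q)
    rw [card_modQ B, Nat.card_zmod] at h1
    exact (Nat.pow_right_injective hq.out.two_le h1).symm
  let b := Module.finBasisOfFinrankEq (ZMod q) (ModQ S q) hrank
  let φ : (ModQ S q)ˣ →* GL (Fin N) (ZMod q) :=
    Units.map (Algebra.leftMulMatrix b : ModQ S q →ₐ[ZMod q] _).toMonoidHom
  have hφ : Function.Injective φ := Units.map_injective (Algebra.leftMulMatrix_injective b)
  apply hφ
  rw [map_pow, map_one, glCard_eq]
  have h2 := Matrix.card_GL_field (𝔽 := ZMod q) N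
  rw [ZMod.card] at h2
  rw [← h2]
  exact pow_card_eq_one'

/-- The test for invertibility, and the inverse, by exponentiation. -/
theorem isUnit_iff_mul_pow_eq_one (B : Module.Basis (Fin N) ℤ S) [hq : Fact q.Prime]
    (a : ModQ S q) :
    IsUnit a ↔ a * a ^ (glCard q N - 1) = 1 := by
  rw [← pow_succ', Nat.sub_add_cancel (glCard_pos q)]
  constructor
  · rintro ⟨u, rfl⟩
    rw [← Units.val_pow_eq_pow_val, unit_pow_glCard q B u, Units.val_one]
  · intro h
    exact IsUnit.of_pow_eq_one h (glCard_pos q).ne'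

theorem inv_eq_pow (B : Module.Basis (Fin N) ℤ S) [hq : Fact q.Prime] (a : (ModQ S q)ˣ) :
    (↑a⁻¹ : ModQ S q) = (a : ModQ S q) ^ (glCard q N - 1) := by
  rw [← Units.val_pow_eq_pow_val]
  congr 1
  rw [inv_eq_iff_mul_eq_one, ← pow_succ', Nat.sub_add_cancel (glCard_pos q), unit_pow_glCard q B]

end Lagrange

/-! ### Unit density of the natural order modulo `q` -/

/-- A random element of `Λ / qΛ` is invertible with probability at least `exp (-d)`. -/
theorem exp_neg_le_unit_density {K L : Type*} [Field K] [NumberField K] [Field L] [NumberField L]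
    [Algebra K L] [IsGalois K L] (n d : ℕ) (θ : L ≃ₐ[K] L)
    (hθ : ∀ g : L ≃ₐ[K] L, g ∈ Subgroup.zpowers θ) (γ : 𝓞 K) (q : ℕ) [Fact q.Prime]
    (hn : n + 1 ≤ q)
    (hsplit : (Ideal.primesOver (Ideal.span {(q : ℤ)}) (𝓞 K)).ncard = n)
    (hsq : Squarefree (Ideal.span {(q : 𝓞 L)}))
    (hγ : ∀ p ∈ Ideal.primesOver (Ideal.span {(q : ℤ)}) (𝓞 K), γ ∉ p)
    (B : Module.Basis (Fin (n * d ^ 2)) ℤ (NaturalOrder θ γ)) :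
    Real.exp (-(d : ℝ)) ≤
      (Nat.card (ModQ (NaturalOrder θ γ) q)ˣ : ℝ) / Nat.card (ModQ (NaturalOrder θ γ) q) := by
  let _ : Algebra (ZMod q) (ModQ (NaturalOrder θ γ) q) := modQAlgebra q
  have : IsSemisimpleRing (ModQ (NaturalOrder θ γ) q) :=
    CyclicAlgebra.isSemisimpleRing_modQ q (inertiaFree_naturalData q θ γ hθ hsq)
      (span_γ_sup_span_natCast q θ γ hγ) (isRadical_span_natCast hsq)
  refine (exp_neg_le_pow q n d hn).trans
    (unit_density_of_isSemisimpleRing q n d (card_modQ B) fun J f h0 hc _ hff => ?_)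
  rw [← hsplit]
  exact card_central_idempotents_le q θ γ hθ hsq hγ f h0 hc hff

namespace RAM

/-! ### Deterministic and probabilistic execution -/

/-- All memory cells hold numbers of bit length at most `w`. -/
def Bdd (w : ℕ) (mem : ℕ → ℕ) : Prop := ∀ a, mem a < 2 ^ w

theorem Bdd.update {w : ℕ} {mem : ℕ → ℕ} (h : Bdd w mem) (a : ℕ) {v : ℕ} (hv : v < 2 ^ w) :
    Bdd w (Function.update mem a v) := by
  intro b
  rw [Function.update_apply]
  split_ifs
  · exact hv
  · exact h b

theorem Bdd.writeMem {w : ℕ} {mem : ℕ → ℕ} (h : Bdd w mem) (a : ℕ) {l : List ℕ}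
    (hl : ∀ x ∈ l, x < 2 ^ w) : Bdd w (writeMem mem a l) := by
  intro b
  rw [RAM.writeMem]
  split_ifs with hb
  · have : b - a < l.length := by omega
    rw [List.getD_eq_getElem _ _ this]
    exact hl _ (List.getElem_mem this)
  · exact h b

/-- The cost of an expression is at most this multiple of `w + 1`, if the memory cells hold numbers
of bit length at most `w` (`Expr.cost_le`). Intermediate values may be longer than `w`: the cost of
a node is bounded by the costs of its arguments. -/
def Expr.wt : Expr → ℕ
  | const n => 1 + n.size
  | load e => 1 + e.wt
  | add e f => 2 * (e.wt + f.wt)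
  | sub e f => 2 * (e.wt + f.wt)
  | mul e f => 2 * (e.wt + f.wt)
  | div e f => 2 * (e.wt + f.wt)
  | mod e f => 2 * (e.wt + f.wt)

theorem Expr.wt_pos (e : Expr) : 0 < e.wt := by
  induction e <;> simp only [wt] <;> omega

theorem size_add_le (a b : ℕ) : (a + b).size ≤ a.size + b.size + 1 := by
  rw [Nat.size_le]
  have h1 := Nat.lt_size_self a
  have h2 := Nat.lt_size_self b
  have h3 : 2 ^ a.size ≤ 2 ^ (a.size + b.size) := Nat.pow_le_pow_right two_pos (by omega)
  have h4 : 2 ^ b.size ≤ 2 ^ (a.size + b.size) := Nat.pow_le_pow_right two_pos (by omega)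
  rw [pow_succ]
  omega

theorem size_mul_le (a b : ℕ) : (a * b).size ≤ a.size + b.size := by
  rw [Nat.size_le, pow_add]
  exact Nat.mul_lt_mul'' (Nat.lt_size_self a) (Nat.lt_size_self b)

/-- The cost of an expression pays for the length of its value. -/
theorem Expr.size_lt_cost (mem : ℕ → ℕ) (e : Expr) : (e.eval mem).size < e.cost mem := by
  cases e <;> simp only [eval, cost] <;> omega

theorem Expr.cost_le {w : ℕ} {mem : ℕ → ℕ} (h : Bdd w mem) (e : Expr) :
    e.cost mem ≤ e.wt * (w + 1) := by
  have key : ∀ e f : Expr, e.cost mem ≤ e.wt * (w + 1) → f.cost mem ≤ f.wt * (w + 1) → ∀ v : ℕ,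
      v.size ≤ (e.eval mem).size + (f.eval mem).size + 1 →
      1 + v.size + e.cost mem + f.cost mem ≤ 2 * (e.wt + f.wt) * (w + 1) := by
    intro e f he hf v hv
    have h1 := e.size_lt_cost mem
    have h2 := f.size_lt_cost mem
    calc 1 + v.size + e.cost mem + f.cost mem ≤ 2 * (e.cost mem + f.cost mem) := by omega
      _ ≤ 2 * (e.wt * (w + 1) + f.wt * (w + 1)) := by omega
      _ = _ := by ring
  induction e with
  | const n =>
    simp only [cost, wt]
    exact Nat.le_mul_of_pos_right _ (Nat.succ_pos w)
  | load e ih =>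
    simp only [cost, wt]
    have := Nat.size_le.2 (h (e.eval mem))
    rw [add_mul]
    omega
  | add e f he hf => exact key e f he hf _ (size_add_le _ _)
  | sub e f he hf =>
    exact key e f he hf _ ((Nat.size_le_size (Nat.sub_le _ _)).trans (by omega))
  | mul e f he hf => exact key e f he hf _ ((size_mul_le _ _).trans (by omega))
  | div e f he hf =>
    exact key e f he hf _ ((Nat.size_le_size (Nat.div_le_self _ _)).trans (by omega))
  | mod e f he hf =>
    exact key e f he hf _ ((Nat.size_le_size (Nat.mod_le _ _)).trans (by omega))

theorem Expr.cost_pos (mem : ℕ → ℕ) (e : Expr) : 0 < e.cost mem :=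
  (Nat.zero_le _).trans_lt (e.size_lt_cost mem)

theorem run_add (O : Oracles) (r s : ℕ) (c : Config) :
    run O (r + s) c = (run O r c).bind (run O s) := by
  induction r generalizing c with
  | zero => simp [run]
  | succ r ih =>
    rw [Nat.add_right_comm, run, run, PMF.bind_bind]
    congr 1
    funext c'
    exact ih c'

/-- For every continuation, the command `c` deterministically turns the memory `mem` into `mem'`,
in at most `s` units of time of length `w + 1`. -/
def Exec (w : ℕ) (c : Cmd) (mem mem' : ℕ → ℕ) (s : ℕ) : Prop :=
  -- `u` is the time and `r ≤ u` the number of steps.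
  ∀ (O : Oracles) (k : List Cmd) (t : ℕ), ∃ u r, r ≤ u ∧ u ≤ s * (w + 1) ∧
    run O r ⟨c :: k, mem, t⟩ = PMF.pure ⟨k, mem', t + u⟩

theorem Exec.mono {w : ℕ} {c : Cmd} {mem mem' : ℕ → ℕ} {s s' : ℕ} (h : Exec w c mem mem' s)
    (hs : s ≤ s') : Exec w c mem mem' s' := fun O k t => by
  obtain ⟨u, r, h1, h2, h3⟩ := h O k t
  exact ⟨u, r, h1, h2.trans (Nat.mul_le_mul_right _ hs), h3⟩

theorem exec_assign {w : ℕ} {mem : ℕ → ℕ} (h : Bdd w mem) (dst e : Expr) :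
    Exec w (.assign dst e) mem (Function.update mem (dst.eval mem) (e.eval mem))
      (dst.wt + e.wt) := fun O k t => by
  refine ⟨dst.cost mem + e.cost mem, 1, ?_, ?_, ?_⟩
  · have := e.cost_pos mem
    omega
  · rw [add_mul]
    exact add_le_add (dst.cost_le h) (e.cost_le h)
  · simp [run, step, add_assoc]

theorem exec_skip (w : ℕ) (mem : ℕ → ℕ) : Exec w .skip mem mem 1 := fun O k t =>
  ⟨1, 1, le_rfl, by omega, by simp [run, step]⟩

theorem Exec.seq {w : ℕ} {c₁ c₂ : Cmd} {m₀ m₁ m₂ : ℕ → ℕ} {s₁ s₂ : ℕ}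
    (h₁ : Exec w c₁ m₀ m₁ s₁) (h₂ : Exec w c₂ m₁ m₂ s₂) :
    Exec w (.seq c₁ c₂) m₀ m₂ (1 + s₁ + s₂) := fun O k t => by
  obtain ⟨u₁, r₁, h1, h2, h3⟩ := h₁ O (c₂ :: k) (t + 1)
  obtain ⟨u₂, r₂, h4, h5, h6⟩ := h₂ O k (t + 1 + u₁)
  refine ⟨1 + u₁ + u₂, 1 + (r₁ + r₂), by omega, ?_, ?_⟩
  · rw [add_mul, add_mul]
    omega
  · rw [run_add]
    simp only [run, step, PMF.pure_bind]
    rw [run_add, h3, PMF.pure_bind, h6]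
    congr 2
    omega

theorem exec_ite {w : ℕ} {mem mem' : ℕ → ℕ} (h : Bdd w mem) (e : Expr) {c₁ c₂ : Cmd} {s : ℕ}
    (hc : Exec w (if e.eval mem ≠ 0 then c₁ else c₂) mem mem' s) :
    Exec w (.ite e c₁ c₂) mem mem' (e.wt + s) := fun O k t => by
  obtain ⟨u₁, r₁, h1, h2, h3⟩ := hc O k (t + e.cost mem)
  have := e.cost_pos mem
  have h4 := e.cost_le h
  refine ⟨e.cost mem + u₁, 1 + r₁, by omega, ?_, ?_⟩
  · rw [add_mul]
    omega
  · rw [run_add]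
    simp only [run, step, PMF.pure_bind, PMF.bind_pure]
    rw [h3, add_assoc]

theorem exec_loop_stop {w : ℕ} {mem : ℕ → ℕ} (h : Bdd w mem) (e : Expr) {c : Cmd}
    (he : e.eval mem = 0) : Exec w (.loop e c) mem mem e.wt := fun O k t =>
  ⟨e.cost mem, 1, e.cost_pos mem, e.cost_le h, by simp [run, step, he]⟩

theorem exec_loop_step {w : ℕ} {m₀ m₁ m₂ : ℕ → ℕ} (h : Bdd w m₀) {e : Expr} {c : Cmd}
    (he : e.eval m₀ ≠ 0) {s₁ s₂ : ℕ} (h₁ : Exec w c m₀ m₁ s₁) (h₂ : Exec w (.loop e c) m₁ m₂ s₂) :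
    Exec w (.loop e c) m₀ m₂ (e.wt + s₁ + s₂) := fun O k t => by
  obtain ⟨u₁, r₁, h1, h2, h3⟩ := h₁ O (.loop e c :: k) (t + e.cost m₀)
  obtain ⟨u₂, r₂, h4, h5, h6⟩ := h₂ O k (t + e.cost m₀ + u₁)
  have := e.cost_pos m₀
  have h7 := e.cost_le h
  refine ⟨e.cost m₀ + u₁ + u₂, 1 + (r₁ + r₂), by omega, ?_, ?_⟩
  · rw [add_mul, add_mul]
    omega
  · rw [run_add]
    simp only [run, step, PMF.pure_bind, PMF.bind_pure, if_pos he]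
    rw [run_add, h3, PMF.pure_bind, h6]
    congr 2
    omega

/-- Started with the commands `k` and the memory `mem`, the machine halts within `τ` units of time
of length `w + 1`, and `out` applied to its final memory has the distribution `φ`. -/
def Halts {β : Type*} (w : ℕ) (O : Oracles) (out : (ℕ → ℕ) → β) (k : List Cmd) (mem : ℕ → ℕ)
    (τ : ℕ) (φ : PMF β) : Prop :=
  ∀ t s, τ * (w + 1) ≤ s → (run O s ⟨k, mem, t⟩).map (fun c => out c.mem) = φ ∧
    ∀ c ∈ (run O s ⟨k, mem, t⟩).support, c.todo = [] ∧ c.time ≤ t + τ * (w + 1)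

section Halts

variable {β : Type*} {w : ℕ} {O : Oracles} {out : (ℕ → ℕ) → β} {k : List Cmd} {mem : ℕ → ℕ}
  {τ : ℕ} {φ : PMF β}

theorem Halts.mono (h : Halts w O out k mem τ φ) {τ' : ℕ} (hτ : τ ≤ τ') :
    Halts w O out k mem τ' φ := fun t s hs => by
  have h1 := Nat.mul_le_mul_right (w + 1) hτ
  obtain ⟨h2, h3⟩ := h t s (h1.trans hs)
  exact ⟨h2, fun c hc => ⟨(h3 c hc).1, (h3 c hc).2.trans (by omega)⟩⟩

theorem run_nil (O : Oracles) (mem : ℕ → ℕ) (t s : ℕ) :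
    run O s ⟨[], mem, t⟩ = PMF.pure ⟨[], mem, t⟩ := by
  induction s with
  | zero => rfl
  | succ s ih => rw [run, step, PMF.pure_bind, ih]

theorem halts_nil (w : ℕ) (O : Oracles) (out : (ℕ → ℕ) → β) (mem : ℕ → ℕ) :
    Halts w O out [] mem 0 (PMF.pure (out mem)) := fun t s _ => by
  rw [run_nil]
  refine ⟨PMF.pure_map _ _, fun c hc => ?_⟩
  rw [PMF.mem_support_pure_iff] at hc
  subst hc
  simp

theorem Halts.exec {c : Cmd} {mem' : ℕ → ℕ} {s : ℕ} (h : Halts w O out k mem' τ φ)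
    (hc : Exec w c mem mem' s) : Halts w O out (c :: k) mem (τ + s) φ := fun t n hn => by
  obtain ⟨u, r, h1, h2, h3⟩ := hc O k t
  rw [add_mul] at hn ⊢
  obtain ⟨n', rfl⟩ : ∃ n', n = r + n' := ⟨n - r, by omega⟩
  rw [run_add, h3, PMF.pure_bind]
  obtain ⟨h4, h5⟩ := h (t + u) n' (by omega)
  exact ⟨h4, fun c hc => ⟨(h5 c hc).1, (h5 c hc).2.trans (by omega)⟩⟩

/-- A step with random outcome `p`, distributed according to `D`. -/
theorem halts_of_step {ι : Type*} (D : PMF ι) (ψ : ι → PMF β) {c : Cmd} {s : ℕ} (hs : 0 < s)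
    (next : ι → List Cmd × (ℕ → ℕ) × ℕ)
    (hstep : ∀ t, step O ⟨c :: k, mem, t⟩ =
      D.map fun p => ⟨(next p).1, (next p).2.1, t + (next p).2.2⟩)
    (hcost : ∀ p, (next p).2.2 ≤ s * (w + 1))
    (h : ∀ p, Halts w O out (next p).1 (next p).2.1 τ (ψ p)) :
    Halts w O out (c :: k) mem (τ + s) (D.bind ψ) := fun t n hn => by
  rw [add_mul] at hn ⊢
  have h1 : 1 ≤ s * (w + 1) := Nat.mul_pos hs (Nat.succ_pos w)
  obtain ⟨n', rfl⟩ : ∃ n', n = n' + 1 := ⟨n - 1, by omega⟩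
  rw [run, hstep, PMF.bind_map]
  constructor
  · rw [PMF.map_bind]
    congr 1
    funext p
    exact (h p (t + (next p).2.2) n' (by omega)).1
  · intro c hc
    rw [PMF.mem_support_bind_iff] at hc
    obtain ⟨p, -, hp⟩ := hc
    have h2 := (h p (t + (next p).2.2) n' (by omega)).2 c hp
    have h3 := hcost p
    exact ⟨h2.1, h2.2.trans (by omega)⟩

theorem listCost_le {l : List ℕ} (hl : ∀ x ∈ l, x < 2 ^ w) :
    listCost l ≤ l.length * (w + 1) := by
  rw [listCost, ← List.length_map (f := fun x : ℕ => 1 + x.size)]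
  refine (List.sum_le_card_nsmul _ (w + 1) fun x hx => ?_).trans_eq (by simp)
  rw [List.mem_map] at hx
  obtain ⟨y, hy, rfl⟩ := hx
  have := Nat.size_le.2 (hl y hy)
  omega

theorem Halts.seq {c₁ c₂ : Cmd} (h : Halts w O out (c₁ :: c₂ :: k) mem τ φ) :
    Halts w O out (.seq c₁ c₂ :: k) mem (τ + 1) φ := by
  have := halts_of_step (w := w) (k := k) (mem := mem) (PMF.pure ()) (fun _ => φ)
    (c := .seq c₁ c₂) (s := 1) one_pos
    (fun _ => (c₁ :: c₂ :: k, mem, 1)) (fun t => by simp [step, PMF.pure_map])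
    (fun _ => by simp) (fun _ => h)
  simpa using this

theorem Halts.ite {e : Expr} {c₁ c₂ : Cmd} (hb : Bdd w mem)
    (h : Halts w O out ((if e.eval mem ≠ 0 then c₁ else c₂) :: k) mem τ φ) :
    Halts w O out (.ite e c₁ c₂ :: k) mem (τ + e.wt) φ := by
  have := halts_of_step (w := w) (k := k) (mem := mem) (PMF.pure ()) (fun _ => φ)
    (c := .ite e c₁ c₂) (s := e.wt) e.wt_pos
    (fun _ => ((if e.eval mem ≠ 0 then c₁ else c₂) :: k, mem, e.cost mem))
    (fun t => by simp [step, PMF.pure_map]) (fun _ => e.cost_le hb) (fun _ => h)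
  simpa using this

theorem Halts.loop {e : Expr} {c : Cmd} (hb : Bdd w mem)
    (h : Halts w O out (if e.eval mem ≠ 0 then c :: .loop e c :: k else k) mem τ φ) :
    Halts w O out (.loop e c :: k) mem (τ + e.wt) φ := by
  have := halts_of_step (w := w) (k := k) (mem := mem) (PMF.pure ()) (fun _ => φ)
    (c := .loop e c) (s := e.wt) e.wt_pos
    (fun _ => (if e.eval mem ≠ 0 then c :: .loop e c :: k else k, mem, e.cost mem))
    (fun t => by simp [step, PMF.pure_map]) (fun _ => e.cost_le hb) (fun _ => h)
  simpa using this

/-- A call of the sample oracle, whose reply is the encoding of an object with distribution `D`. -/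
theorem halts_sample {ι : Type*} {D : PMF ι} {enc : ι → List ℕ} {ψ : ι → PMF β} {dst : Expr}
    {l : ℕ} (hO : O.sample = D.map enc) (hb : Bdd w mem)
    (henc : ∀ p, (enc p).length ≤ l ∧ ∀ x ∈ enc p, x < 2 ^ w)
    (h : ∀ p, Halts w O out k (writeMem mem (dst.eval mem) (enc p)) τ (ψ p)) :
    Halts w O out (.sample dst :: k) mem (τ + (1 + dst.wt + l)) (D.bind ψ) := by
  refine halts_of_step (w := w) D ψ (by omega)
    (fun p => (k, writeMem mem (dst.eval mem) (enc p), 1 + dst.cost mem + listCost (enc p)))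
    (fun t => ?_) (fun p => ?_) h
  · simp only [step, hO, PMF.map_comp]
    congr 1
    funext p
    simp [add_assoc]
  · have h1 := dst.cost_le hb
    have h2 := listCost_le (w := w) (henc p).2
    have h3 := Nat.mul_le_mul_right (w + 1) (henc p).1
    simp only [add_mul]
    omega

/-- A call of the solver, whose reply is the encoding of an object with distribution `D`. -/
theorem halts_solve {ι : Type*} {D : PMF ι} {enc : ι → List ℕ} {ψ : ι → PMF β}
    {src len dst : Expr} {l : ℕ}
    (hO : O.solver (readMem mem (src.eval mem) (len.eval mem)) = D.map enc) (hb : Bdd w mem)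
    (henc : ∀ p, (enc p).length ≤ l ∧ ∀ x ∈ enc p, x < 2 ^ w)
    (h : ∀ p, Halts w O out k (writeMem mem (dst.eval mem) (enc p)) τ (ψ p)) :
    Halts w O out (.solve src len dst :: k) mem
      (τ + (1 + src.wt + len.wt + dst.wt + len.eval mem + l)) (D.bind ψ) := by
  refine halts_of_step (w := w) D ψ (by omega)
    (fun p => (k, writeMem mem (dst.eval mem) (enc p), 1 + src.cost mem + len.cost mem +
      dst.cost mem + listCost (readMem mem (src.eval mem) (len.eval mem)) + listCost (enc p)))
    (fun t => ?_) (fun p => ?_) h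
  · simp only [step, hO, PMF.map_comp]
    congr 1
    funext p
    simp [add_assoc]
  · have h1 := dst.cost_le hb
    have h4 := src.cost_le hb
    have h5 := len.cost_le hb
    have h2 := listCost_le (w := w) (henc p).2
    have h3 := Nat.mul_le_mul_right (w + 1) (henc p).1
    have h6 := listCost_le (w := w) (l := readMem mem (src.eval mem) (len.eval mem)) (by
      intro x hx
      rw [readMem, List.mem_map] at hx
      obtain ⟨i, -, rfl⟩ := hx
      exact hb _)
    have h7 : (readMem mem (src.eval mem) (len.eval mem)).length = len.eval mem := by
      simp [readMem]
    rw [h7] at h6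
    simp only [add_mul]
    omega

end Halts

end RAM

namespace RAM

/-! ### Registers and loops -/

/-- The names of the arrays in which a program keeps its data; a scalar is an array of which only
the entry `0` is used. -/
inductive Reg where
  | ctr | dim | buf | qry | expo | pw | rem | flag | tries | round | tmp | base | fst | inv | snd
  | prod | res
deriving DecidableEq

/-- The position of an array. -/
def Reg.idx : Reg → ℕ
  | ctr => 0 | dim => 1 | buf => 2 | qry => 3 | expo => 4 | pw => 5 | rem => 6 | flag => 7
  | tries => 8 | round => 9 | tmp => 10 | base => 11 | fst => 12 | inv => 13 | snd => 14
  | prod => 15 | res => 16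

theorem Reg.idx_lt (r : Reg) : r.idx < 32 := by cases r <;> decide

theorem Reg.idx_injective : Function.Injective Reg.idx := by
  intro r s h
  cases r <;> cases s <;> first | rfl | (exact absurd h (by decide))

/-- The entry `k` of the array `r`. The arrays are interleaved above the address that is stored in
the cell `0`, so that each of them has unbounded length. -/
def hi (mem : ℕ → ℕ) (r : Reg) (k : ℕ) : ℕ := mem (mem 0 + 1 + (32 * k + r.idx))

/-- Change of the entry `k` of the array `r`. -/
def setHi (mem : ℕ → ℕ) (r : Reg) (k v : ℕ) : ℕ → ℕ :=
  Function.update mem (mem 0 + 1 + (32 * k + r.idx)) v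

theorem addr_inj {r r' : Reg} {k k' : ℕ} (h : 32 * k + r.idx = 32 * k' + r'.idx) :
    r = r' ∧ k = k' := by
  have h1 := r.idx_lt
  have h2 := r'.idx_lt
  exact ⟨Reg.idx_injective (by omega), by omega⟩

theorem setHi_low (mem : ℕ → ℕ) (r : Reg) (k v : ℕ) {a : ℕ} (ha : a ≤ mem 0) :
    setHi mem r k v a = mem a :=
  Function.update_of_ne (by omega) _ _

@[simp] theorem setHi_zero (mem : ℕ → ℕ) (r : Reg) (k v : ℕ) : setHi mem r k v 0 = mem 0 :=
  setHi_low mem r k v (Nat.zero_le _)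

theorem hi_setHi (mem : ℕ → ℕ) (r : Reg) (k v : ℕ) (r' : Reg) (k' : ℕ) :
    hi (setHi mem r k v) r' k' = if r' = r ∧ k' = k then v else hi mem r' k' := by
  rw [hi, setHi_zero, setHi, Function.update_apply]
  by_cases h : r' = r ∧ k' = k
  · rw [if_pos h, if_pos (by rw [h.1, h.2])]
  · rw [if_neg h, if_neg]
    · rfl
    · intro h1
      exact h (addr_inj (by omega))

@[simp] theorem hi_setHi_self (mem : ℕ → ℕ) (r : Reg) (k v : ℕ) :
    hi (setHi mem r k v) r k = v := by simp [hi_setHi]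

theorem hi_setHi_of_ne (mem : ℕ → ℕ) {r r' : Reg} (k v : ℕ) (k' : ℕ) (h : r' ≠ r) :
    hi (setHi mem r k v) r' k' = hi mem r' k' := by simp [hi_setHi, h]

theorem Bdd.setHi {w : ℕ} {mem : ℕ → ℕ} (h : Bdd w mem) (r : Reg) (k : ℕ) {v : ℕ}
    (hv : v < 2 ^ w) : Bdd w (setHi mem r k v) := h.update _ hv

theorem Bdd.hi {w : ℕ} {mem : ℕ → ℕ} (h : Bdd w mem) (r : Reg) (k : ℕ) : hi mem r k < 2 ^ w := h _

/-- The address of the entry `e` of the array `r`. -/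
def addr (r : Reg) (e : Expr) : Expr :=
  .add (.add (.load (.const 0)) (.const 1)) (.add (.mul (.const 32) e) (.const r.idx))

/-- The entry `e` of the array `r`. -/
def get (r : Reg) (e : Expr) : Expr := .load (addr r e)

/-- The scalar `r`. -/
def val (r : Reg) : Expr := get r (.const 0)

/-- Assignment to the entry `i` of the array `r`. -/
def put (r : Reg) (i e : Expr) : Cmd := .assign (addr r i) e

/-- Assignment to the scalar `r`. -/
def set (r : Reg) (e : Expr) : Cmd := put r (.const 0) e

@[simp] theorem eval_addr (mem : ℕ → ℕ) (r : Reg) (e : Expr) :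
    (addr r e).eval mem = mem 0 + 1 + (32 * e.eval mem + r.idx) := rfl

@[simp] theorem eval_get (mem : ℕ → ℕ) (r : Reg) (e : Expr) :
    (get r e).eval mem = hi mem r (e.eval mem) := rfl

@[simp] theorem eval_val (mem : ℕ → ℕ) (r : Reg) : (val r).eval mem = hi mem r 0 := rfl

/-- The weight of a command without loops and branches. -/
def Cmd.wt : Cmd → ℕ
  | .assign dst e => dst.wt + e.wt
  | .seq c₁ c₂ => 1 + c₁.wt + c₂.wt
  | _ => 0

theorem exec_put {w : ℕ} {mem : ℕ → ℕ} (h : Bdd w mem) (r : Reg) (i e : Expr) :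
    Exec w (put r i e) mem (setHi mem r (i.eval mem) (e.eval mem)) (put r i e).wt :=
  exec_assign h _ _

theorem exec_set {w : ℕ} {mem : ℕ → ℕ} (h : Bdd w mem) (r : Reg) (e : Expr) :
    Exec w (set r e) mem (setHi mem r 0 (e.eval mem)) (set r e).wt :=
  exec_assign h _ _

/-- The memory `mem'` differs from `mem` at most in the cells `W` below the arrays, and in the
arrays `F`. -/
structure Frame (W : Set ℕ) (F : List Reg) (mem mem' : ℕ → ℕ) : Prop where
  zero : mem' 0 = mem 0
  low : ∀ a ≤ mem 0, a ∉ W → mem' a = mem a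
  hi : ∀ r ∉ F, ∀ k, hi mem' r k = hi mem r k

namespace Frame

variable {W W' : Set ℕ} {F F' : List Reg} {m₀ m₁ m₂ : ℕ → ℕ}

theorem refl (W : Set ℕ) (F : List Reg) (mem : ℕ → ℕ) : Frame W F mem mem :=
  ⟨rfl, fun _ _ _ => rfl, fun _ _ _ => rfl⟩

theorem mono (h : Frame W F m₀ m₁) (hW : W ⊆ W') (hF : F ⊆ F') : Frame W' F' m₀ m₁ :=
  ⟨h.zero, fun a ha haW => h.low a ha fun h' => haW (hW h'),
    fun r hr => h.hi r fun h' => hr (hF h')⟩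

theorem trans (h : Frame W F m₀ m₁) (h' : Frame W F m₁ m₂) : Frame W F m₀ m₂ :=
  ⟨h'.zero.trans h.zero, fun a ha haW => (h'.low a (h.zero.symm ▸ ha) haW).trans (h.low a ha haW),
    fun r hr k => (h'.hi r hr k).trans (h.hi r hr k)⟩

theorem setHi (h : Frame W F m₀ m₁) {r : Reg} (hr : r ∈ F) (k v : ℕ) :
    Frame W F m₀ (setHi m₁ r k v) :=
  h.trans ⟨setHi_zero _ _ _ _, fun _ ha _ => setHi_low _ _ _ _ ha,
    fun _ hr' _ => hi_setHi_of_ne _ _ _ _ fun h' => hr' (h' ▸ hr)⟩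

end Frame

theorem Frame.of_setHi (W : Set ℕ) {F : List Reg} (mem : ℕ → ℕ) {r : Reg} (hr : r ∈ F) (k v : ℕ) :
    Frame W F mem (RAM.setHi mem r k v) := (Frame.refl W F mem).setHi hr k v

theorem Frame.of_writeMem {W : Set ℕ} (F : List Reg) (mem : ℕ → ℕ) {a : ℕ} {l : List ℕ}
    (h0 : 0 < a) (ha : a + l.length ≤ mem 0 + 1) (hW : ∀ i, a ≤ i → i < a + l.length → i ∈ W) :
    Frame W F mem (writeMem mem a l) := by
  have hz : writeMem mem a l 0 = mem 0 := by
    rw [writeMem, if_neg (by omega)]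
  refine ⟨hz, fun b hb hbW => ?_, fun r _ k => ?_⟩
  · rw [writeMem, if_neg]
    rintro ⟨h1, h2⟩
    exact hbW (hW b h1 h2)
  · rw [RAM.hi, hz, writeMem, if_neg (by omega)]
    rfl

/-- `for r = 0, …, cnt - 1 do body`. -/
def forLoop (r : Reg) (cnt : Expr) (body : Cmd) : Cmd :=
  .seq (set r (.const 0))
    (.loop (.sub cnt (val r)) (.seq body (set r (.add (val r) (.const 1)))))

/-- The overhead of one round of a loop. -/
def forWt (r : Reg) (cnt : Expr) : ℕ :=
  2 + (set r (.const 0)).wt + (set r (.add (val r) (.const 1))).wt + (Expr.sub cnt (val r)).wt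

/-- The rule for counting loops: `Inv i` holds when the counter `r` has been set to `i`. -/
theorem exec_for {w : ℕ} (r : Reg) (cnt : Expr) (body : Cmd) (m s : ℕ) (hm : m < 2 ^ w)
    (Inv : ℕ → (ℕ → ℕ) → Prop) {mem : ℕ → ℕ} (hb : Bdd w mem) (h0 : Inv 0 (setHi mem r 0 0))
    (hcnt : ∀ i mem, Inv i mem → cnt.eval mem = m)
    (hbody : ∀ i < m, ∀ mem, Bdd w mem → hi mem r 0 = i → Inv i mem →
      ∃ mem', Exec w body mem mem' s ∧ Bdd w mem' ∧ hi mem' r 0 = i ∧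
        Inv (i + 1) (setHi mem' r 0 (i + 1))) :
    ∃ mem', Exec w (forLoop r cnt body) mem mem' ((m + 1) * (s + forWt r cnt)) ∧ Bdd w mem' ∧
      hi mem' r 0 = m ∧ Inv m mem' := by
  have key : ∀ j ≤ m, ∀ mem, Bdd w mem → hi mem r 0 = m - j → Inv (m - j) mem →
      ∃ mem', Exec w (.loop (.sub cnt (val r)) (.seq body (set r (.add (val r) (.const 1)))))
        mem mem' (j * (s + forWt r cnt) + (Expr.sub cnt (val r)).wt) ∧ Bdd w mem' ∧
        hi mem' r 0 = m ∧ Inv m mem' := by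
    intro j
    induction j with
    | zero =>
      intro _ mem hb hr hI
      refine ⟨mem, (exec_loop_stop hb _ ?_).mono (by omega), hb, by simpa using hr,
        by simpa using hI⟩
      simp [Expr.eval, hcnt _ _ hI, hr]
    | succ j ih =>
      intro hj mem hb hr hI
      obtain ⟨m₁, e₁, hb₁, hr₁, hI₁⟩ := hbody (m - (j + 1)) (by omega) mem hb hr hI
      have hsub : m - (j + 1) + 1 = m - j := by omega
      have hb₂ : Bdd w (setHi m₁ r 0 (m - j)) := hb₁.setHi r 0 (by omega)
      rw [hsub] at hI₁
      obtain ⟨m₂, e₂, hb₂', hr₂, hI₂⟩ := ih (by omega) _ hb₂ (hi_setHi_self _ _ _ _) hI₁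
      refine ⟨m₂, ?_, hb₂', hr₂, hI₂⟩
      have e₃ := exec_set hb₁ r (.add (val r) (.const 1))
      have hev : (Expr.add (val r) (.const 1)).eval m₁ = m - j := by
        simp [Expr.eval, hr₁, hsub]
      rw [hev] at e₃
      refine (exec_loop_step hb ?_ (e₁.seq e₃) e₂).mono ?_
      · simp only [Expr.eval, eval_val, hcnt _ _ hI, hr]
        omega
      · rw [add_mul]
        simp only [forWt]
        omega
  obtain ⟨m₁, e₁, h₁⟩ := key m le_rfl (setHi mem r 0 0) (hb.setHi r 0 (by positivity))
    (by simp) (by simpa using h0)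
  refine ⟨m₁, ((exec_set hb r (.const 0)).seq e₁).mono ?_, h₁⟩
  rw [add_mul]
  simp only [forWt]
  omega

/-- A loop whose rounds store the values `f i` at distinct addresses `adr i`. -/
theorem exec_storeLoop {w : ℕ} (r : Reg) (cnt dst e : Expr) (m : ℕ) (hm : m < 2 ^ w)
    {mem : ℕ → ℕ} (hb : Bdd w mem) (adr f : ℕ → ℕ)
    (hadr : ∀ i < m, ∀ j < m, adr i = adr j → i = j)
    (hadr0 : ∀ i < m, adr i ≠ 0) (hadrr : ∀ i < m, adr i ≠ mem 0 + 1 + (32 * 0 + r.idx))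
    (hf : ∀ i < m, f i < 2 ^ w)
    (hcnt : ∀ mem', mem' 0 = mem 0 → (∀ a, a ≠ mem 0 + 1 + (32 * 0 + r.idx) →
      (∀ i < m, a ≠ adr i) → mem' a = mem a) → cnt.eval mem' = m)
    (hstep : ∀ i < m, ∀ mem', mem' 0 = mem 0 → hi mem' r 0 = i →
      (∀ a, a ≠ mem 0 + 1 + (32 * 0 + r.idx) → (∀ j < i, a ≠ adr j) → mem' a = mem a) →
      dst.eval mem' = adr i ∧ e.eval mem' = f i) :
    ∃ mem', Exec w (forLoop r cnt (.assign dst e)) mem mem'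
        ((m + 1) * ((Cmd.assign dst e).wt + forWt r cnt)) ∧ Bdd w mem' ∧
      mem' 0 = mem 0 ∧ (∀ i < m, mem' (adr i) = f i) ∧
      ∀ a, a ≠ mem 0 + 1 + (32 * 0 + r.idx) → (∀ i < m, a ≠ adr i) → mem' a = mem a := by
  obtain ⟨mem', h1, h2, -, h3, h4, h5⟩ := exec_for (w := w) r cnt (.assign dst e) m
    (Cmd.assign dst e).wt hm
    (fun i mem' => mem' 0 = mem 0 ∧ (∀ j < i, j < m → mem' (adr j) = f j) ∧
      ∀ a, a ≠ mem 0 + 1 + (32 * 0 + r.idx) → (∀ j < i, j < m → a ≠ adr j) → mem' a = mem a)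
    hb (by
      exact ⟨setHi_zero _ _ _ _, fun j hj => absurd hj (Nat.not_lt_zero j),
          fun a ha _ => Function.update_of_ne ha _ _⟩)
    (by
      rintro i mem' ⟨h1, -, h3⟩
      exact hcnt mem' h1 fun a ha ha' => h3 a ha fun j _ hj => ha' j hj)
    (by
      rintro i him m₁ hb₁ hr ⟨h1, h2, h3⟩
      obtain ⟨hd, he⟩ := hstep i him m₁ h1 hr fun a ha ha' => h3 a ha fun j hj _ => ha' j hj
      have e₁ := exec_assign hb₁ dst e
      rw [hd, he] at e₁
      have hz : Function.update m₁ (adr i) (f i) 0 = mem 0 := by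
        rw [Function.update_of_ne (hadr0 i him).symm, h1]
      refine ⟨_, e₁, hb₁.update _ (hf i him), ?_, ?_, ?_, ?_⟩
      · rw [hi, hz, Function.update_of_ne (hadrr i him).symm, ← h1]
        exact hr
      · rw [setHi_zero, hz]
      · intro j hj hjm
        rw [setHi, hz, Function.update_of_ne (hadrr j hjm)]
        by_cases hji : j = i
        · subst hji
          rw [Function.update_self]
        · rw [Function.update_of_ne fun h => hji (hadr j hjm i him h), h2 j (by omega) hjm]
      · intro a ha ha'
        rw [setHi, hz, Function.update_of_ne ha,
          Function.update_of_ne (ha' i (Nat.lt_succ_self i) him), h3 a ha]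
        exact fun j hj hjm => ha' j (by omega) hjm)
  exact ⟨mem', h1, h2, h3, fun i hi => h4 i hi hi, fun a ha ha' => h5 a ha fun j hj _ => ha' j hj⟩

/-- `for t = 0, …, N - 1 do dst[t] ← e`. -/
def vecLoop (dst : Reg) (e : Expr) : Cmd := forLoop .ctr (val .dim) (put dst (val .ctr) e)

/-- Bound for the time of a round of `vecLoop`. -/
def vecWt (dst : Reg) (e : Expr) : ℕ := (put dst (val .ctr) e).wt + forWt .ctr (val .dim)

/-- The expression `e` may refer to the array `dst` itself, at entries that are not yet
overwritten. -/
theorem exec_vecLoop {w N : ℕ} {mem : ℕ → ℕ} (hb : Bdd w mem) (hN : hi mem .dim 0 = N) (dst : Reg)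
    (hdt : dst ≠ .ctr) (hdn : dst ≠ .dim) (e : Expr) (f : ℕ → ℕ) (hf : ∀ k < N, f k < 2 ^ w)
    (he : ∀ k < N, ∀ mem', Frame ∅ [.ctr, dst] mem mem' → hi mem' .ctr 0 = k →
      (∀ i, k ≤ i → hi mem' dst i = hi mem dst i) → e.eval mem' = f k) :
    ∃ mem', Exec w (vecLoop dst e) mem mem' ((N + 1) * vecWt dst e) ∧ Bdd w mem' ∧
      Frame ∅ [.ctr, dst] mem mem' ∧ ∀ k < N, hi mem' dst k = f k := by
  have hframe : ∀ mem' m, mem' 0 = mem 0 → (∀ a, a ≠ mem 0 + 1 + (32 * 0 + Reg.ctr.idx) →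
      (∀ i < m, a ≠ mem 0 + 1 + (32 * i + dst.idx)) → mem' a = mem a) →
      Frame ∅ [.ctr, dst] mem mem' := by
    intro mem' m h0 h
    refine ⟨h0, fun a ha _ => h a (by omega) fun i _ => by omega, fun r hr k => ?_⟩
    rw [hi, h0]
    simp only [List.mem_cons, List.not_mem_nil, or_false, not_or] at hr
    refine h _ (fun h' => hr.1 (addr_inj (k := k) (k' := 0) (by omega)).1)
      fun i _ h' => hr.2 (addr_inj (k := k) (k' := i) (by omega)).1
  obtain ⟨mem', h1, h2, h3, h4, h5⟩ := exec_storeLoop (w := w) .ctr (val .dim)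
    (addr dst (val .ctr)) e N
    (hN ▸ hb.hi _ _) hb (fun i => mem 0 + 1 + (32 * i + dst.idx)) f
    (fun i _ j _ h => by omega) (fun i _ => by omega)
    (fun i _ h' => hdt (addr_inj (by omega : 32 * i + dst.idx = 32 * 0 + Reg.ctr.idx)).1) hf
    (fun mem' h0 h => by
      rw [eval_val, (hframe mem' N h0 h).hi .dim (by simp [hdn.symm])]
      exact hN)
    (fun i hi' mem' h0 ht h => by
      refine ⟨?_, he i hi' mem' (hframe mem' i h0 h) ht fun j hj => ?_⟩
      · rw [eval_addr, eval_val, ht, h0]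
      · rw [hi, h0]
        exact h _ (fun h' => hdt (addr_inj (by omega : 32 * j + dst.idx = 32 * 0 + Reg.ctr.idx)).1)
          fun l hl => by omega)
  refine ⟨mem', h1, h2, hframe mem' N h3 h5, fun k hk => ?_⟩
  rw [hi, h3]
  exact h4 k hk

/-- `for t = 0, …, cnt - 1 do mem[base + t] ← e`. -/
def lowLoop (base cnt e : Expr) : Cmd := forLoop .ctr cnt (.assign (.add base (val .ctr)) e)

/-- Bound for the time of a round of `lowLoop`. -/
def lowWt (base cnt e : Expr) : ℕ := (Cmd.assign (.add base (val .ctr)) e).wt + forWt .ctr cnt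

theorem exec_lowLoop {w m A : ℕ} {mem : ℕ → ℕ} (hb : Bdd w mem) (hm : m < 2 ^ w)
    (base cnt e : Expr) (hA : 0 < A) (hA' : A + m ≤ mem 0 + 1) (f : ℕ → ℕ)
    (hf : ∀ k < m, f k < 2 ^ w)
    (hcnt : ∀ mem', Frame (Set.Ico A (A + m)) [.ctr] mem mem' → cnt.eval mem' = m)
    (he : ∀ k < m, ∀ mem', Frame (Set.Ico A (A + m)) [.ctr] mem mem' → hi mem' .ctr 0 = k →
      base.eval mem' = A ∧ e.eval mem' = f k) :
    ∃ mem', Exec w (lowLoop base cnt e) mem mem' ((m + 1) * lowWt base cnt e) ∧ Bdd w mem' ∧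
      Frame (Set.Ico A (A + m)) [.ctr] mem mem' ∧ ∀ k < m, mem' (A + k) = f k := by
  have hframe : ∀ mem' l, l ≤ m → mem' 0 = mem 0 → (∀ a, a ≠ mem 0 + 1 + (32 * 0 + Reg.ctr.idx) →
      (∀ i < l, a ≠ A + i) → mem' a = mem a) → Frame (Set.Ico A (A + m)) [.ctr] mem mem' := by
    intro mem' l hl h0 h
    refine ⟨h0, fun a ha haW => h a (by omega) fun i _ h' => haW ⟨by omega, by omega⟩,
      fun r hr k => ?_⟩
    rw [hi, h0]
    simp only [List.mem_cons, List.not_mem_nil, or_false] at hr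
    exact h _ (fun h' => hr (addr_inj (k := k) (k' := 0) (by omega)).1) fun i _ => by omega
  obtain ⟨mem', h1, h2, h3, h4, h5⟩ := exec_storeLoop (w := w) .ctr cnt (.add base (val .ctr)) e m
    hm hb (fun i => A + i) f
    (fun i _ j _ h => by omega) (fun i _ => by omega) (fun i _ => by omega) hf
    (fun mem' h0 h => hcnt mem' (hframe mem' m le_rfl h0 h))
    (fun i hi' mem' h0 ht h => by
      obtain ⟨hb1, hb2⟩ := he i hi' mem' (hframe mem' i hi'.le h0 h) ht
      exact ⟨by simp [Expr.eval, hb1, ht], hb2⟩)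
  exact ⟨mem', h1, h2, hframe mem' m le_rfl h3 h5, h4⟩

end RAM

namespace RAM

/-! ### The memory of the reduction -/

/-- The first cell above the input. -/
def lowEnd (N : ℕ) : ℕ := 5 + N + N * N * N

/-- The last cell below the arrays: the input is followed by a buffer for the replies of the oracles
and by the query to the solver. -/
def memEnd (N m : ℕ) : ℕ := lowEnd N + 2 * N + 2 * N * m

/-- A bound for the bit length of all numbers that occur. -/
def width (q N κ m : ℕ) : ℕ := memEnd N m + κ + q.size * (N ^ 2 + 1)

section Memory

variable {S : Type*} [Ring S] {N : ℕ} (B : Module.Basis (Fin N) ℤ S) (q κ m : ℕ)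

/-- The part of the input that follows the cell `0` is stored in its place. -/
structure HasInput (mem : ℕ → ℕ) : Prop where
  q_eq : mem 2 = q
  κ_eq : mem 3 = κ
  m_eq : mem 4 = m
  one_eq : ∀ i : Fin N, mem (5 + i) = (crd B (1 : ModQ S q) i).val
  struct_eq : ∀ i j k : Fin N, mem (5 + N + ((i * N + j) * N + k)) =
    (crd B (Ideal.Quotient.mk (Ideal.span {(q : S)}) (B i * B j)) k).val

/-- The constants on which the program relies are stored in their places. -/
structure Good (mem : ℕ → ℕ) : Prop extends HasInput B q κ m mem where
  zero : mem 0 = memEnd N m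
  dim : hi mem .dim 0 = N
  buf : hi mem .buf 0 = lowEnd N
  qry : hi mem .qry 0 = lowEnd N + 2 * N
  expo : hi mem .expo 0 = glCard q N - 1

/-- The array `r` holds the coordinates of `x`. -/
def Vec {q : ℕ} (mem : ℕ → ℕ) (r : Reg) (x : ModQ S q) : Prop :=
  ∀ i : Fin N, hi mem r i = (crd B x i).val

variable {B q κ m}

theorem Vec.frame {W : Set ℕ} {F : List Reg} {mem mem' : ℕ → ℕ} {r : Reg} {x : ModQ S q}
    (h : Vec B mem r x) (hF : Frame W F mem mem') (hr : r ∉ F) : Vec B mem' r x := fun i => by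
  rw [hF.hi r hr, h i]

theorem Fin.struct_lt {N : ℕ} (i j k : Fin N) : (i * N + j) * N + k < N * N * N := by
  have h1 : (i : ℕ) * N + j < N * N := by
    have h2 : ((i : ℕ) + 1) * N ≤ N * N := Nat.mul_le_mul_right _ i.2
    rw [Nat.succ_mul] at h2
    omega
  have h3 : ((i : ℕ) * N + j + 1) * N ≤ N * N * N := Nat.mul_le_mul_right _ h1
  rw [Nat.succ_mul] at h3
  omega

theorem HasInput.of_eq {mem mem' : ℕ → ℕ} (h : HasInput B q κ m mem)
    (he : ∀ a, 0 < a → a < lowEnd N → mem' a = mem a) : HasInput B q κ m mem' where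
  q_eq := (he 2 (by omega) (by unfold lowEnd; omega)).trans h.q_eq
  κ_eq := (he 3 (by omega) (by unfold lowEnd; omega)).trans h.κ_eq
  m_eq := (he 4 (by omega) (by unfold lowEnd; omega)).trans h.m_eq
  one_eq i := (he _ (by omega) (by have := i.2; unfold lowEnd; omega)).trans (h.one_eq i)
  struct_eq i j k := (he _ (by omega) (by
    have := Fin.struct_lt i j k
    unfold lowEnd
    omega)).trans (h.struct_eq i j k)

theorem lowEnd_le_memEnd (N m : ℕ) : lowEnd N ≤ memEnd N m := by
  unfold memEnd
  omega

theorem Good.frame {W : Set ℕ} {F : List Reg} {mem mem' : ℕ → ℕ} (h : Good B q κ m mem)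
    (hF : Frame W F mem mem') (hW : ∀ a ∈ W, lowEnd N ≤ a)
    (hr : Reg.dim ∉ F ∧ Reg.buf ∉ F ∧ Reg.qry ∉ F ∧ Reg.expo ∉ F) : Good B q κ m mem' where
  toHasInput := h.toHasInput.of_eq fun a _ ha => hF.low a
    (by have := lowEnd_le_memEnd N m; have := h.zero; omega)
    fun haW => absurd (hW a haW) (not_le.2 ha)
  zero := hF.zero.trans h.zero
  dim := (hF.hi _ hr.1 0).trans h.dim
  buf := (hF.hi _ hr.2.1 0).trans h.buf
  qry := (hF.hi _ hr.2.2.1 0).trans h.qry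
  expo := (hF.hi _ hr.2.2.2 0).trans h.expo

theorem lt_two_pow_of_le_memEnd {w v : ℕ} (hw : width q N κ m ≤ w) (hv : v ≤ memEnd N m) :
    v < 2 ^ w :=
  (lt_of_le_of_lt (hv.trans ((by unfold width; omega : memEnd N m ≤ width q N κ m).trans hw))
    Nat.lt_two_pow_self)

theorem q_le_two_pow {w : ℕ} (hw : width q N κ m ≤ w) : q ≤ 2 ^ w := by
  refine (Nat.lt_size_self q).le.trans (Nat.pow_le_pow_right two_pos (le_trans ?_ hw))
  unfold width
  nlinarith [Nat.zero_le (q.size * N ^ 2)]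

theorem lt_two_pow_of_lt_q {w v : ℕ} (hw : width q N κ m ≤ w) (hv : v < q) : v < 2 ^ w :=
  hv.trans_le (q_le_two_pow hw)

end Memory

/-! ### Multiplication -/

theorem mul_add_mod_of_lt {N k : ℕ} (hk : k < N) (r : ℕ) : (r * N + k) % N = k := by
  rw [Nat.mul_add_mod', Nat.mod_eq_of_lt hk]

theorem sum_range_mul_ite {R : Type*} [AddCommMonoid R] (F : ℕ → R) (M : ℕ) {N k : ℕ}
    (hk : k < N) : ∑ s ∈ Finset.range (M * N), (if s % N = k then F s else 0) =
      ∑ r ∈ Finset.range M, F (r * N + k) := by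
  induction M with
  | zero => simp
  | succ M ih =>
    rw [Nat.succ_mul, Finset.sum_range_add, ih, Finset.sum_range_succ]
    congr 1
    rw [Finset.sum_eq_single k]
    · rw [if_pos]
      rw [mul_add_mod_of_lt hk]
    · intro x hx hxk
      rw [Finset.mem_range] at hx
      rw [if_neg]
      rwa [mul_add_mod_of_lt hx]
    · intro h
      exact absurd (Finset.mem_range.2 hk) h

theorem sum_range_mul {R : Type*} [AddCommMonoid R] (F : ℕ → R) (M N : ℕ) :
    ∑ s ∈ Finset.range (M * N), F s =
      ∑ i ∈ Finset.range M, ∑ j ∈ Finset.range N, F (i * N + j) := by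
  induction M with
  | zero => simp
  | succ M ih => rw [Nat.succ_mul, Finset.sum_range_add, ih, Finset.sum_range_succ]

/-- The product of the entries of `x` and `y` and of the structure constant to which the counter
points, added to the entry of `tmp` for which it counts. -/
def mulExpr (x y : Reg) : Expr :=
  .mod (.add (get .tmp (.mod (val .ctr) (val .dim)))
    (.mul (.mul (get x (.div (val .ctr) (.mul (val .dim) (val .dim))))
      (get y (.mod (.div (val .ctr) (val .dim)) (val .dim))))
      (.load (.add (.add (.const 5) (val .dim)) (val .ctr))))) (.load (.const 2))

/-- `dst ← x * y`, by a single loop over the structure constants. -/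
def mulCmd (dst x y : Reg) : Cmd :=
  .seq (vecLoop .tmp (.const 0))
    (.seq (forLoop .ctr (.mul (.mul (val .dim) (val .dim)) (val .dim))
        (put .tmp (.mod (val .ctr) (val .dim)) (mulExpr x y)))
      (vecLoop dst (get .tmp (val .ctr))))

/-- Bound for the time of `mulCmd`, in units of length `w + 1`. -/
def mulWt (N : ℕ) (dst x y : Reg) : ℕ :=
  2 + (N + 1) * vecWt .tmp (.const 0) +
    (N * N * N + 1) * ((put .tmp (.mod (val .ctr) (val .dim)) (mulExpr x y)).wt +
      forWt .ctr (.mul (.mul (val .dim) (val .dim)) (val .dim))) +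
    (N + 1) * vecWt dst (get .tmp (val .ctr))

section Programs

variable {S : Type*} [Ring S] {N : ℕ} {B : Module.Basis (Fin N) ℤ S} {q κ m w : ℕ}
  [hq : Fact q.Prime]

theorem exec_mul (hw : width q N κ m ≤ w) {mem : ℕ → ℕ} (hb : Bdd w mem) (hg : Good B q κ m mem)
    {dst x y : Reg} {a b : ModQ S q} (ha : Vec B mem x a) (hb' : Vec B mem y b)
    (hx : x ∉ [Reg.ctr, .tmp]) (hy : y ∉ [Reg.ctr, .tmp])
    (hdst : dst ∉ [Reg.ctr, .tmp, .dim, .buf, .qry, .expo]) :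
    ∃ mem', Exec w (mulCmd dst x y) mem mem' (mulWt N dst x y) ∧ Bdd w mem' ∧
      Frame ∅ [.ctr, .tmp, dst] mem mem' ∧ Vec B mem' dst (a * b) := by
  simp only [List.mem_cons, List.not_mem_nil, or_false, not_or] at hx hy hdst
  have hNm : N * N * N ≤ memEnd N m := by unfold memEnd lowEnd; omega
  obtain ⟨m₁, e₁, b₁, f₁, v₁⟩ := exec_vecLoop hb hg.dim .tmp (by decide) (by decide) (.const 0)
    (fun _ => 0) (fun _ _ => by positivity) (fun _ _ _ _ _ _ => rfl)
  have g₁ : Good B q κ m m₁ := hg.frame f₁ (by simp) (by decide)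
  have hX : ∀ r : Reg, r ≠ .ctr → r ≠ .tmp → ∀ k, hi m₁ r k = hi mem r k := fun r h1 h2 k =>
    f₁.hi r (by simp [h1, h2]) k
  let F : ℕ → ZMod q := fun s =>
    ((hi m₁ x (s / (N * N)) : ℕ) : ZMod q) * (hi m₁ y (s / N % N) : ℕ) * (m₁ (5 + N + s) : ℕ)
  obtain ⟨m₂, e₂, b₂, -, f₂, i₂⟩ := exec_for (w := w) .ctr
    (.mul (.mul (val .dim) (val .dim)) (val .dim))
    (put .tmp (.mod (val .ctr) (val .dim)) (mulExpr x y)) (N * N * N) _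
    (lt_two_pow_of_le_memEnd hw hNm)
    (fun i mem' => Frame ∅ [.ctr, .tmp] m₁ mem' ∧ ∀ k < N, hi mem' .tmp k < q ∧
      ((hi mem' .tmp k : ℕ) : ZMod q) = ∑ s ∈ Finset.range i, if s % N = k then F s else 0)
    b₁ (by
      refine ⟨Frame.of_setHi _ _ (by decide) _ _, fun k hk => ?_⟩
      rw [hi_setHi_of_ne _ _ _ _ (by decide), v₁ k hk]
      simp [hq.out.pos])
    (by
      rintro i mem' ⟨hF, -⟩
      simp [Expr.eval, hF.hi .dim (by decide), g₁.dim])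
    (by
      rintro i hi' mem' bm hc ⟨hF, hI⟩
      have gm : Good B q κ m mem' := g₁.frame hF (by simp) (by decide)
      have hN0 : 0 < N := by
        rcases Nat.eq_zero_or_pos N with h | h
        · subst h; simp at hi'
        · exact h
      have hlow : mem' (5 + N + i) = m₁ (5 + N + i) := hF.low _ (by
        rw [g₁.zero]
        unfold memEnd lowEnd
        omega) (by simp)
      set v := (hi mem' .tmp (i % N) + hi m₁ x (i / (N * N)) * hi m₁ y (i / N % N) *
        m₁ (5 + N + i)) % q with hv
      have hvq : v < q := Nat.mod_lt _ hq.out.pos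
      have hvw : v < 2 ^ w := lt_two_pow_of_lt_q hw hvq
      have ev : (mulExpr x y).eval mem' = v := by
        have h1 := hF.hi x (by simp [hx]) (i / (N * N))
        have h2 := hF.hi y (by simp [hy]) (i / N % N)
        simp only [mulExpr, Expr.eval, eval_get, eval_val, gm.dim, hc, gm.q_eq, h1, h2, hlow]
        rfl
      have e := exec_put bm .tmp (.mod (val .ctr) (val .dim)) (mulExpr x y)
      rw [ev] at e
      simp only [Expr.eval, eval_val, gm.dim, hc] at e
      refine ⟨_, e, bm.setHi _ _ hvw, ?_, ?_, ?_⟩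
      · rw [hi_setHi_of_ne _ _ _ _ (by decide), hc]
      · exact (hF.setHi (by decide) _ _).setHi (by decide) _ _
      · intro k hk
        rw [hi_setHi_of_ne _ _ _ _ (by decide), hi_setHi, Finset.sum_range_succ]
        by_cases hki : k = i % N
        · rw [if_pos ⟨rfl, hki⟩, if_pos hki.symm]
          refine ⟨hvq, ?_⟩
          rw [← (hI k hk).2, hv, ZMod.natCast_mod, hki]
          push_cast
          rfl
        · rw [if_neg fun h => hki h.2, if_neg fun h => hki h.symm, add_zero]
          exact hI k hk)
  have g₂ : Good B q κ m m₂ := g₁.frame f₂ (by simp) (by decide)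
  obtain ⟨m₃, e₃, b₃, f₃, v₃⟩ := exec_vecLoop b₂ g₂.dim dst hdst.1 hdst.2.2.1
    (get .tmp (val .ctr)) (fun k => hi m₂ .tmp k) (fun k _ => b₂.hi _ _) (fun k _ mem' hF hc _ => by
      simp only [eval_get, eval_val, hc]
      exact hF.hi .tmp (by simp [Ne.symm hdst.2.1]) k)
  refine ⟨m₃, (e₁.seq (e₂.seq e₃)).mono (by unfold mulWt; omega), b₃, ?_, ?_⟩
  · refine (f₁.mono subset_rfl ?_).trans ((f₂.mono subset_rfl ?_).trans (f₃.mono subset_rfl ?_))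
      <;> intro r hr <;> simp at hr ⊢ <;> tauto
  · intro k
    rw [v₃ k k.2]
    have h1 := (i₂ k k.2).1
    rw [← Nat.mod_eq_of_lt h1, ← ZMod.val_natCast, (i₂ k k.2).2, sum_range_mul_ite F (N * N) k.2,
      sum_range_mul, crd_mul, ← Fin.sum_univ_eq_sum_range
        (fun i => ∑ j ∈ Finset.range N, F ((i * N + j) * N + k))]
    congr 1
    refine Finset.sum_congr rfl fun i _ => ?_
    rw [← Fin.sum_univ_eq_sum_range (fun j => F ((i * N + j) * N + k))]
    refine Finset.sum_congr rfl fun j _ => ?_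
    have hN0 : 0 < N := i.pos
    have d1 : ((i * N + j) * N + k) / N = (i : ℕ) * N + j := by
      rw [Nat.add_comm, Nat.add_mul_div_right _ _ hN0, Nat.div_eq_of_lt k.2, zero_add]
    have d2 : ((i : ℕ) * N + j) / N = i := by
      rw [Nat.add_comm, Nat.add_mul_div_right _ _ hN0, Nat.div_eq_of_lt j.2, zero_add]
    simp only [F]
    rw [← Nat.div_div_eq_div_mul, d1, d2, mul_add_mod_of_lt j.2, g₁.struct_eq,
      hX x hx.1 hx.2, hX y hy.1 hy.2, ha i, hb' j]
    simp

end Programs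

end RAM

namespace RAM

/-! ### Inversion by exponentiation -/

/-- One round of square-and-multiply. -/
def powBody : Cmd :=
  .seq (.ite (.mod (val .rem) (.const 2)) (mulCmd .inv .inv .base) .skip)
    (.seq (mulCmd .base .base .base) (set .rem (.div (val .rem) (.const 2))))

/-- `inv ← fst ^ expo`, by square-and-multiply. -/
def powCmd : Cmd :=
  .seq (vecLoop .inv (.load (.add (.const 5) (val .ctr))))
    (.seq (vecLoop .base (get .fst (val .ctr)))
      (.seq (set .rem (val .expo)) (.loop (val .rem) powBody)))

/-- `1` if the entries of `res` and of the coordinates of `1` at the counter agree, and `0`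
otherwise: subtraction is truncated. -/
def eqExpr : Expr :=
  .sub (.const 1) (.add (.sub (get .res (val .ctr)) (.load (.add (.const 5) (val .ctr))))
    (.sub (.load (.add (.const 5) (val .ctr))) (get .res (val .ctr))))

/-- `flag ← 1` if `fst * inv = 1`, and `flag ← 0` otherwise. -/
def testCmd : Cmd :=
  .seq (mulCmd .res .fst .inv)
    (.seq (set .flag (.const 1))
      (forLoop .ctr (val .dim) (set .flag (.mul (val .flag) eqExpr))))

/-- Bound for the time of a round of square-and-multiply, in units of length `w + 1`. -/
def powBodyWt (N : ℕ) : ℕ :=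
  2 + (Expr.mod (val .rem) (.const 2)).wt + mulWt N .inv .inv .base + 1 +
    mulWt N .base .base .base + (set .rem (.div (val .rem) (.const 2))).wt + (val .rem).wt

/-- Bound for the time of `powCmd` and `testCmd`; the exponent has at most `w` binary digits. -/
def unitWt (N w : ℕ) : ℕ :=
  6 + (N + 1) * vecWt .inv (.load (.add (.const 5) (val .ctr))) +
    (N + 1) * vecWt .base (get .fst (val .ctr)) + (set .rem (val .expo)).wt +
    (w * powBodyWt N + (val .rem).wt) + mulWt N .res .fst .inv + (set .flag (.const 1)).wt +
    (N + 1) * ((set .flag (.mul (val .flag) eqExpr)).wt + forWt .ctr (val .dim))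

section Programs

variable {S : Type*} [Ring S] {N : ℕ} {B : Module.Basis (Fin N) ℤ S} {q κ m w : ℕ}
  [hq : Fact q.Prime]

/-- Square-and-multiply for an exponent `E` of at most `L` binary digits. -/
theorem exec_powLoop (hw : width q N κ m ≤ w) (L : ℕ) : ∀ (E : ℕ) (mem : ℕ → ℕ)
    (a b : ModQ S q), E < 2 ^ L → Bdd w mem → Good B q κ m mem → hi mem .rem 0 = E →
    Vec B mem .base a → Vec B mem .inv b →
    ∃ mem', Exec w (.loop (val .rem) powBody) mem mem' (L * powBodyWt N + (val .rem).wt) ∧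
      Bdd w mem' ∧ Frame ∅ [.ctr, .tmp, .base, .inv, .rem] mem mem' ∧
      Vec B mem' .inv (b * a ^ E) := by
  induction L with
  | zero =>
    intro E mem a b hE hb hg hr ha hinv
    have hE0 : E = 0 := by simpa using hE
    subst hE0
    exact ⟨mem, (exec_loop_stop hb _ (by simpa using hr)).mono (by omega), hb, Frame.refl _ _ _,
      by simpa using hinv⟩
  | succ L ih =>
    intro E mem a b hE hb hg hr ha hinv
    by_cases hE0 : E = 0
    · subst hE0
      exact ⟨mem, (exec_loop_stop hb _ (by simpa using hr)).mono (by omega), hb, Frame.refl _ _ _,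
        by simpa using hinv⟩
    have h1 : ∃ m₁, Exec w (.ite (.mod (val .rem) (.const 2)) (mulCmd .inv .inv .base) .skip) mem m₁
        ((Expr.mod (val .rem) (.const 2)).wt + (mulWt N .inv .inv .base + 1)) ∧ Bdd w m₁ ∧
        Frame ∅ [.ctr, .tmp, .inv] mem m₁ ∧ Vec B m₁ .inv (b * a ^ (E % 2)) := by
      have hev : (Expr.mod (val .rem) (.const 2)).eval mem = E % 2 := by simp [Expr.eval, hr]
      rcases Nat.mod_two_eq_zero_or_one E with h2 | h2
      · refine ⟨mem, exec_ite hb _ ?_, hb, Frame.refl _ _ _, by simpa [h2] using hinv⟩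
        rw [hev, h2]
        exact (exec_skip w mem).mono (by omega)
      · obtain ⟨m₁, e₁, b₁, f₁, v₁⟩ := exec_mul hw hb hg (dst := .inv) hinv ha (by decide)
          (by decide) (by decide)
        refine ⟨m₁, exec_ite hb _ ?_, b₁, f₁, by simpa [h2] using v₁⟩
        rw [hev, h2]
        exact e₁.mono (by omega)
    obtain ⟨m₁, e₁, b₁, f₁, v₁⟩ := h1
    have g₁ := hg.frame f₁ (by simp) (by decide)
    have ha₁ := ha.frame f₁ (by decide)
    obtain ⟨m₂, e₂, b₂, f₂, v₂⟩ := exec_mul hw b₁ g₁ (dst := .base) ha₁ ha₁ (by decide)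
      (by decide) (by decide)
    have hr₂ : hi m₂ .rem 0 = E := by rw [f₂.hi _ (by decide), f₁.hi _ (by decide), hr]
    have e₃ := exec_set b₂ .rem (.div (val .rem) (.const 2))
    have hev : (Expr.div (val .rem) (.const 2)).eval m₂ = E / 2 := by simp [Expr.eval, hr₂]
    rw [hev] at e₃
    have f₃ : Frame ∅ [.ctr, .tmp, .base, .inv, .rem] mem (setHi m₂ .rem 0 (E / 2)) :=
      ((f₁.mono subset_rfl (by decide)).trans (f₂.mono subset_rfl (by decide))).setHi
        (by decide) _ _
    have f₃' : Frame ∅ [.rem] m₂ (setHi m₂ .rem 0 (E / 2)) := Frame.of_setHi _ _ (by decide) _ _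
    have hEw : E / 2 < 2 ^ w := (Nat.div_le_self E 2).trans_lt (hr₂ ▸ b₂.hi _ _)
    obtain ⟨m₄, e₄, b₄, f₄, v₄⟩ := ih (E / 2) (setHi m₂ .rem 0 (E / 2)) (a * a) (b * a ^ (E % 2))
      (by rw [pow_succ] at hE; omega) (b₂.setHi _ _ hEw)
      (hg.frame f₃ (by simp) (by decide)) (hi_setHi_self _ _ _ _)
      (v₂.frame f₃' (by decide)) ((v₁.frame f₂ (by decide)).frame f₃' (by decide))
    refine ⟨m₄, (exec_loop_step hb (by simpa [hr] using hE0) (e₁.seq (e₂.seq e₃)) e₄).mono ?_, b₄,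
      f₃.trans f₄, ?_⟩
    · rw [add_mul]
      simp only [powBodyWt]
      omega
    · rw [mul_assoc, ← pow_two, ← pow_mul, ← pow_add, Nat.mod_add_div] at v₄
      exact v₄

/-- Whether the vector `fst` is invertible is decided, and its inverse is computed. -/
theorem exec_unit (hw : width q N κ m ≤ w) {mem : ℕ → ℕ} (hb : Bdd w mem) (hg : Good B q κ m mem)
    {a : ModQ S q} (ha : Vec B mem .fst a) :
    ∃ mem', Exec w (.seq powCmd testCmd) mem mem' (unitWt N w) ∧ Bdd w mem' ∧
      Frame ∅ [.ctr, .tmp, .base, .inv, .rem, .res, .flag] mem mem' ∧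
      Vec B mem' .inv (a ^ (glCard q N - 1)) ∧
      ((IsUnit a ∧ hi mem' .flag 0 = 1) ∨ (¬ IsUnit a ∧ hi mem' .flag 0 = 0)) := by
  classical
  have hNm : N ≤ memEnd N m := by unfold memEnd lowEnd; omega
  have hone : ∀ {m' : ℕ → ℕ}, Good B q κ m m' → ∀ k (hk : k < N),
      m' (5 + k) = (crd B (1 : ModQ S q) ⟨k, hk⟩).val := fun g k hk => g.one_eq ⟨k, hk⟩
  have hpos : ∀ {v : ℕ}, v ≤ 1 → v < 2 ^ w := fun hv =>
    lt_of_le_of_lt hv (Nat.one_lt_two_pow (fun h0 => by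
      have : 5 ≤ w := le_trans (by unfold width memEnd lowEnd; omega) hw
      omega))
  obtain ⟨m₁, e₁, b₁, f₁, v₁⟩ := exec_vecLoop hb hg.dim .inv (by decide) (by decide)
    (.load (.add (.const 5) (val .ctr))) (fun k => mem (5 + k)) (fun _ _ => hb _)
    (fun k hk mem' hF hc _ => by
      simp only [Expr.eval, eval_val, hc]
      rw [hone hg k hk, hone (hg.frame hF (by simp) (by decide)) k hk])
  have g₁ := hg.frame f₁ (by simp) (by decide)
  have hv₁ : Vec B m₁ .inv (1 : ModQ S q) := fun i => by rw [v₁ i i.2, hg.one_eq]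
  obtain ⟨m₂, e₂, b₂, f₂, v₂⟩ := exec_vecLoop b₁ g₁.dim .base (by decide) (by decide)
    (get .fst (val .ctr)) (fun k => hi m₁ .fst k) (fun _ _ => b₁.hi _ _)
    (fun k hk mem' hF hc _ => by
      simp only [eval_get, eval_val, hc]
      exact hF.hi _ (by decide) k)
  have g₂ := g₁.frame f₂ (by simp) (by decide)
  have hv₂ : Vec B m₂ .base a := fun i => by rw [v₂ i i.2, f₁.hi _ (by decide), ha i]
  have e₃ := exec_set b₂ .rem (val .expo)
  rw [eval_val, g₂.expo] at e₃
  have hMw : glCard q N - 1 < 2 ^ w := g₂.expo ▸ b₂.hi _ _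
  have f₃ : Frame ∅ [.rem] m₂ (setHi m₂ .rem 0 (glCard q N - 1)) :=
    Frame.of_setHi _ _ (by decide) _ _
  have b₃ := b₂.setHi .rem 0 hMw
  have g₃ := g₂.frame f₃ (by simp) (by decide)
  obtain ⟨m₄, e₄, b₄, f₄, v₄⟩ := exec_powLoop hw w (glCard q N - 1) _ a 1 hMw b₃ g₃
    (hi_setHi_self _ _ _ _) (hv₂.frame f₃ (by decide))
    ((hv₁.frame f₂ (by decide)).frame f₃ (by decide))
  rw [one_mul] at v₄
  have g₄ := g₃.frame f₄ (by simp) (by decide)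
  have ha₄ : Vec B m₄ .fst a := (((ha.frame f₁ (by decide)).frame f₂ (by decide)).frame f₃
    (by decide)).frame f₄ (by decide)
  obtain ⟨m₅, e₅, b₅, f₅, v₅⟩ := exec_mul hw b₄ g₄ (dst := .res) ha₄ v₄ (by decide) (by decide)
    (by decide)
  have g₅ := g₄.frame f₅ (by simp) (by decide)
  have e₆ := exec_set b₅ .flag (.const 1)
  have f₆ : Frame ∅ [.flag] m₅ (setHi m₅ .flag 0 1) := Frame.of_setHi _ _ (by decide) _ _
  have b₆ := b₅.setHi .flag 0 (hpos le_rfl)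
  have g₆ := g₅.frame f₆ (by simp) (by decide)
  obtain ⟨m₇, e₇, b₇, -, f₇, i₇⟩ := exec_for (w := w) .ctr (val .dim)
    (set .flag (.mul (val .flag) eqExpr)) N _ (lt_two_pow_of_le_memEnd hw hNm)
    (fun i mem' => Frame ∅ [.ctr, .flag] m₅ mem' ∧
      hi mem' .flag 0 = if ∀ k < i, hi m₅ .res k = m₅ (5 + k) then 1 else 0)
    b₆ (by
      refine ⟨(f₆.mono subset_rfl (by decide)).setHi (by decide) _ _, ?_⟩
      rw [hi_setHi_of_ne _ _ _ _ (by decide), hi_setHi_self]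
      simp)
    (fun i mem' h => by rw [eval_val, h.1.hi _ (by decide), g₅.dim])
    (by
      rintro i hi' mem' bm hc ⟨hF, hI⟩
      have gm : Good B q κ m mem' := g₅.frame hF (by simp) (by decide)
      have hev : (Expr.mul (val .flag) eqExpr).eval mem' =
          if ∀ k < i + 1, hi m₅ .res k = m₅ (5 + k) then 1 else 0 := by
        have h1 : mem' (5 + i) = m₅ (5 + i) := by
          rw [hone gm i hi', hone g₅ i hi']
        simp only [eqExpr, Expr.eval, eval_val, eval_get, hc, hI, hF.hi .res (by decide), h1]
        have h2 : (∀ k < i + 1, hi m₅ .res k = m₅ (5 + k)) ↔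
            (∀ k < i, hi m₅ .res k = m₅ (5 + k)) ∧ hi m₅ .res i = m₅ (5 + i) :=
          Nat.forall_lt_succ_right
        rw [if_congr h2 rfl rfl]
        by_cases h3 : ∀ k < i, hi m₅ .res k = m₅ (5 + k)
        · by_cases h4 : hi m₅ .res i = m₅ (5 + i)
          · rw [if_pos h3, if_pos ⟨h3, h4⟩, h4]
            simp
          · rw [if_pos h3, if_neg fun h => h4 h.2]
            omega
        · rw [if_neg h3, if_neg fun h => h3 h.1, zero_mul]
      have e := exec_set bm .flag (.mul (val .flag) eqExpr)
      rw [hev] at e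
      refine ⟨_, e, bm.setHi _ _ (hpos (by split_ifs <;> omega)), ?_, ?_, ?_⟩
      · rw [hi_setHi_of_ne _ _ _ _ (by decide), hc]
      · exact (hF.setHi (by decide) _ _).setHi (by decide) _ _
      · rw [hi_setHi_of_ne _ _ _ _ (by decide), hi_setHi_self])
  refine ⟨m₇, ((e₁.seq (e₂.seq (e₃.seq e₄))).seq (e₅.seq (e₆.seq e₇))).mono ?_, b₇, ?_, ?_, ?_⟩
  · simp only [unitWt]
    omega
  · exact (f₁.mono subset_rfl (by decide)).trans ((f₂.mono subset_rfl (by decide)).trans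
      ((f₃.mono subset_rfl (by decide)).trans ((f₄.mono subset_rfl (by decide)).trans
      ((f₅.mono subset_rfl (by decide)).trans (f₇.mono subset_rfl (by decide))))))
  · exact (v₄.frame f₅ (by decide)).frame f₇ (by decide)
  · have h1 : (∀ k < N, hi m₅ .res k = m₅ (5 + k)) ↔ IsUnit a := by
      rw [isUnit_iff_mul_pow_eq_one q B a, ← (crd_injective B).eq_iff]
      constructor
      · intro h
        funext i
        have h2 := h i i.2
        rw [v₅ i, hone g₅ i i.2] at h2
        exact ZMod.val_injective q h2
      · intro h k hk
        rw [hone g₅ k hk, ← h]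
        exact v₅ ⟨k, hk⟩
    rw [i₇, if_congr h1 rfl rfl]
    by_cases hu : IsUnit a
    · exact Or.inl ⟨hu, if_pos hu⟩
    · exact Or.inr ⟨hu, if_neg hu⟩

end Programs

/-! ### Initialization -/

/-- The dimension `N = n d ^ 2`, computed from the input. -/
def dimExpr (d : ℕ) : Expr := .mul (.load (.const 0)) (.const (d ^ 2))

/-- The last cell below the arrays, computed from the input. -/
def endExpr (d : ℕ) : Expr :=
  .add (.add (.add (.add (.const 5) (dimExpr d)) (.mul (.mul (dimExpr d) (dimExpr d)) (dimExpr d)))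
    (.mul (.const 2) (dimExpr d))) (.mul (.mul (.const 2) (dimExpr d)) (.load (.const 4)))

/-- A factor of `glCard` is multiplied to `expo`, and the power `pw` of `q` is updated. -/
def expoStep : Cmd :=
  .seq (set .expo (.mul (val .expo)
      (.mul (.sub (.mul (val .pw) (.load (.const 2))) (.const 1)) (val .pw))))
    (set .pw (.mul (val .pw) (.load (.const 2))))

/-- The constants are put into their places; `expo` becomes `glCard q N - 1`. The dimension has to
be stored before the cell `0`, from which it is computed, is overwritten. -/
def initCmd (d : ℕ) : Cmd :=
  .seq (.assign (.add (.add (endExpr d) (.const 1)) (.const Reg.dim.idx)) (dimExpr d))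
    (.seq (.assign (.const 0) (endExpr d))
      (.seq (set .buf (.add (.add (.const 5) (val .dim))
          (.mul (.mul (val .dim) (val .dim)) (val .dim))))
        (.seq (set .qry (.add (val .buf) (.mul (.const 2) (val .dim))))
          (.seq (set .expo (.const 1))
            (.seq (set .pw (.const 1))
              (.seq (forLoop .ctr (val .dim) expoStep)
                (set .expo (.sub (val .expo) (.const 1)))))))))

/-- Bound for the time of `initCmd`, in units of length `w + 1`. -/
def initWt (d N : ℕ) : ℕ :=
  7 + (Cmd.assign (.add (.add (endExpr d) (.const 1)) (.const Reg.dim.idx)) (dimExpr d)).wt +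
    (Cmd.assign (.const 0) (endExpr d)).wt +
    (set .buf (.add (.add (.const 5) (val .dim))
          (.mul (.mul (val .dim) (val .dim)) (val .dim)))).wt +
    (set .qry (.add (val .buf) (.mul (.const 2) (val .dim)))).wt +
    (set .expo (.const 1)).wt + (set .pw (.const 1)).wt +
    (N + 1) * (expoStep.wt + forWt .ctr (val .dim)) +
    (set .expo (.sub (val .expo) (.const 1))).wt

theorem glCard_le (q N : ℕ) : glCard q N ≤ q ^ (N ^ 2) := by
  induction N with
  | zero => simp [glCard]
  | succ N ih =>
    rw [glCard, Finset.prod_range_succ]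
    calc _ ≤ q ^ (N ^ 2) * (q ^ (N + 1) * q ^ N) :=
          Nat.mul_le_mul ih (Nat.mul_le_mul_right _ (Nat.sub_le _ _))
      _ = q ^ ((N + 1) ^ 2) := by
          rw [← pow_add, ← pow_add]
          congr 1
          ring

/-- The powers of `q` that occur in the computation of `glCard` fit into the word length. -/
theorem q_pow_lt_two_pow {q N κ m w j : ℕ} (hq : 0 < q) (hw : width q N κ m ≤ w)
    (hj : j ≤ N ^ 2) : q ^ j < 2 ^ w := by
  have hs : 0 < q.size := Nat.size_pos.2 hq
  calc q ^ j ≤ (2 ^ q.size) ^ j := Nat.pow_le_pow_left (Nat.lt_size_self q).le j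
    _ = 2 ^ (q.size * j) := (pow_mul _ _ _).symm
    _ < 2 ^ w := by
        refine Nat.pow_lt_pow_right (by norm_num) (lt_of_lt_of_le ?_ hw)
        have : q.size * j < q.size * (N ^ 2 + 1) := Nat.mul_lt_mul_of_pos_left (by omega) hs
        unfold width
        omega

theorem exec_init {S : Type*} [Ring S] {N : ℕ} {B : Module.Basis (Fin N) ℤ S} {q κ m w : ℕ}
    [hq : Fact q.Prime] (hw : width q N κ m ≤ w) {n d : ℕ} (hN : N = n * d ^ 2) {mem : ℕ → ℕ}
    (hb : Bdd w mem) (hin : HasInput B q κ m mem) (hn : mem 0 = n) :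
    ∃ mem', Exec w (initCmd d) mem mem' (initWt d N) ∧ Bdd w mem' ∧ Good B q κ m mem' := by
  have hend : ∀ mem' : ℕ → ℕ, mem' 0 = n → mem' 4 = m → (endExpr d).eval mem' = memEnd N m := by
    intro mem' h0 h4
    simp [endExpr, dimExpr, Expr.eval, h0, h4, ← hN, memEnd, lowEnd]
  have hdim : (dimExpr d).eval mem = N := by simp [dimExpr, Expr.eval, hn, hN]
  have hle : ∀ v ≤ memEnd N m, v < 2 ^ w := fun v hv => lt_two_pow_of_le_memEnd hw hv
  have hpos : ∀ {v : ℕ}, v ≤ 1 → v < 2 ^ w := fun hv =>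
    hle _ (hv.trans (by unfold memEnd lowEnd; omega))
  have hNm : N ≤ memEnd N m := by unfold memEnd lowEnd; omega
  have e₁ := exec_assign hb (.add (.add (endExpr d) (.const 1)) (.const Reg.dim.idx)) (dimExpr d)
  rw [hdim, show (Expr.add (.add (endExpr d) (.const 1)) (.const Reg.dim.idx)).eval mem =
    memEnd N m + 1 + Reg.dim.idx by simp [Expr.eval, hend mem hn hin.m_eq]] at e₁
  set m₁ := Function.update mem (memEnd N m + 1 + Reg.dim.idx) N with hm₁
  have b₁ : Bdd w m₁ := hb.update _ (hle _ hNm)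
  have hm₁' : ∀ a ≤ memEnd N m, m₁ a = mem a := fun a ha => Function.update_of_ne (by omega) _ _
  have e₂ := exec_assign b₁ (.const 0) (endExpr d)
  have h4m : 4 ≤ memEnd N m := by unfold memEnd lowEnd; omega
  rw [hend m₁ ((hm₁' 0 (by omega)).trans hn) ((hm₁' 4 h4m).trans hin.m_eq)] at e₂
  simp only [Expr.eval] at e₂
  set m₂ := Function.update m₁ 0 (memEnd N m) with hm₂
  have b₂ : Bdd w m₂ := b₁.update _ (hle _ le_rfl)
  have z₂ : m₂ 0 = memEnd N m := Function.update_self _ _ _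
  have d₂ : hi m₂ .dim 0 = N := by
    rw [hi, z₂, hm₂, Function.update_of_ne (by omega), hm₁]
    exact Function.update_self _ _ _
  have i₂ : HasInput B q κ m m₂ := hin.of_eq fun a ha0 ha => by
    rw [hm₂, Function.update_of_ne (by omega),
      hm₁' a (ha.le.trans (lowEnd_le_memEnd N m))]
  have e₃ := exec_set b₂ .buf (.add (.add (.const 5) (val .dim))
          (.mul (.mul (val .dim) (val .dim)) (val .dim)))
  rw [show (Expr.add (.add (.const 5) (val .dim))
    (.mul (.mul (val .dim) (val .dim)) (val .dim))).eval m₂ = lowEnd N by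
      simp [Expr.eval, d₂, lowEnd]] at e₃
  have b₃ := b₂.setHi .buf 0 (hle _ (lowEnd_le_memEnd N m))
  set m₃ := setHi m₂ .buf 0 (lowEnd N) with hm₃
  have f₃ : Frame ∅ [.buf] m₂ m₃ := Frame.of_setHi _ _ (by decide) _ _
  have d₃ : hi m₃ .dim 0 = N := (f₃.hi .dim (by decide) 0).trans d₂
  have bf₃ : hi m₃ .buf 0 = lowEnd N := hi_setHi_self _ _ _ _
  have e₄ := exec_set b₃ .qry (.add (val .buf) (.mul (.const 2) (val .dim)))
  rw [show (Expr.add (val .buf) (.mul (.const 2) (val .dim))).eval m₃ = lowEnd N + 2 * N by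
    simp [Expr.eval, d₃, bf₃]] at e₄
  have b₄ := b₃.setHi .qry 0 (hle (lowEnd N + 2 * N) (by unfold memEnd; omega))
  set m₄ := setHi m₃ .qry 0 (lowEnd N + 2 * N) with hm₄
  have e₅ := exec_set b₄ .expo (.const 1)
  have b₅ := b₄.setHi .expo 0 (v := 1) (hpos le_rfl)
  set m₅ := setHi m₄ .expo 0 ((Expr.const 1).eval m₄) with hm₅
  have e₆ := exec_set (show Bdd w m₅ from b₅) .pw (.const 1)
  have b₆ := b₅.setHi .pw 0 (v := 1) (hpos le_rfl)
  have f₆ : Frame ∅ [.expo, .pw] m₄ (setHi m₅ .pw 0 1) :=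
    (Frame.of_setHi (F := [.expo, .pw]) ∅ m₄ (r := .expo) (by decide) 0 1).setHi (by decide) _ _
  have d₄ : hi m₄ .dim 0 = N := by
    rw [hm₄, hi_setHi_of_ne _ _ _ _ (by decide), f₃.hi .dim (by decide), d₂]
  have f₄ : Frame ∅ [.buf, .qry] m₂ m₄ := (f₃.mono subset_rfl (by decide)).setHi (by decide) _ _
  have q₄ : m₄ 2 = q := (f₄.low 2 (by rw [z₂]; omega) (by simp)).trans i₂.q_eq
  have z₄ : m₄ 0 = memEnd N m := f₄.zero.trans z₂
  obtain ⟨m₇, e₇, b₇, -, f₇, i₇, -⟩ := exec_for (w := w) .ctr (val .dim) expoStep N expoStep.wt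
    (hle _ hNm)
    (fun i mem' => Frame ∅ [.ctr, .expo, .pw] m₄ mem' ∧ hi mem' .expo 0 = glCard q i ∧
      hi mem' .pw 0 = q ^ i)
    b₆ (by
      refine ⟨(f₆.mono subset_rfl (by decide)).setHi (by decide) _ _, ?_, ?_⟩
      · rw [hi_setHi_of_ne _ _ _ _ (by decide), hi_setHi_of_ne _ _ _ _ (by decide), hi_setHi_self]
        simp [glCard]
      · rw [hi_setHi_of_ne _ _ _ _ (by decide), hi_setHi_self, pow_zero])
    (fun i mem' h => by rw [eval_val, h.1.hi _ (by decide), d₄])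
    (by
      rintro i hi' mem' bm hc ⟨hF, hE, hP⟩
      have hq' : mem' 2 = q := (hF.low 2 (by rw [z₄]; omega) (by simp)).trans q₄
      have s₁ := exec_set bm .expo (.mul (val .expo)
        (.mul (.sub (.mul (val .pw) (.load (.const 2))) (.const 1)) (val .pw)))
      have hev : (Expr.mul (val .expo) (.mul (.sub (.mul (val .pw) (.load (.const 2)))
          (.const 1)) (val .pw))).eval mem' = glCard q (i + 1) := by
        simp only [Expr.eval, eval_val, hE, hP, hq']
        rw [glCard, glCard, Finset.prod_range_succ, pow_succ]
      rw [hev] at s₁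
      have hlt : glCard q (i + 1) < 2 ^ w := (glCard_le q (i + 1)).trans_lt
        (q_pow_lt_two_pow hq.out.pos hw (Nat.pow_le_pow_left hi' 2))
      have c₁ := bm.setHi .expo 0 hlt
      set m' := setHi mem' .expo 0 (glCard q (i + 1)) with hm'
      have hF' : Frame ∅ [.ctr, .expo, .pw] m₄ m' := hF.setHi (by decide) _ _
      have s₂ := exec_set c₁ .pw (.mul (val .pw) (.load (.const 2)))
      have hev' : (Expr.mul (val .pw) (.load (.const 2))).eval m' = q ^ (i + 1) := by
        have h1 : m' 2 = q := (hF'.low 2 (by rw [z₄]; omega) (by simp)).trans q₄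
        have h2 : hi m' .pw 0 = q ^ i := by
          rw [hm', hi_setHi_of_ne _ _ _ _ (by decide), hP]
        simp only [Expr.eval, eval_val, h1, h2, pow_succ]
      rw [hev'] at s₂
      have hlt' : q ^ (i + 1) < 2 ^ w := q_pow_lt_two_pow hq.out.pos hw
        (show i + 1 ≤ N ^ 2 by nlinarith)
      refine ⟨_, s₁.seq s₂, c₁.setHi _ _ hlt', ?_, ?_, ?_, ?_⟩
      · rw [hi_setHi_of_ne _ _ _ _ (by decide), hm', hi_setHi_of_ne _ _ _ _ (by decide), hc]
      · exact (hF'.setHi (by decide) _ _).setHi (by decide) _ _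
      · rw [hi_setHi_of_ne _ _ _ _ (by decide), hi_setHi_of_ne _ _ _ _ (by decide), hm',
          hi_setHi_self]
      · rw [hi_setHi_of_ne _ _ _ _ (by decide), hi_setHi_self])
  have e₈ := exec_set b₇ .expo (.sub (val .expo) (.const 1))
  rw [show (Expr.sub (val .expo) (.const 1)).eval m₇ = glCard q N - 1 by
    simp [Expr.eval, i₇]] at e₈
  have hlt : glCard q N - 1 < 2 ^ w := (Nat.sub_le _ _).trans_lt
    ((glCard_le q N).trans_lt (q_pow_lt_two_pow hq.out.pos hw le_rfl))
  have f₈ : Frame ∅ [.ctr, .expo, .pw] m₄ (setHi m₇ .expo 0 (glCard q N - 1)) :=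
    f₇.setHi (by decide) _ _
  refine ⟨_, (e₁.seq (e₂.seq (e₃.seq (e₄.seq (e₅.seq (e₆.seq (e₇.seq e₈))))))).mono ?_,
    b₇.setHi _ _ hlt, ?_⟩
  · simp only [initWt, set, put, Cmd.wt]
    omega
  · exact
      { toHasInput := i₂.of_eq fun a _ ha => by
          have := lowEnd_le_memEnd N m
          rw [f₈.low a (by omega) (by simp), f₄.low a (by omega) (by simp)]
        zero := f₈.zero.trans z₄
        dim := (f₈.hi _ (by decide) 0).trans d₄
        buf := by
          rw [f₈.hi _ (by decide), hm₄, hi_setHi_of_ne _ _ _ _ (by decide), hm₃, hi_setHi_self]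
        qry := by rw [f₈.hi _ (by decide), hm₄, hi_setHi_self]
        expo := hi_setHi_self _ _ _ _ }

end RAM

namespace RAM

/-! ### The search for an invertible sample -/

/-- The difference of two residues modulo `q`. -/
def subExpr (x y : Expr) : Expr :=
  .mod (.add x (.sub (.load (.const 2)) y)) (.load (.const 2))

theorem val_sub_eq {q : ℕ} [NeZero q] (a b : ZMod q) : (a.val + (q - b.val)) % q = (a - b).val := by
  rw [← ZMod.val_natCast]
  congr 1
  rw [Nat.cast_add, Nat.cast_sub (ZMod.val_lt b).le]
  simp [sub_eq_add_neg]

theorem eval_subExpr {q : ℕ} [NeZero q] {mem : ℕ → ℕ} (hq : mem 2 = q) {x y : Expr} {a b : ZMod q}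
    (hx : x.eval mem = a.val) (hy : y.eval mem = b.val) :
    (subExpr x y).eval mem = (a - b).val := by
  simp only [subExpr, Expr.eval, hq, hx, hy]
  exact val_sub_eq a b

/-- The entry of the buffer to which the counter points. -/
def bufExpr : Expr := .load (.add (val .buf) (val .ctr))

/-- The entry of the second half of the buffer to which the counter points. -/
def bufExpr' : Expr := .load (.add (.add (val .buf) (val .dim)) (val .ctr))

/-- The part of a round of the search that follows the call of the sample oracle. -/
def findStep : Cmd :=
  .seq (vecLoop .fst bufExpr) (.seq (vecLoop .snd bufExpr') (.seq (.seq powCmd testCmd)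
    (.ite (val .flag) (set .tries (.const 0)) (set .tries (.sub (val .tries) (.const 1))))))

/-- At most `κ` samples are drawn, until the first entry of one is invertible; then `tries` is set
to `0` to leave the loop. -/
def findCmd : Cmd :=
  .seq (set .flag (.const 0)) (.seq (set .tries (.load (.const 3)))
    (.loop (val .tries) (.seq (.sample (val .buf)) findStep)))

/-- Bound for the time of `findStep`, in units of length `w + 1`. -/
def findStepWt (N w : ℕ) : ℕ :=
  3 + (N + 1) * vecWt .fst bufExpr + (N + 1) * vecWt .snd bufExpr' + unitWt N w + (val .flag).wt +
    (set .tries (.const 0)).wt + (set .tries (.sub (val .tries) (.const 1))).wt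

/-- Bound for the time of a round of the search. -/
def findBodyWt (N w : ℕ) : ℕ :=
  1 + (1 + (val .buf).wt + (N + N)) + findStepWt N w + (val .tries).wt

/-- Bound for the time of `findCmd`. -/
def findWt (N w κ : ℕ) : ℕ :=
  2 + (set .flag (.const 0)).wt + (set .tries (.load (.const 3))).wt +
    (κ * findBodyWt N w + (val .tries).wt)

section Programs

variable {S : Type*} [Ring S] {N : ℕ} {B : Module.Basis (Fin N) ℤ S} {q κ m w : ℕ}

/-- The buffer holds the coordinates of `x`, from the position `o` on. -/
def Buf (B : Module.Basis (Fin N) ℤ S) (mem : ℕ → ℕ) (o : ℕ) (x : ModQ S q) : Prop :=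
  ∀ i : Fin N, mem (o + i) = (crd B x i).val

theorem Buf.frame {W : Set ℕ} {F : List Reg} {mem mem' : ℕ → ℕ} {o : ℕ} {x : ModQ S q}
    (h : Buf B mem o x) (hF : Frame W F mem mem') (ho : ∀ i < N, o + i ≤ mem 0 ∧ o + i ∉ W) :
    Buf B mem' o x := fun i => by
  rw [hF.low _ (ho i i.2).1 (ho i i.2).2, h i]

theorem writeMem_getD (mem : ℕ → ℕ) (a : ℕ) (l : List ℕ) {i : ℕ} (hi : i < l.length) :
    writeMem mem a l (a + i) = l[i] := by
  rw [writeMem, if_pos (by omega), Nat.add_sub_cancel_left, List.getD_eq_getElem _ _ hi]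

theorem length_encodePair (p : ModQ S q × ModQ S q) : (encodePair B q p).length = N + N := by
  simp [encodePair, length_encode]

theorem Good.sample {mem : ℕ → ℕ} (hg : Good B q κ m mem) (p : ModQ S q × ModQ S q) :
    Frame (Set.Ico (lowEnd N) (lowEnd N + 2 * N)) [] mem
      (writeMem mem (lowEnd N) (encodePair B q p)) := by
  refine Frame.of_writeMem _ _ (by unfold lowEnd; omega) ?_ fun i h1 h2 => ?_
  · rw [length_encodePair, hg.zero]
    unfold memEnd
    omega
  · rw [length_encodePair] at h2
    exact ⟨h1, by omega⟩

variable [hq : Fact q.Prime]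

theorem encode_lt (hw : width q N κ m ≤ w) (x : ModQ S q) : ∀ v ∈ encode B q x, v < 2 ^ w := by
  intro v hv
  rw [encode_eq, List.mem_ofFn] at hv
  obtain ⟨i, rfl⟩ := hv
  exact lt_two_pow_of_lt_q hw (ZMod.val_lt _)

theorem encodePair_lt (hw : width q N κ m ≤ w) (p : ModQ S q × ModQ S q) :
    ∀ v ∈ encodePair B q p, v < 2 ^ w := by
  intro v hv
  rw [encodePair, List.mem_append] at hv
  exact hv.elim (encode_lt hw _ v) (encode_lt hw _ v)

theorem buf_encode (mem : ℕ → ℕ) (o : ℕ) (x : ModQ S q) :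
    Buf B (writeMem mem o (encode B q x)) o x := fun i => by
  rw [writeMem_getD _ _ _ (by rw [length_encode]; exact i.2)]
  simp [encode_eq]

theorem buf_encodePair (mem : ℕ → ℕ) (o : ℕ) (p : ModQ S q × ModQ S q) :
    Buf B (writeMem mem o (encodePair B q p)) o p.1 ∧
      Buf B (writeMem mem o (encodePair B q p)) (o + N) p.2 := by
  have hl := length_encodePair (B := B) p
  constructor
  · intro i
    rw [writeMem_getD _ _ _ (by rw [hl]; omega)]
    simp only [encodePair]
    rw [List.getElem_append_left (by rw [length_encode]; exact i.2)]
    simp [encode_eq]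
  · intro i
    rw [add_assoc, writeMem_getD _ _ _ (by rw [hl]; omega)]
    simp only [encodePair]
    rw [List.getElem_append_right (by rw [length_encode]; omega)]
    simp [encode_eq]

/-- An array is filled with the coordinates of `x`, if `e` computes them. -/
theorem exec_vecCrd (hw : width q N κ m ≤ w) {mem : ℕ → ℕ} (hb : Bdd w mem)
    (hg : Good B q κ m mem) (dst : Reg) (hdst : dst ∉ [Reg.ctr, .dim, .buf, .qry, .expo])
    (e : Expr) (x : ModQ S q)
    (he : ∀ (k : Fin N) (mem' : ℕ → ℕ), Good B q κ m mem' → Frame ∅ [.ctr, dst] mem mem' →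
      hi mem' .ctr 0 = k → e.eval mem' = (crd B x k).val) :
    ∃ mem', Exec w (vecLoop dst e) mem mem' ((N + 1) * vecWt dst e) ∧ Bdd w mem' ∧
      Good B q κ m mem' ∧ Frame ∅ [.ctr, dst] mem mem' ∧ Vec B mem' dst x := by
  simp only [List.mem_cons, List.not_mem_nil, or_false, not_or] at hdst
  have hgf : ∀ mem', Frame ∅ [.ctr, dst] mem mem' → Good B q κ m mem' := fun mem' hF =>
    hg.frame hF (by simp) (by simp [Ne.symm hdst.2.1, Ne.symm hdst.2.2.1, Ne.symm hdst.2.2.2.1,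
      Ne.symm hdst.2.2.2.2])
  obtain ⟨mem', e₁, b₁, f₁, v₁⟩ := exec_vecLoop hb hg.dim dst hdst.1 hdst.2.1 e
    (fun k => if h : k < N then (crd B x ⟨k, h⟩).val else 0)
    (fun k hk => by
      rw [dif_pos hk]
      exact lt_two_pow_of_lt_q hw (ZMod.val_lt _))
    (fun k hk mem' hF hc _ => by rw [dif_pos hk, he ⟨k, hk⟩ mem' (hgf mem' hF) hF hc])
  exact ⟨mem', e₁, b₁, hgf mem' f₁, f₁, fun i => by rw [v₁ i i.2, dif_pos i.2]⟩

/-- What the search for an invertible sample leaves in the memory. -/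
def Found (B : Module.Basis (Fin N) ℤ S) (mem : ℕ → ℕ) :
    Option ((ModQ S q)ˣ × ModQ S q) → Prop
  | none => hi mem .flag 0 = 0
  | some (a, b) => hi mem .flag 0 = 1 ∧ Vec B mem .inv (↑a⁻¹ : ModQ S q) ∧ Vec B mem .snd b

theorem exec_findStep (hw : width q N κ m ≤ w) {mem : ℕ → ℕ} (hb : Bdd w mem)
    (hg : Good B q κ m mem) {p : ModQ S q × ModQ S q} (hp : Buf B mem (lowEnd N) p.1)
    (hp' : Buf B mem (lowEnd N + N) p.2) {t : ℕ} (ht : hi mem .tries 0 = t + 1) :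
    ∃ mem', Exec w findStep mem mem' (findStepWt N w) ∧ Bdd w mem' ∧ Good B q κ m mem' ∧
      ((∃ h : IsUnit p.1, hi mem' .tries 0 = 0 ∧ Found B mem' (some (h.unit, p.2))) ∨
        (¬ IsUnit p.1 ∧ hi mem' .tries 0 = t ∧ hi mem' .flag 0 = 0)) := by
  have hlow : ∀ i < N, lowEnd N + i ≤ mem 0 ∧ lowEnd N + N + i ≤ mem 0 := fun i hi => by
    rw [hg.zero]
    unfold memEnd
    omega
  obtain ⟨m₁, e₁, b₁, g₁, f₁, v₁⟩ := exec_vecCrd hw hb hg .fst (by decide) bufExpr p.1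
    (fun k mem' g hF hc => by
      simp only [bufExpr, Expr.eval, eval_val, g.buf, hc]
      rw [hF.low _ (hlow k k.2).1 (by simp), hp k])
  obtain ⟨m₂, e₂, b₂, g₂, f₂, v₂⟩ := exec_vecCrd hw b₁ g₁ .snd (by decide) bufExpr' p.2
    (fun k mem' g hF hc => by
      simp only [bufExpr', Expr.eval, eval_val, g.buf, g.dim, hc]
      rw [hF.low _ (f₁.zero ▸ (hlow k k.2).2) (by simp), f₁.low _ (hlow k k.2).2 (by simp), hp' k])
  obtain ⟨m₃, e₃, b₃, f₃, v₃, h₃⟩ := exec_unit hw b₂ g₂ (v₁.frame f₂ (by decide))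
  have g₃ := g₂.frame f₃ (by simp) (by decide)
  have ht₃ : hi m₃ .tries 0 = t + 1 := by
    rw [f₃.hi _ (by decide), f₂.hi _ (by decide), f₁.hi _ (by decide), ht]
  have v₂' := v₂.frame f₃ (by decide)
  rcases h₃ with ⟨hu, hf⟩ | ⟨hu, hf⟩
  · have e₄ := exec_set b₃ .tries (.const 0)
    have F := Frame.of_setHi (F := [.tries]) ∅ m₃ (r := .tries) (by decide) 0 0
    refine ⟨_, (e₁.seq (e₂.seq (e₃.seq (exec_ite b₃ (val .flag)
      (by rw [eval_val, hf, if_pos one_ne_zero]; exact e₄))))).mono ?_,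
      b₃.setHi _ _ (by positivity), g₃.frame F (by simp) (by decide), Or.inl ⟨hu, ?_, ?_, ?_, ?_⟩⟩
    · simp only [findStepWt]
      omega
    · exact hi_setHi_self _ _ _ _
    · exact (F.hi _ (by decide) 0).trans hf
    · rw [inv_eq_pow q B, IsUnit.unit_spec]
      exact v₃.frame F (by decide)
    · exact v₂'.frame F (by decide)
  · have e₄ := exec_set b₃ .tries (.sub (val .tries) (.const 1))
    have hev : (Expr.sub (val .tries) (.const 1)).eval m₃ = t := by simp [Expr.eval, ht₃]
    rw [hev] at e₄
    have F := Frame.of_setHi (F := [.tries]) ∅ m₃ (r := .tries) (by decide) 0 t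
    have htw : t < 2 ^ w := by
      have := b₃.hi .tries 0
      omega
    refine ⟨_, (e₁.seq (e₂.seq (e₃.seq (exec_ite b₃ (val .flag)
      (by rw [eval_val, hf, if_neg (not_not.2 rfl)]; exact e₄))))).mono ?_,
      b₃.setHi _ _ htw, g₃.frame F (by simp) (by decide), Or.inr ⟨hu, ?_, ?_⟩⟩
    · simp only [findStepWt]
      omega
    · exact hi_setHi_self _ _ _ _
    · exact (F.hi _ (by decide) 0).trans hf

variable {β : Type*} {O : Oracles} {out : (ℕ → ℕ) → β} {k : List Cmd} {τ : ℕ}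
  {D : PMF (ModQ S q × ModQ S q)}

theorem halts_findLoop (hw : width q N κ m ≤ w) (hO : O.sample = D.map (encodePair B q))
    {ψ : Option ((ModQ S q)ˣ × ModQ S q) → PMF β}
    (h : ∀ r mem, Bdd w mem → Good B q κ m mem → Found B mem r → Halts w O out k mem τ (ψ r))
    (t : ℕ) : ∀ mem, Bdd w mem → Good B q κ m mem → hi mem .tries 0 = t → hi mem .flag 0 = 0 →
      Halts w O out (.loop (val .tries) (.seq (.sample (val .buf)) findStep) :: k) mem
        (τ + (t * findBodyWt N w + (val .tries).wt)) ((findUnit D t).bind ψ) := by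
  induction t with
  | zero =>
    intro mem hb hg ht hf
    rw [findUnit, PMF.pure_bind]
    refine (Halts.loop hb (τ := τ) ?_).mono (by omega)
    rw [eval_val, ht, if_neg (not_not.2 rfl)]
    exact h none mem hb hg hf
  | succ t ih =>
    intro mem hb hg ht hf
    rw [findUnit, PMF.bind_bind]
    refine (Halts.loop hb (τ := τ + (t * findBodyWt N w + (val .tries).wt) + findStepWt N w +
      (1 + (val .buf).wt + (N + N)) + 1) ?_).mono (by
        rw [add_mul]
        simp only [findBodyWt]
        omega)
    rw [eval_val, ht, if_pos (Nat.succ_ne_zero t)]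
    refine (halts_sample hO hb (fun p => ⟨(length_encodePair p).le, encodePair_lt hw p⟩)
      fun p => ?_).seq
    rw [eval_val, hg.buf]
    have f₁ := hg.sample p
    obtain ⟨h1, h2⟩ := buf_encodePair (B := B) mem (lowEnd N) p
    obtain ⟨m₂, e₂, b₂, g₂, h₂⟩ := exec_findStep hw (hb.writeMem _ (encodePair_lt hw p))
      (hg.frame f₁ (fun _ ha => ha.1) (by decide)) h1 h2 ((f₁.hi _ (by decide) 0).trans ht)
    refine Halts.exec ?_ e₂
    rcases h₂ with ⟨hu, ht₂, hF⟩ | ⟨hu, ht₂, hf₂⟩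
    · rw [dif_pos hu, PMF.pure_bind]
      refine (Halts.loop b₂ (τ := τ) ?_).mono (by omega)
      rw [eval_val, ht₂, if_neg (not_not.2 rfl)]
      exact h _ m₂ b₂ g₂ hF
    · rw [dif_neg hu]
      exact ih m₂ b₂ g₂ ht₂ hf₂

theorem halts_find (hw : width q N κ m ≤ w) (hO : O.sample = D.map (encodePair B q))
    {ψ : Option ((ModQ S q)ˣ × ModQ S q) → PMF β}
    (h : ∀ r mem, Bdd w mem → Good B q κ m mem → Found B mem r → Halts w O out k mem τ (ψ r))
    {mem : ℕ → ℕ} (hb : Bdd w mem) (hg : Good B q κ m mem) :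
    Halts w O out (findCmd :: k) mem (τ + findWt N w κ) ((findUnit D κ).bind ψ) := by
  have e₁ := exec_set hb .flag (.const 0)
  have f₁ := Frame.of_setHi (F := [.flag]) ∅ mem (r := .flag) (by decide) 0 0
  have b₁ := hb.setHi .flag 0 (v := 0) (by positivity)
  have g₁ := hg.frame f₁ (by simp) (by decide)
  have e₂ := exec_set b₁ .tries (.load (.const 3))
  have hev : (Expr.load (.const 3)).eval (setHi mem .flag 0 0) = κ := g₁.κ_eq
  have hκ : κ < 2 ^ w := g₁.κ_eq ▸ b₁ 3
  rw [hev] at e₂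
  have f₂ := Frame.of_setHi (F := [.tries]) ∅ (setHi mem .flag 0 0) (r := .tries) (by decide) 0 κ
  have := halts_findLoop hw hO h κ _ (b₁.setHi .tries 0 hκ) (g₁.frame f₂ (by simp) (by decide))
    (hi_setHi_self _ _ _ _) ((f₂.hi _ (by decide) 0).trans (hi_setHi_self _ _ _ _))
  exact (((this.exec e₂).seq.exec e₁).seq).mono (by simp only [findWt]; omega)

end Programs

end RAM

namespace RAM

/-! ### The query to the solver -/

/-- The position of the block of the query that belongs to the current round. -/
def blockExpr : Expr := .add (val .qry) (.mul (.mul (.const 2) (val .dim)) (val .round))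

/-- A coordinate of the first entry of the transformed sample. -/
def fstExpr (ε : ℤˣ) : Expr :=
  if ε = 1 then get .prod (val .ctr) else subExpr (.const 0) (get .prod (val .ctr))

/-- A coordinate of the second entry of the transformed sample. -/
def sndExpr (ε : ℤˣ) : Expr :=
  if ε = 1 then subExpr (get .res (val .ctr)) bufExpr'
  else subExpr bufExpr' (get .res (val .ctr))

/-- The transformed sample is appended to the query. -/
def roundStep (ε : ℤˣ) : Cmd :=
  .seq (vecLoop .base bufExpr) (.seq (mulCmd .prod .base .inv) (.seq (mulCmd .res .prod .snd)
    (.seq (lowLoop blockExpr (val .dim) (fstExpr ε))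
      (.seq (lowLoop (.add blockExpr (val .dim)) (val .dim) (sndExpr ε))
        (set .round (.add (val .round) (.const 1)))))))

/-- The query is composed and sent. -/
def queryCmd (ε : ℤˣ) : Cmd :=
  .seq (set .round (.const 0))
    (.seq (.loop (.sub (.load (.const 4)) (val .round)) (.seq (.sample (val .buf)) (roundStep ε)))
      (.solve (val .qry) (.mul (.mul (.const 2) (val .dim)) (.load (.const 4))) (val .buf)))

/-- Bound for the time of `roundStep`, in units of length `w + 1`. -/
def roundStepWt (ε : ℤˣ) (N : ℕ) : ℕ :=
  5 + (N + 1) * vecWt .base bufExpr + mulWt N .prod .base .inv + mulWt N .res .prod .snd +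
    (N + 1) * lowWt blockExpr (val .dim) (fstExpr ε) +
    (N + 1) * lowWt (.add blockExpr (val .dim)) (val .dim) (sndExpr ε) +
    (set .round (.add (val .round) (.const 1))).wt

/-- Bound for the time of a round in which the query is extended. -/
def roundBodyWt (ε : ℤˣ) (N : ℕ) : ℕ :=
  1 + (1 + (val .buf).wt + (N + N)) + roundStepWt ε N +
    (Expr.sub (.load (.const 4)) (val .round)).wt

/-- Bound for the time of `queryCmd`, where `l` bounds the length of the reply of the solver. -/
def queryWt (ε : ℤˣ) (N m l : ℕ) : ℕ :=
  2 + (set .round (.const 0)).wt +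
    (m * roundBodyWt ε N + (Expr.sub (.load (.const 4)) (val .round)).wt) +
    (1 + (val .qry).wt + (Expr.mul (.mul (.const 2) (val .dim)) (.load (.const 4))).wt +
      (val .buf).wt + 2 * N * m + l)

section Programs

variable {S : Type*} [Ring S] {N : ℕ} {B : Module.Basis (Fin N) ℤ S} {q κ m w : ℕ}

/-- The query holds the coordinates of the pairs in the list `xs`. -/
def Query (B : Module.Basis (Fin N) ℤ S) (mem : ℕ → ℕ) (xs : List (ModQ S q × ModQ S q)) : Prop :=
  ∀ j (hj : j < xs.length), Buf B mem (lowEnd N + 2 * N + 2 * N * j) xs[j].1 ∧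
    Buf B mem (lowEnd N + 2 * N + 2 * N * j + N) xs[j].2

theorem two_mul_mul_le {N i j : ℕ} (h : i < j) : 2 * N * i + 2 * N ≤ 2 * N * j := by
  have := Nat.mul_le_mul_left (2 * N) h
  rwa [Nat.succ_eq_add_one, mul_add, mul_one] at this

theorem Query.frame {W : Set ℕ} {F : List Reg} {mem mem' : ℕ → ℕ}
    {xs : List (ModQ S q × ModQ S q)} (h : Query B mem xs) (hF : Frame W F mem mem')
    (hm : lowEnd N + 2 * N + 2 * N * xs.length ≤ mem 0)
    (hW : ∀ a ∈ W, a < lowEnd N + 2 * N ∨ lowEnd N + 2 * N + 2 * N * xs.length ≤ a) :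
    Query B mem' xs := by
  intro j hj
  have h1 := two_mul_mul_le (N := N) hj
  constructor
  · refine (h j hj).1.frame hF fun i hi => ⟨by omega, fun h2 => ?_⟩
    have := hW _ h2
    omega
  · refine (h j hj).2.frame hF fun i hi => ⟨by omega, fun h2 => ?_⟩
    have := hW _ h2
    omega

variable [hq : Fact q.Prime]

/-- A part of the query is filled with the coordinates of `x`, if `e` computes them. -/
theorem exec_lowCrd (hw : width q N κ m ≤ w) {mem : ℕ → ℕ} (hb : Bdd w mem)
    (hg : Good B q κ m mem) {A : ℕ} (hA : lowEnd N ≤ A) (hA' : A + N ≤ memEnd N m + 1)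
    (base e : Expr) (x : ModQ S q)
    (he : ∀ (k : Fin N) (mem' : ℕ → ℕ), Good B q κ m mem' →
      Frame (Set.Ico A (A + N)) [.ctr] mem mem' → hi mem' .ctr 0 = k →
      base.eval mem' = A ∧ e.eval mem' = (crd B x k).val) :
    ∃ mem', Exec w (lowLoop base (val .dim) e) mem mem' ((N + 1) * lowWt base (val .dim) e) ∧
      Bdd w mem' ∧ Good B q κ m mem' ∧ Frame (Set.Ico A (A + N)) [.ctr] mem mem' ∧
      Buf B mem' A x := by
  have hgf : ∀ mem', Frame (Set.Ico A (A + N)) [.ctr] mem mem' → Good B q κ m mem' :=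
    fun mem' hF => hg.frame hF (fun a ha => hA.trans ha.1) (by decide)
  obtain ⟨mem', e₁, b₁, f₁, v₁⟩ := exec_lowLoop (m := N) (A := A) hb
    (lt_two_pow_of_le_memEnd hw (by unfold memEnd lowEnd; omega)) base (val .dim) e
    (lt_of_lt_of_le (by unfold lowEnd; omega) hA) (by rw [hg.zero]; exact hA')
    (fun k => if h : k < N then (crd B x ⟨k, h⟩).val else 0)
    (fun k hk => by
      rw [dif_pos hk]
      exact lt_two_pow_of_lt_q hw (ZMod.val_lt _))
    (fun mem' hF => (hgf mem' hF).dim)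
    (fun k hk mem' hF hc => by
      rw [dif_pos hk]
      exact he ⟨k, hk⟩ mem' (hgf mem' hF) hF hc)
  exact ⟨mem', e₁, b₁, hgf mem' f₁, f₁, fun i => by rw [v₁ i i.2, dif_pos i.2]⟩

theorem exec_roundStep (ε : ℤˣ) (hw : width q N κ m ≤ w) {mem : ℕ → ℕ} (hb : Bdd w mem)
    (hg : Good B q κ m mem) {p : ModQ S q × ModQ S q} (hp : Buf B mem (lowEnd N) p.1)
    (hp' : Buf B mem (lowEnd N + N) p.2) {a : (ModQ S q)ˣ} {b : ModQ S q}
    (hinv : Vec B mem .inv (↑a⁻¹ : ModQ S q)) (hsnd : Vec B mem .snd b)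
    {xs : List (ModQ S q × ModQ S q)} (hxs : Query B mem xs) (hm : xs.length < m)
    (hr : hi mem .round 0 = xs.length) :
    ∃ mem', Exec w (roundStep ε) mem mem' (roundStepWt ε N) ∧ Bdd w mem' ∧ Good B q κ m mem' ∧
      Vec B mem' .inv (↑a⁻¹ : ModQ S q) ∧ Vec B mem' .snd b ∧
      hi mem' .round 0 = xs.length + 1 ∧ Query B mem' (xs ++ [transform ε a b p]) := by
  have hle := two_mul_mul_le (N := N) hm
  have hlow : lowEnd N + 2 * N + 2 * N * xs.length + 2 * N ≤ mem 0 := by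
    rw [hg.zero]
    unfold memEnd
    omega
  obtain ⟨m₁, e₁, b₁, g₁, f₁, v₁⟩ := exec_vecCrd hw hb hg .base (by decide) bufExpr p.1
    (fun k mem' g hF hc => by
      simp only [bufExpr, Expr.eval, eval_val, g.buf, hc]
      rw [hF.low _ (by omega) (by simp), hp k])
  obtain ⟨m₂, e₂, b₂, f₂, v₂⟩ := exec_mul hw b₁ g₁ (dst := .prod) v₁ (hinv.frame f₁ (by decide))
    (by decide) (by decide) (by decide)
  have g₂ := g₁.frame f₂ (by simp) (by decide)
  obtain ⟨m₃, e₃, b₃, f₃, v₃⟩ := exec_mul hw b₂ g₂ (dst := .res) v₂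
    ((hsnd.frame f₁ (by decide)).frame f₂ (by decide)) (by decide) (by decide) (by decide)
  have g₃ := g₂.frame f₃ (by simp) (by decide)
  have F₃ : Frame ∅ [.ctr, .tmp, .base, .prod, .res] mem m₃ :=
    (f₁.mono subset_rfl (by decide)).trans ((f₂.mono subset_rfl (by decide)).trans
      (f₃.mono subset_rfl (by decide)))
  have v₂' := v₂.frame f₃ (by decide)
  have hr₃ : hi m₃ .round 0 = xs.length := (F₃.hi _ (by decide) 0).trans hr
  have hlow' := hlow
  rw [hg.zero] at hlow'
  obtain ⟨m₄, e₄, b₄, g₄, f₄, v₄⟩ := exec_lowCrd hw b₃ g₃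
    (A := lowEnd N + 2 * N + 2 * N * xs.length) (by omega) (by omega) blockExpr
    (fstExpr ε) (transform ε a b p).1 (fun k mem' g hF hc => by
      have h1 : hi mem' .round 0 = xs.length := (hF.hi _ (by decide) 0).trans hr₃
      have h2 := (v₂'.frame hF (by decide)) k
      refine ⟨by simp only [blockExpr, Expr.eval, eval_val, g.qry, g.dim, h1], ?_⟩
      have h3 : (get .prod (val .ctr)).eval mem' = (crd B (p.1 * (↑a⁻¹ : ModQ S q)) k).val := by
        simp only [eval_get, eval_val, hc, h2]
      rcases Int.units_eq_one_or ε with rfl | rfl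
      · simpa [fstExpr, transform] using h3
      · rw [fstExpr, if_neg (by decide), eval_subExpr g.q_eq (a := 0) (by simp [Expr.eval]) h3]
        simp [transform, crd_neg])
  have hr₄ : hi m₄ .round 0 = xs.length := (f₄.hi _ (by decide) 0).trans hr₃
  have v₃' := v₃.frame f₄ (by decide)
  have z₄ : m₄ 0 = mem 0 := f₄.zero.trans F₃.zero
  have hp₄ : Buf B m₄ (lowEnd N + N) p.2 := (hp'.frame F₃ fun i hi => ⟨by omega, by simp⟩).frame f₄
    fun i hi => ⟨by rw [F₃.zero]; omega, fun h => by have := h.1; omega⟩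
  obtain ⟨m₅, e₅, b₅, g₅, f₅, v₅⟩ := exec_lowCrd hw b₄ g₄
    (A := lowEnd N + 2 * N + 2 * N * xs.length + N) (by omega) (by omega)
    (.add blockExpr (val .dim)) (sndExpr ε) (transform ε a b p).2 (fun k mem' g hF hc => by
      have h1 : hi mem' .round 0 = xs.length := (hF.hi _ (by decide) 0).trans hr₄
      have h2 := (v₃'.frame hF (by decide)) k
      have h4 := hp₄.frame hF (fun i hi => ⟨by omega, fun h => by have := h.1; omega⟩) k
      refine ⟨by simp only [blockExpr, Expr.eval, eval_val, g.qry, g.dim, h1], ?_⟩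
      have h3 : (get .res (val .ctr)).eval mem' =
          (crd B (p.1 * (↑a⁻¹ : ModQ S q) * b) k).val := by
        simp only [eval_get, eval_val, hc, h2]
      have h5 : bufExpr'.eval mem' = (crd B p.2 k).val := by
        simp only [bufExpr', Expr.eval, eval_val, g.buf, g.dim, hc, h4]
      rcases Int.units_eq_one_or ε with rfl | rfl
      · rw [sndExpr, if_pos rfl, eval_subExpr g.q_eq h3 h5]
        simp [transform, crd_sub]
      · rw [sndExpr, if_neg (by decide), eval_subExpr g.q_eq h5 h3]
        simp [transform, crd_sub])
  have e₆ := exec_set b₅ .round (.add (val .round) (.const 1))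
  have hev : (Expr.add (val .round) (.const 1)).eval m₅ = xs.length + 1 := by
    simp only [Expr.eval, eval_val, f₅.hi .round (by decide), hr₄]
  rw [hev] at e₆
  have hmw : m < 2 ^ w := g₅.m_eq ▸ b₅ 4
  have f₆ := Frame.of_setHi (F := [.round]) ∅ m₅ (r := .round) (by decide) 0 (xs.length + 1)
  have z₅ : m₅ 0 = mem 0 := f₅.zero.trans z₄
  refine ⟨_, (e₁.seq (e₂.seq (e₃.seq (e₄.seq (e₅.seq e₆))))).mono ?_,
    b₅.setHi _ _ (by omega), g₅.frame f₆ (by simp) (by decide), ?_, ?_, hi_setHi_self _ _ _ _, ?_⟩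
  · simp only [roundStepWt]
    omega
  · exact (((hinv.frame F₃ (by decide)).frame f₄ (by decide)).frame f₅ (by decide)).frame f₆
      (by decide)
  · exact (((hsnd.frame F₃ (by decide)).frame f₄ (by decide)).frame f₅ (by decide)).frame f₆
      (by decide)
  · have hQ : Query B (setHi m₅ .round 0 (xs.length + 1)) xs := by
      refine (((hxs.frame F₃ (by omega) (by simp)).frame f₄ (by rw [F₃.zero]; omega) ?_).frame f₅
        (by omega) ?_).frame f₆ (by omega) (by simp)
      · exact fun a ha => Or.inr ha.1
      · exact fun a ha => Or.inr (by have := ha.1; omega)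
    intro j hj
    rw [List.length_append, List.length_singleton] at hj
    rcases Nat.lt_succ_iff_lt_or_eq.1 hj with h | h
    · rw [List.getElem_append_left h]
      exact hQ j h
    · subst h
      rw [List.getElem_concat_length rfl]
      refine ⟨?_, ?_⟩
      · exact (v₄.frame f₅ fun i hi => ⟨by omega, fun h => by have := h.1; omega⟩).frame f₆
          fun i hi => ⟨by omega, by simp⟩
      · exact v₅.frame f₆ fun i hi => ⟨by omega, by simp⟩

theorem Query.decodePairs {mem : ℕ → ℕ} {xs : List (ModQ S q × ModQ S q)} (h : Query B mem xs)
    (hm : xs.length = m) :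
    decodePairs B q m (readMem mem (lowEnd N + 2 * N) (2 * N * m)) = xs := by
  have hget : ∀ i < 2 * N * m, (readMem mem (lowEnd N + 2 * N) (2 * N * m)).getD i 0 =
      mem (lowEnd N + 2 * N + i) := fun i hi => by
    rw [List.getD_eq_getElem _ _ (by simpa [readMem] using hi)]
    simp [readMem]
  refine List.ext_getElem (by simp [_root_.decodePairs, hm]) fun j h1 h2 => ?_
  have h3 := two_mul_mul_le (N := N) (hm ▸ h2)
  simp only [_root_.decodePairs, List.getElem_map, List.getElem_range]
  refine Prod.ext (decode_eq B fun i => ?_) (decode_eq B fun i => ?_)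
  · rw [hget _ (by omega), ← add_assoc, (h j h2).1 i]
    simp
  · rw [hget _ (by omega), ← add_assoc, ← add_assoc, (h j h2).2 i]
    simp

variable {β : Type*} {O : Oracles} {out : (ℕ → ℕ) → β} {k : List Cmd} {τ : ℕ}
  {D : PMF (ModQ S q × ModQ S q)} {a : (ModQ S q)ˣ} {b : ModQ S q}

/-- The loop that extends the query `xs` by `j` transformed samples. -/
theorem halts_queryLoop (ε : ℤˣ) (hw : width q N κ m ≤ w) (hO : O.sample = D.map (encodePair B q))
    {ψ : List (ModQ S q × ModQ S q) → PMF β}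
    (h : ∀ xs mem, Bdd w mem → Good B q κ m mem → Vec B mem .inv (↑a⁻¹ : ModQ S q) →
      Vec B mem .snd b → xs.length = m → Query B mem xs → Halts w O out k mem τ (ψ xs))
    (j : ℕ) : ∀ mem xs, xs.length + j = m → Bdd w mem → Good B q κ m mem →
      Vec B mem .inv (↑a⁻¹ : ModQ S q) → Vec B mem .snd b → hi mem .round 0 = xs.length →
      Query B mem xs →
      Halts w O out (.loop (.sub (.load (.const 4)) (val .round))
          (.seq (.sample (val .buf)) (roundStep ε)) :: k) mem
        (τ + (j * roundBodyWt ε N + (Expr.sub (.load (.const 4)) (val .round)).wt))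
        ((iid D j).bind fun ys => ψ (xs ++ ys.map (transform ε a b))) := by
  induction j with
  | zero =>
    intro mem xs hj hb hg hinv hsnd hr hxs
    rw [iid, PMF.pure_bind]
    refine (Halts.loop hb (τ := τ) ?_).mono (by omega)
    have : (Expr.sub (.load (.const 4)) (val .round)).eval mem = 0 := by
      simp only [Expr.eval, eval_val, hg.m_eq, hr]
      omega
    rw [this, if_neg (not_not.2 rfl), List.map_nil, List.append_nil]
    exact h xs mem hb hg hinv hsnd (by omega) hxs
  | succ j ih =>
    intro mem xs hj hb hg hinv hsnd hr hxs
    have hm : xs.length < m := by omega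
    have hle := two_mul_mul_le (N := N) hm
    rw [iid, PMF.bind_bind]
    refine (Halts.loop hb (τ := τ + (j * roundBodyWt ε N +
      (Expr.sub (.load (.const 4)) (val .round)).wt) + roundStepWt ε N +
      (1 + (val .buf).wt + (N + N)) + 1) ?_).mono (by
        rw [add_mul]
        simp only [roundBodyWt]
        omega)
    have : (Expr.sub (.load (.const 4)) (val .round)).eval mem ≠ 0 := by
      simp only [Expr.eval, eval_val, hg.m_eq, hr]
      omega
    rw [if_pos this]
    refine (halts_sample hO hb (fun p => ⟨(length_encodePair p).le, encodePair_lt hw p⟩)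
      fun p => ?_).seq
    rw [eval_val, hg.buf]
    have f₁ := hg.sample p
    obtain ⟨h1, h2⟩ := buf_encodePair (B := B) mem (lowEnd N) p
    obtain ⟨m₂, e₂, b₂, g₂, hinv₂, hsnd₂, hr₂, hxs₂⟩ := exec_roundStep ε hw
      (hb.writeMem _ (encodePair_lt hw p)) (hg.frame f₁ (fun _ ha => ha.1) (by decide)) h1 h2
      (hinv.frame f₁ (by decide)) (hsnd.frame f₁ (by decide))
      (hxs.frame f₁ (by rw [hg.zero]; unfold memEnd; omega) fun a ha => Or.inl ha.2) hm
      ((f₁.hi _ (by decide) 0).trans hr)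
    refine Halts.exec ?_ e₂
    have := ih m₂ (xs ++ [transform ε a b p]) (by simp; omega) b₂ g₂ hinv₂ hsnd₂
      (by simpa using hr₂) hxs₂
    rw [PMF.bind_map]
    simpa [Function.comp_def] using this

theorem halts_query {α : Type*} (ε : ℤˣ) (hw : width q N κ m ≤ w)
    (hO : O.sample = D.map (encodePair B q)) {A : List (ModQ S q × ModQ S q) → PMF α}
    {enc : α → List ℕ} (hO' : ∀ l, O.solver l = (A (decodePairs B q m l)).map enc) {l : ℕ}
    (henc : ∀ x, (enc x).length ≤ l ∧ ∀ v ∈ enc x, v < 2 ^ w) {ψ : α → PMF β}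
    (h : ∀ x mem, Bdd w mem → Good B q κ m mem → Vec B mem .inv (↑a⁻¹ : ModQ S q) →
      Vec B mem .snd b → Halts w O out k (writeMem mem (lowEnd N) (enc x)) τ (ψ x))
    {mem : ℕ → ℕ} (hb : Bdd w mem) (hg : Good B q κ m mem)
    (hinv : Vec B mem .inv (↑a⁻¹ : ModQ S q)) (hsnd : Vec B mem .snd b) :
    Halts w O out (queryCmd ε :: k) mem (τ + queryWt ε N m l)
      ((iid D m).bind fun xs => (A (xs.map (transform ε a b))).bind ψ) := by
  have e₁ := exec_set hb .round (.const 0)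
  have f₁ := Frame.of_setHi (F := [.round]) ∅ mem (r := .round) (by decide) 0 0
  have b₁ := hb.setHi .round 0 (v := 0) (by positivity)
  have g₁ := hg.frame f₁ (by simp) (by decide)
  have := halts_queryLoop (k := .solve (val .qry)
      (.mul (.mul (.const 2) (val .dim)) (.load (.const 4))) (val .buf) :: k) (out := out)
    (τ := τ + (1 + (val .qry).wt + (Expr.mul (.mul (.const 2) (val .dim)) (.load (.const 4))).wt +
      (val .buf).wt + 2 * N * m + l)) (ψ := fun xs => (A xs).bind ψ) ε hw hO
    (fun xs mem' hb' hg' hinv' hsnd' hl hxs => by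
      have hlen : (Expr.mul (.mul (.const 2) (val .dim)) (.load (.const 4))).eval mem' =
          2 * N * m := by simp only [Expr.eval, eval_val, hg'.dim, hg'.m_eq]
      have := halts_solve (k := k) (τ := τ) (src := val .qry) (dst := val .buf)
        (len := .mul (.mul (.const 2) (val .dim)) (.load (.const 4))) (D := A xs)
        (by rw [hlen, eval_val, hg'.qry, hO', hxs.decodePairs hl]) hb' henc
        (fun x => by
          rw [eval_val, hg'.buf]
          exact h x mem' hb' hg' hinv' hsnd')
      rwa [hlen] at this) m _ [] (by simp) b₁ g₁ (hinv.frame f₁ (by decide))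
      (hsnd.frame f₁ (by decide)) (hi_setHi_self _ _ _ _)
      (fun j hj => absurd hj (Nat.not_lt_zero j))
  refine ((this.seq.exec e₁).seq).mono ?_
  simp only [queryWt]
  omega

end Programs

end RAM

namespace RAM

/-! ### The programs -/

/-- The vector `prod` is stored from the cell `0` on. The cell `0`, on which the access to the
arrays depends, comes last. -/
def outCmd : Cmd :=
  .seq (lowLoop (.const 1) (.sub (val .dim) (.const 1)) (get .prod (.add (val .ctr) (.const 1))))
    (.assign (.const 0) (get .prod (.const 0)))

/-- The answer `x` of the solver is turned into `inv * (snd - x)`. -/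
def postSearch : Cmd :=
  .seq (vecLoop .base (subExpr (get .snd (val .ctr)) bufExpr))
    (.seq (mulCmd .prod .inv .base) outCmd)

/-- The output `0`, if no invertible sample has been found. -/
def failSearch : Cmd := .seq (vecLoop .prod (.const 0)) outCmd

/-- The answer of the solver is the output. -/
def postDecision : Cmd := .assign (.const 0) (.load (val .buf))

/-- The output for rejection, if no invertible sample has been found. -/
def failDecision : Cmd := .assign (.const 0) (.const 0)

/-- The reduction, with the commands `post` for the treatment of the answer and `fail` for the case
that no invertible sample has been found. -/
def mainCmd (d : ℕ) (ε : ℤˣ) (post fail : Cmd) : Cmd :=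
  .seq (initCmd d) (.seq findCmd (.ite (val .flag) (.seq (queryCmd ε) post) fail))

/-- Bound for the time of `outCmd`, in units of length `w + 1`. -/
def outWt (N : ℕ) : ℕ :=
  1 + (N + 1) * lowWt (.const 1) (.sub (val .dim) (.const 1))
    (get .prod (.add (val .ctr) (.const 1))) + (Cmd.assign (.const 0) (get .prod (.const 0))).wt

/-- Bound for the time of `postSearch`. -/
def postSearchWt (N : ℕ) : ℕ :=
  2 + (N + 1) * vecWt .base (subExpr (get .snd (val .ctr)) bufExpr) + mulWt N .prod .inv .base +
    outWt N

/-- Bound for the time of `failSearch`. -/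
def failSearchWt (N : ℕ) : ℕ := 1 + (N + 1) * vecWt .prod (.const 0) + outWt N

/-- Bound for the time of `mainCmd`, where `p` and `f` bound the times of `post` and `fail`. -/
def mainWt (d : ℕ) (ε : ℤˣ) (N w κ m l p f : ℕ) : ℕ :=
  p + f + queryWt ε N m l + 3 + (val .flag).wt + findWt N w κ + initWt d N

section Programs

variable {S : Type*} [Ring S] {N : ℕ} {B : Module.Basis (Fin N) ℤ S} {q κ m w : ℕ}
  {O : Oracles}

theorem halts_postDecision (hw : width q N κ m ≤ w) {mem : ℕ → ℕ} (hb : Bdd w mem)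
    (hg : Good B q κ m mem) (x : Bool) :
    Halts w O (fun mem => decide (mem 0 ≠ 0)) [postDecision]
      (writeMem mem (lowEnd N) [x.toNat]) postDecision.wt (PMF.pure x) := by
  have f₀ : Frame (Set.Ici (lowEnd N)) [] mem (writeMem mem (lowEnd N) [x.toNat]) :=
    Frame.of_writeMem _ _ (by unfold lowEnd; omega)
      (by rw [hg.zero, List.length_singleton]; unfold memEnd; omega) fun _ h _ => h
  have b₀ : Bdd w (writeMem mem (lowEnd N) [x.toNat]) := hb.writeMem _ fun v hv => by
    rw [List.mem_singleton] at hv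
    refine lt_two_pow_of_le_memEnd hw ?_
    have : v ≤ 1 := by cases x <;> simp [hv]
    unfold memEnd lowEnd
    omega
  have e := exec_assign b₀ (.const 0) (.load (val .buf))
  have hev : (Expr.load (val .buf)).eval (writeMem mem (lowEnd N) [x.toNat]) = x.toNat := by
    rw [Expr.eval, eval_val, f₀.hi _ (by decide), hg.buf]
    exact writeMem_getD mem (lowEnd N) [x.toNat] (i := 0) (by simp)
  rw [hev] at e
  have := (halts_nil w O (fun mem => decide (mem 0 ≠ 0)) _).exec e
  simp only [Expr.eval, Function.update_self] at this
  have hx : decide (x.toNat ≠ 0) = x := by cases x <;> rfl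
  rw [hx, zero_add] at this
  exact this

theorem halts_failDecision {mem : ℕ → ℕ} (hb : Bdd w mem) :
    Halts w O (fun mem => decide (mem 0 ≠ 0)) [failDecision] mem failDecision.wt
      (PMF.pure false) := by
  have := (halts_nil w O (fun mem => decide (mem 0 ≠ 0)) _).exec
    (exec_assign hb (.const 0) (.const 0))
  simpa [Expr.eval, failDecision, Cmd.wt] using this

variable [hq : Fact q.Prime]

theorem exec_out (hw : width q N κ m ≤ w) {mem : ℕ → ℕ} (hb : Bdd w mem) (hg : Good B q κ m mem)
    {x : ModQ S q} (hx : Vec B mem .prod x) :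
    ∃ mem', Exec w outCmd mem mem' (outWt N) ∧ decode B q (readMem mem' 0 N) 0 = x := by
  have hN : N ≤ memEnd N m := by unfold memEnd lowEnd; omega
  obtain ⟨m₁, e₁, b₁, f₁, v₁⟩ := exec_lowLoop (m := N - 1) (A := 1) hb
    (lt_two_pow_of_le_memEnd hw (by omega)) (.const 1) (.sub (val .dim) (.const 1))
    (get .prod (.add (val .ctr) (.const 1))) one_pos (by rw [hg.zero]; omega)
    (fun k => hi mem .prod (k + 1)) (fun k _ => hb.hi _ _)
    (fun mem' hF => by simp only [Expr.eval, eval_val, hF.hi .dim (by decide), hg.dim])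
    (fun k _ mem' hF hc => by
      refine ⟨rfl, ?_⟩
      simp only [Expr.eval, eval_get, eval_val, hc]
      exact hF.hi _ (by decide) _)
  have e₂ := exec_assign b₁ (.const 0) (get .prod (.const 0))
  have hev : (get .prod (.const 0)).eval m₁ = hi mem .prod 0 := f₁.hi _ (by decide) 0
  rw [hev] at e₂
  refine ⟨_, (e₁.seq e₂).mono ?_, decode_eq B fun i => ?_⟩
  · have : (N - 1 + 1) * lowWt (.const 1) (.sub (val .dim) (.const 1))
        (get .prod (.add (val .ctr) (.const 1))) ≤ (N + 1) * lowWt (.const 1)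
        (.sub (val .dim) (.const 1)) (get .prod (.add (val .ctr) (.const 1))) :=
      Nat.mul_le_mul_right _ (by omega)
    simp only [outWt, Cmd.wt]
    omega
  · rw [List.getD_eq_getElem _ _ (by simp [readMem])]
    simp only [readMem, List.getElem_map, List.getElem_range, zero_add]
    have h1 : Function.update m₁ ((Expr.const 0).eval m₁) (hi mem .prod 0) i = hi mem .prod i := by
      rw [Expr.eval]
      rcases Nat.eq_zero_or_pos (i : ℕ) with h | h
      · rw [h, Function.update_self]
      · rw [Function.update_of_ne (by omega)]
        have h2 := v₁ (i - 1) (by omega)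
        rwa [show 1 + ((i : ℕ) - 1) = i by omega, Nat.sub_add_cancel h] at h2
    rw [h1, hx i]
    simp

theorem halts_postSearch (hw : width q N κ m ≤ w) {mem : ℕ → ℕ} (hb : Bdd w mem)
    (hg : Good B q κ m mem) {a : (ModQ S q)ˣ} {b : ModQ S q}
    (hinv : Vec B mem .inv (↑a⁻¹ : ModQ S q)) (hsnd : Vec B mem .snd b) (x : ModQ S q) :
    Halts w O (fun mem => decode B q (readMem mem 0 N) 0) [postSearch]
      (writeMem mem (lowEnd N) (encode B q x)) (postSearchWt N)
      (PMF.pure ((↑a⁻¹ : ModQ S q) * (b - x))) := by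
  have f₀ : Frame (Set.Ici (lowEnd N)) [] mem (writeMem mem (lowEnd N) (encode B q x)) :=
    Frame.of_writeMem _ _ (by unfold lowEnd; omega)
      (by rw [length_encode, hg.zero]; unfold memEnd; omega) fun _ h _ => h
  have b₀ := hb.writeMem (lowEnd N) (encode_lt (B := B) hw x)
  have g₀ := hg.frame f₀ (fun _ h => h) (by decide)
  have hx := buf_encode (B := B) mem (lowEnd N) x
  have hsnd₀ := hsnd.frame f₀ (by decide)
  obtain ⟨m₁, e₁, b₁, g₁, f₁, v₁⟩ := exec_vecCrd hw b₀ g₀ .base (by decide)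
    (subExpr (get .snd (val .ctr)) bufExpr) (b - x)
    (fun k mem' g hF hc => by
      rw [crd_sub]
      refine eval_subExpr g.q_eq ?_ ?_
      · simp only [eval_get, eval_val, hc]
        exact hsnd₀.frame hF (by decide) k
      · simp only [bufExpr, Expr.eval, eval_val, g.buf, hc]
        exact hx.frame hF (fun i hi => ⟨by rw [g₀.zero]; unfold memEnd; omega, by simp⟩) k)
  obtain ⟨m₂, e₂, b₂, f₂, v₂⟩ := exec_mul hw b₁ g₁ (dst := .prod)
    ((hinv.frame f₀ (by decide)).frame f₁ (by decide)) v₁ (by decide) (by decide) (by decide)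
  obtain ⟨m₃, e₃, h₃⟩ := exec_out hw b₂ (g₁.frame f₂ (by simp) (by decide)) v₂
  have := (halts_nil w O (fun mem => decode B q (readMem mem 0 N) 0) m₃).exec (e₁.seq (e₂.seq e₃))
  simp only [h₃] at this
  exact this.mono (by simp only [postSearchWt]; omega)

theorem halts_failSearch (hw : width q N κ m ≤ w) {mem : ℕ → ℕ} (hb : Bdd w mem)
    (hg : Good B q κ m mem) :
    Halts w O (fun mem => decode B q (readMem mem 0 N) 0) [failSearch] mem (failSearchWt N)
      (PMF.pure 0) := by
  obtain ⟨m₁, e₁, b₁, g₁, f₁, v₁⟩ := exec_vecCrd hw hb hg .prod (by decide) (.const 0) 0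
    (fun k mem' g hF hc => by simp [Expr.eval, crd_zero])
  obtain ⟨m₃, e₃, h₃⟩ := exec_out hw b₁ g₁ v₁
  have := (halts_nil w O (fun mem => decode B q (readMem mem 0 N) 0) m₃).exec (e₁.seq e₃)
  simp only [h₃] at this
  exact this.mono (by simp only [failSearchWt]; omega)

/-- The output of the program has the distribution of the experiment. -/
theorem halts_main {α : Type*} {n d : ℕ} (ε : ℤˣ) (hw : width q N κ m ≤ w) (hN : N = n * d ^ 2)
    {D : PMF (ModQ S q × ModQ S q)} (hO : O.sample = D.map (encodePair B q))
    {A : List (ModQ S q × ModQ S q) → PMF α} {enc : α → List ℕ}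
    (hO' : ∀ l, O.solver l = (A (decodePairs B q m l)).map enc) {l : ℕ}
    (henc : ∀ x, (enc x).length ≤ l ∧ ∀ v ∈ enc x, v < 2 ^ w) {out : (ℕ → ℕ) → α}
    {post fail : Cmd} {fail' : α} {post' : (ModQ S q)ˣ → ModQ S q → α → α} {p f : ℕ}
    (hpost : ∀ (a : (ModQ S q)ˣ) (b : ModQ S q) (x : α) (mem : ℕ → ℕ), Bdd w mem →
      Good B q κ m mem → Vec B mem .inv (↑a⁻¹ : ModQ S q) → Vec B mem .snd b →
      Halts w O out [post] (writeMem mem (lowEnd N) (enc x)) p (PMF.pure (post' a b x)))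
    (hfail : ∀ mem, Bdd w mem → Good B q κ m mem → Halts w O out [fail] mem f (PMF.pure fail'))
    {mem : ℕ → ℕ} (hb : Bdd w mem) (hin : HasInput B q κ m mem) (hn : mem 0 = n) :
    Halts w O out [mainCmd d ε post fail] mem (mainWt d ε N w κ m l p f)
      (normalFormExperiment ε κ m A fail' post' D) := by
  obtain ⟨m₁, e₁, b₁, g₁⟩ := exec_init hw hN hb hin hn
  refine ((Halts.exec ?_ e₁).seq (τ := p + f + queryWt ε N m l + 1 + (val .flag).wt +
    findWt N w κ + 1 + initWt d N)).mono (by simp only [mainWt]; omega)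
  refine Halts.seq (halts_find hw hO (fun r mem hb hg hF => ?_) b₁ g₁)
  refine Halts.ite hb ?_
  rcases r with _ | ⟨a, b⟩
  · rw [eval_val, hF, if_neg (not_not.2 rfl)]
    exact (hfail mem hb hg).mono (by omega)
  · rw [eval_val, hF.1, if_pos one_ne_zero]
    exact ((halts_query ε hw hO hO' henc (fun x mem hb hg h1 h2 => hpost a b x mem hb hg h1 h2)
      hb hg hF.2.1 hF.2.2).seq).mono (by omega)

end Programs

end RAM

/-! ### The input -/

theorem List.length_flatten_ofFn {α : Type*} {a L : ℕ} (f : Fin a → List α)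
    (hL : ∀ i, (f i).length = L) : (List.ofFn f).flatten.length = a * L := by
  rw [List.length_flatten, List.map_ofFn, List.sum_ofFn]
  simp [hL]

theorem List.getElem?_flatten_ofFn {α : Type*} {a L : ℕ} (f : Fin a → List α)
    (hL : ∀ i, (f i).length = L) (i : Fin a) {r : ℕ} (hr : r < L) :
    (List.ofFn f).flatten[i * L + r]? = (f i)[r]? := by
  induction a with
  | zero => exact i.elim0
  | succ a ih =>
    rw [List.ofFn_succ, List.flatten_cons]
    refine Fin.cases ?_ (fun i => ?_) i
    · rw [Fin.val_zero, zero_mul, zero_add, List.getElem?_append_left (by rw [hL]; exact hr)]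
    · rw [Fin.val_succ, Nat.succ_mul, List.getElem?_append_right (by rw [hL]; omega), hL,
        show (i : ℕ) * L + L + r - L = i * L + r by omega]
      exact ih (fun i => f i.succ) (fun i => hL _) i

namespace RAM

section Input

variable {S : Type*} [Ring S] {N : ℕ} (B : Module.Basis (Fin N) ℤ S) (n d q κ m : ℕ)

theorem writeMem_zero_apply (l : List ℕ) (k : ℕ) : writeMem (fun _ => 0) 0 l k = l.getD k 0 := by
  rw [writeMem]
  split_ifs with h
  · simp
  · rw [List.getD_eq_default _ _ (by omega)]

variable [hq : Fact q.Prime]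

theorem hasInput_instanceInput :
    HasInput B q κ m (writeMem (fun _ => 0) 0 (instanceInput B n d q κ m)) where
  q_eq := by simp [writeMem_zero_apply, instanceInput]
  κ_eq := by simp [writeMem_zero_apply, instanceInput]
  m_eq := by simp [writeMem_zero_apply, instanceInput]
  one_eq i := by
    have hl := length_encode B (1 : ModQ S q)
    rw [writeMem_zero_apply, List.getD_eq_getElem?_getD, instanceInput,
      List.getElem?_append_left (by simp [hl]; omega), List.getElem?_append_right (by simp)]
    simp [encode_eq]
  struct_eq i j k := by
    have hl := length_encode B (1 : ModQ S q)
    have h1 : (j : ℕ) * N + k < N * N := by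
      have h2 : ((j : ℕ) + 1) * N ≤ N * N := Nat.mul_le_mul_right _ j.2
      rw [Nat.succ_mul] at h2
      omega
    rw [writeMem_zero_apply, List.getD_eq_getElem?_getD, instanceInput,
      List.getElem?_append_right (by simp [hl]; omega)]
    rw [show 5 + N + ((i * N + j) * N + k) - ([n, d, q, κ, m] ++ encode B q 1).length =
      i * (N * N) + (j * N + k) by
        rw [List.length_append, hl]
        simp only [List.length_cons, List.length_nil]
        rw [Nat.add_sub_cancel_left]
        ring]
    rw [List.getElem?_flatten_ofFn _ (fun i => List.length_flatten_ofFn _ fun j =>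
      length_encode B _) i h1, List.getElem?_flatten_ofFn _ (fun j => length_encode B _) j k.2]
    simp [encode_eq]

variable {n d q κ m} {w : ℕ}

theorem bdd_instanceInput (hw : width q N κ m ≤ w) (hN : N = n * d ^ 2) (hn : 0 < n) (hd : 0 < d) :
    Bdd w (writeMem (fun _ => 0) 0 (instanceInput B n d q κ m)) := by
  have hd2 : 0 < d ^ 2 := pow_pos hd 2
  have hN0 : 0 < N := hN ▸ Nat.mul_pos hn hd2
  have hnN : n ≤ N := hN ▸ Nat.le_mul_of_pos_right n hd2
  have hdN : d ≤ N := hN ▸ (Nat.le_self_pow two_ne_zero d).trans (Nat.le_mul_of_pos_left _ hn)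
  have hNm : N ≤ memEnd N m := by unfold memEnd lowEnd; omega
  have hmm : m ≤ memEnd N m := by
    have := Nat.le_mul_of_pos_left m (show 0 < 2 * N by omega)
    unfold memEnd
    omega
  refine Bdd.writeMem (fun _ => by positivity) 0 fun v hv => ?_
  simp only [instanceInput, List.mem_append, List.mem_cons, List.not_mem_nil, or_false] at hv
  rcases hv with ((rfl | rfl | rfl | rfl | rfl) | hv) | hv
  · exact lt_two_pow_of_le_memEnd hw (hnN.trans hNm)
  · exact lt_two_pow_of_le_memEnd hw (hdN.trans hNm)
  · rw [← pow_one v]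
    exact q_pow_lt_two_pow hq.out.pos hw (Nat.pow_pos hN0)
  · refine Nat.lt_two_pow_self.trans_le (Nat.pow_le_pow_right two_pos (le_trans ?_ hw))
    unfold width
    omega
  · exact lt_two_pow_of_le_memEnd hw hmm
  · exact encode_lt hw _ v hv
  · obtain ⟨l, hl, hv⟩ := List.mem_flatten.1 hv
    rw [List.mem_ofFn] at hl
    obtain ⟨i, rfl⟩ := hl
    obtain ⟨l, hl, hv⟩ := List.mem_flatten.1 hv
    rw [List.mem_ofFn] at hl
    obtain ⟨j, rfl⟩ := hl
    exact encode_lt hw _ v hv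

end Input

/-! ### The running time -/

/-- Functions that are bounded by a polynomial in the size `X` of their argument. -/
def PolyBdd {ι : Type*} (X f : ι → ℕ) : Prop := ∃ P : Polynomial ℕ, ∀ v, f v ≤ P.eval (X v)

namespace PolyBdd

variable {ι : Type*} {X f g : ι → ℕ}

theorem const (c : ℕ) : PolyBdd X fun _ => c := ⟨.C c, fun v => by simp⟩

theorem of_le (h : ∀ v, f v ≤ X v) : PolyBdd X f := ⟨.X, fun v => by simpa using h v⟩

theorem add (hf : PolyBdd X f) (hg : PolyBdd X g) : PolyBdd X fun v => f v + g v := by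
  obtain ⟨P, hP⟩ := hf
  obtain ⟨Q, hQ⟩ := hg
  exact ⟨P + Q, fun v => by simpa using add_le_add (hP v) (hQ v)⟩

theorem mul (hf : PolyBdd X f) (hg : PolyBdd X g) : PolyBdd X fun v => f v * g v := by
  obtain ⟨P, hP⟩ := hf
  obtain ⟨Q, hQ⟩ := hg
  exact ⟨P * Q, fun v => by simpa using Nat.mul_le_mul (hP v) (hQ v)⟩

end PolyBdd

/-- The time that is sufficient for `mainCmd`, for numbers `n, q, κ, m` in the input and with the
dimension `N = n d ^ 2`. The length of the reply of the solver and the times for its treatment and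
for failure depend on `N`. -/
def mainTime (d : ℕ) (ε : ℤˣ) (l p f : ℕ → ℕ) (n q κ m : ℕ) : ℕ :=
  mainWt d ε (n * d ^ 2) (width q (n * d ^ 2) κ m) κ m (l (n * d ^ 2)) (p (n * d ^ 2))
    (f (n * d ^ 2)) * (width q (n * d ^ 2) κ m + 1)

theorem exists_mainTime_le (d : ℕ) (ε : ℤˣ) (l p f : ℕ → ℕ)
    (hl : ∀ {ι : Type} {X N : ι → ℕ}, PolyBdd X N → PolyBdd X fun v => l (N v))
    (hp : ∀ {ι : Type} {X N : ι → ℕ}, PolyBdd X N → PolyBdd X fun v => p (N v))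
    (hf : ∀ {ι : Type} {X N : ι → ℕ}, PolyBdd X N → PolyBdd X fun v => f (N v)) :
    ∃ P : Polynomial ℕ, ∀ n q κ m, mainTime d ε l p f n q κ m ≤ P.eval (n + q.size + κ + m) := by
  let X : ℕ × ℕ × ℕ × ℕ → ℕ := fun v => v.1 + v.2.1.size + v.2.2.1 + v.2.2.2
  suffices h : PolyBdd X fun v => mainTime d ε l p f v.1 v.2.1 v.2.2.1 v.2.2.2 by
    obtain ⟨P, hP⟩ := h
    exact ⟨P, fun n q κ m => hP (n, q, κ, m)⟩
  have hs : PolyBdd X fun v => v.2.1.size := .of_le fun v => by simp only [X]; omega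
  have hκ : PolyBdd X fun v => v.2.2.1 := .of_le fun v => by simp only [X]; omega
  have hm : PolyBdd X fun v => v.2.2.2 := .of_le fun v => by simp only [X]; omega
  have hN : PolyBdd X fun v => v.1 * d ^ 2 :=
    .mul (.of_le fun v => by simp only [X]; omega) (.const _)
  have hw : PolyBdd X fun v => width v.2.1 (v.1 * d ^ 2) v.2.2.1 v.2.2.2 := by
    unfold width memEnd lowEnd
    simp only [pow_two (_ * d ^ 2)]
    with_reducible repeat' first
      | assumption
      | exact PolyBdd.const _
      | apply PolyBdd.add
      | apply PolyBdd.mul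
  have hl' := hl hN
  have hp' := hp hN
  have hf' := hf hN
  unfold mainTime mainWt queryWt roundBodyWt roundStepWt findWt findBodyWt findStepWt unitWt
    powBodyWt mulWt initWt
  with_reducible repeat' first
    | assumption
    | exact PolyBdd.const _
    | apply PolyBdd.add
    | apply PolyBdd.mul

theorem PolyBdd.postSearchWt {ι : Type} {X N : ι → ℕ} (hN : PolyBdd X N) :
    PolyBdd X fun v => RAM.postSearchWt (N v) := by
  unfold RAM.postSearchWt mulWt outWt
  with_reducible repeat' first
    | assumption
    | exact PolyBdd.const _
    | apply PolyBdd.add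
    | apply PolyBdd.mul

theorem PolyBdd.failSearchWt {ι : Type} {X N : ι → ℕ} (hN : PolyBdd X N) :
    PolyBdd X fun v => RAM.failSearchWt (N v) := by
  unfold RAM.failSearchWt outWt
  with_reducible repeat' first
    | assumption
    | exact PolyBdd.const _
    | apply PolyBdd.add
    | apply PolyBdd.mul

/-- The time that is sufficient for the reduction of the search problem. -/
def searchTime (d : ℕ) (ε : ℤˣ) : ℕ → ℕ → ℕ → ℕ → ℕ :=
  mainTime d ε id postSearchWt failSearchWt

/-- The time that is sufficient for the reduction of the decision problem. -/
def decisionTime (d : ℕ) (ε : ℤˣ) : ℕ → ℕ → ℕ → ℕ → ℕ :=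
  mainTime d ε (fun _ => 1) (fun _ => postDecision.wt) (fun _ => failDecision.wt)

/-- Every step costs at least one unit of time, so that the time bound also bounds the number of
steps. -/
theorem Halts.start {α : Type*} {w : ℕ} {O : Oracles} {out : (ℕ → ℕ) → α} {R : Cmd} {τ T : ℕ}
    {φ : PMF α} {input : List ℕ}
    (h : Halts w O out [R] (writeMem (fun _ => 0) 0 input) τ φ) (hT : τ * (w + 1) ≤ T) :
    HaltsWithin O R input T ∧ (run O T (start R input)).map (fun c => out c.mem) = φ := by
  obtain ⟨h1, h2⟩ := h 0 T hT
  exact ⟨fun c hc => ⟨(h2 c hc).1, (h2 c hc).2.trans (by omega)⟩, h1⟩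

section Run

variable {S : Type*} [Ring S] {n d q κ m T : ℕ} (B : Module.Basis (Fin (n * d ^ 2)) ℤ S)
  [hq : Fact q.Prime] (ε : ℤˣ) (D : PMF (ModQ S q × ModQ S q))

theorem search_run (hn : 0 < n) (hd : 0 < d) (hT : searchTime d ε n q κ m ≤ T)
    (A : List (ModQ S q × ModQ S q) → PMF (ModQ S q)) :
    HaltsWithin (searchOracles B q m A D) (mainCmd d ε postSearch failSearch)
        (instanceInput B n d q κ m) T ∧
      searchOutput B n d q κ m (mainCmd d ε postSearch failSearch) T A D =
        normalFormSearch ε κ m A D := by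
  have hw := le_refl (width q (n * d ^ 2) κ m)
  exact (halts_main (O := searchOracles B q m A D) (enc := encode B q) ε hw rfl rfl (fun _ => rfl)
    (fun x => ⟨(length_encode B x).le, encode_lt hw x⟩)
    (fun a b x mem hb hg h1 h2 => halts_postSearch hw hb hg h1 h2 x)
    (fun mem hb hg => halts_failSearch hw hb hg) (bdd_instanceInput B hw rfl hn hd)
    (hasInput_instanceInput B n d q κ m) (by simp [writeMem_zero_apply, instanceInput])).start hT

theorem decision_run (hn : 0 < n) (hd : 0 < d) (hT : decisionTime d ε n q κ m ≤ T)
    (A : List (ModQ S q × ModQ S q) → PMF Bool) :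
    HaltsWithin (decisionOracles B q m A D) (mainCmd d ε postDecision failDecision)
        (instanceInput B n d q κ m) T ∧
      decisionOutput B n d q κ m (mainCmd d ε postDecision failDecision) T A D =
        normalFormDecision ε κ m A D := by
  have hw := le_refl (width q (n * d ^ 2) κ m)
  have hpos : ∀ b : Bool, b.toNat < 2 ^ width q (n * d ^ 2) κ m := fun b =>
    lt_two_pow_of_le_memEnd hw (by have := b.toNat_le; unfold memEnd lowEnd; omega)
  exact (halts_main (O := decisionOracles B q m A D) (enc := fun b => [b.toNat]) ε hw rfl rfl
    (fun _ => rfl) (fun x => ⟨le_rfl, fun v hv => List.mem_singleton.1 hv ▸ hpos x⟩)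
    (fun _ _ x mem hb hg _ _ => halts_postDecision hw hb hg x)
    (fun mem hb _ => halts_failDecision hb) (bdd_instanceInput B hw rfl hn hd)
    (hasInput_instanceInput B n d q κ m) (by simp [writeMem_zero_apply, instanceInput])).start hT

end Run

end RAM

end

theorem mainTheorem6 (d : ℕ) (ε : ℤˣ) :
    ∃ (Rs Rd : RAM.Cmd) (P : Polynomial ℕ),
      ∀ (K L : Type*) [Field K] [NumberField K] [Field L] [NumberField L] [Algebra K L]
        [IsGalois K L] (n : ℕ) (_ : Module.finrank ℚ K = n) (_ : Module.finrank K L = d)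
        (θ : L ≃ₐ[K] L) (_ : ∀ g : L ≃ₐ[K] L, g ∈ Subgroup.zpowers θ)
        (γ : 𝓞 K) (q : ℕ) [Fact q.Prime] (_ : n + 1 ≤ q)
        -- `q` splits completely in `K`, is unramified in `L`, and no prime above `q` contains `γ`
        (_ : (Ideal.primesOver (Ideal.span {(q : ℤ)}) (𝓞 K)).ncard = n)
        (_ : Squarefree (Ideal.span {(q : 𝓞 L)}))
        (_ : ∀ p ∈ Ideal.primesOver (Ideal.span {(q : ℤ)}) (𝓞 K), γ ∉ p)
        (B : Module.Basis (Fin (n * d ^ 2)) ℤ (NaturalOrder θ γ)) (κ m : ℕ),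
      -- the reduction between the search problems
      (∀ A : List (ModQ (NaturalOrder θ γ) q × ModQ (NaturalOrder θ γ) q) →
            PMF (ModQ (NaturalOrder θ γ) q),
        (∀ D : PMF (ModQ (NaturalOrder θ γ) q × ModQ (NaturalOrder θ γ) q),
          RAM.HaltsWithin (searchOracles B q m A D) Rs (instanceInput B n d q κ m)
            (P.eval (n + q.size + κ + m)) ∧
          searchOutput B n d q κ m Rs (P.eval (n + q.size + κ + m)) A D =
            normalFormSearch ε κ m A D) ∧
        ∀ (χ : PMF (ModQ (NaturalOrder θ γ) q)) (_ : ε = -1 ∨ ∀ x, χ (-x) = χ x)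
          (G : Finset (ModQ (NaturalOrder θ γ) q)) (hG : G.Nonempty),
          (1 - (1 - Real.exp (-(d : ℝ))) ^ κ) * searchSuccess χ χ (onSamples m A) ≤
            searchSuccess (PMF.uniformOfFinset G hG) χ
              (searchOutput B n d q κ m Rs (P.eval (n + q.size + κ + m)) A)) ∧
      -- the reduction between the decision problems
      (∀ A : List (ModQ (NaturalOrder θ γ) q × ModQ (NaturalOrder θ γ) q) → PMF Bool,
        (∀ D : PMF (ModQ (NaturalOrder θ γ) q × ModQ (NaturalOrder θ γ) q),
          RAM.HaltsWithin (decisionOracles B q m A D) Rd (instanceInput B n d q κ m)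
            (P.eval (n + q.size + κ + m)) ∧
          decisionOutput B n d q κ m Rd (P.eval (n + q.size + κ + m)) A D =
            normalFormDecision ε κ m A D) ∧
        ∀ (χ : PMF (ModQ (NaturalOrder θ γ) q)) (_ : ε = -1 ∨ ∀ x, χ (-x) = χ x)
          (G : Finset (ModQ (NaturalOrder θ γ) q)) (hG : G.Nonempty),
          (1 - (1 - Real.exp (-(d : ℝ))) ^ κ) * decisionAdvantage χ χ (onSamples m A) ≤
            decisionAdvantage (PMF.uniformOfFinset G hG) χ
              (decisionOutput B n d q κ m Rd (P.eval (n + q.size + κ + m)) A)) := by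
  obtain ⟨P, hP⟩ := RAM.exists_mainTime_le d ε id RAM.postSearchWt RAM.failSearchWt id
    RAM.PolyBdd.postSearchWt RAM.PolyBdd.failSearchWt
  obtain ⟨Q, hQ⟩ := RAM.exists_mainTime_le d ε (fun _ => 1) (fun _ => RAM.postDecision.wt)
    (fun _ => RAM.failDecision.wt) (fun _ => .const _) (fun _ => .const _) (fun _ => .const _)
  refine ⟨RAM.mainCmd d ε RAM.postSearch RAM.failSearch,
    RAM.mainCmd d ε RAM.postDecision RAM.failDecision, P + Q, ?_⟩
  intro K L _ _ _ _ _ _ n hn hd θ hθ γ q _ hnq hsplit hsq hγ B κ m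
  have hn0 : 0 < n := hn ▸ Module.finrank_pos
  have hd0 : 0 < d := hd ▸ Module.finrank_pos
  have hc := exp_neg_le_unit_density n d θ hθ γ q hnq hsplit hsq hγ B
  rw [Polynomial.eval_add]
  set T := P.eval (n + q.size + κ + m) + Q.eval (n + q.size + κ + m)
  constructor
  · intro A
    have h := fun D => RAM.search_run (T := T) B ε D hn0 hd0
      ((hP n q κ m).trans (Nat.le_add_right _ _)) A
    refine ⟨h, fun χ hχ G hG => ?_⟩
    rw [funext fun D => (h D).2]
    exact searchSuccess_normalForm ε κ m A χ _ hχ hc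
  · intro A
    have h := fun D => RAM.decision_run (T := T) B ε D hn0 hd0
      ((hQ n q κ m).trans (Nat.le_add_left _ _)) A
    refine ⟨h, fun χ hχ G hG => ?_⟩
    rw [funext fun D => (h D).2]
    exact decisionAdvantage_normalForm ε κ m A χ _ hχ hc
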